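/- Let $\mathbb Z_*=\mathbb Z\setminus\{0\}$. For $s\in\mathbb R$ let $\ell^2_s$ be the Hilbert space of complex sequences $q=(q_j)_{j\in\mathbb Z_*}$ with $\|q\|_s^2=\sum_{j\in\mathbb Z_*}|q_j|^2|j|^{2s}<\infty$. In the Fourier coordinates $u=\sum_{j\in\mathbb Z_*} q_j\,e^{\mathrm i jx}/\sqrt{2\pi}$, the periodic derivative nonlinear Schrödinger equation $\mathrm i u_t+u_{xx}+\mathrm i(|u|^2u)_x=0$ is the Hamiltonian system $\dot q_j=-\mathrm i j\,\partial H/\partial\bar q_j$ with $H=\Lambda+G$, $$\Lambda=\sum_{j\in\mathbb Z_*}j|q_j|^2,\qquad G=\frac1{4\pi}\sum_{\substack{j,k,l,m\in\mathbb Z_*\\ j-k+l-m=0}}q_j\bar q_kq_l\bar q_m .$$ For a real-valued function $F$, let $X_F$ be its Hamiltonian vector field, with $q_j$-components $(X_F)_j=-\mathrm i j\,\partial F/\partial\bar q_j$; the corresponding symplectic form is $\omega=-\mathrm i\sum_{j\in\mathbb Z_*}j^{-1}\,dq_j\wedge d\bar q_j$. For $r\ge 1$ put $$\mathcal M_r=\{(j_1,\dots,j_{2r})\in\mathbb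 Z_*^{2r}:\ j_1-j_2+\cdots+j_{2r-1}-j_{2r}=0\},$$ and let $j_1^*\ge j_2^*\ge\cdots\ge j_{2r}^*$ denote the decreasing rearrangement of $|j_1|,\dots,|j_{2r}|$. There is a constant $C>0$ such that for every $s>1$ there is a real analytic symplectic coordinate transformation $\Psi$ defined in a neighbourhood $U$ of the origin of $\ell^2_s$ (a bijection of $U$ onto an open neighbourhood of the origin, with $\Psi(0)=0$, real analytic together with its inverse, and $\Psi^*\omega=\omega$) such that on $U$ $$H\circ\Psi=\Lambda+B+R,\qquad B=-\frac1{4\pi}\sum_{j\in\mathbb Z_*}|q_j|^4+\frac1{2\pi}\Big(\sum_{j\in\mathbb Z_*}|q_j|^2\Big)^2,$$ where $R:U\to\mathbb R$ is real analytic and of order at least $6$ at the origin, that is $R=O(\|q\|_s^6)$ as $q\to0$; its vector field $X_R$ maps $U$ into $\ell^2_{s-1}$, with $$\|X_R\|_{s-1}=O(\|q\|_s^5)\quad\text{as } q\to0 .$$ Moreover, on $U$ the function $R$ is given by an absolutely convergent series $$R=\sum_{r\ge3}\ \sum_{(j_1,\dots,j_{2r})\in\mathcal M_r}c(j_1,\dots,j_{2r})\,q_{j_1}\bar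 q_{j_2}\cdots q_{j_{2r-1}}\bar q_{j_{2r}}$$ whose coefficients satisfy, for all $r\ge3$ and $(j_1,\dots,j_{2r})\in\mathcal M_r$, $$|c(j_1,\dots,j_{2r})|<C^r\Big(\frac{j_2^*j_3^*\cdots j_{2r}^*}{j_1^*}\Big)^{1/2}.$$ -/

import Mathlib

open scoped ComplexConjugate Topology
open Asymptotics

noncomputable section

namespace DNLS

/-- The nonzero integers. -/
abbrev ZStar : Type := {j : ℤ // j ≠ 0}

/-- Complex sequences `(q_j)`, `j ≠ 0`, with `∑ |q_j|² |j|^{2s} < ∞`, as a linear subspace of all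
sequences. -/
def ell2Sub (s : ℝ) : Submodule ℂ (ZStar → ℂ) where
  carrier := {q | Summable fun j : ZStar => ‖q j‖ ^ 2 * |(j.1 : ℝ)| ^ (2 * s)}
  zero_mem' := by
    simp
  add_mem' := by
    intro a b ha hb
    refine Summable.of_nonneg_of_le (fun j => by positivity) (fun j => ?_)
      ((ha.add hb).mul_left 2)
    have h1 : ‖a j + b j‖ ^ 2 ≤ 2 * (‖a j‖ ^ 2 + ‖b j‖ ^ 2) := by
      have := norm_add_le (a j) (b j)
      nlinarith [sq_nonneg (‖a j‖ - ‖b j‖), norm_nonneg (a j + b j), norm_nonneg (a j),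
        norm_nonneg (b j)]
    have h2 : 0 ≤ |(j.1 : ℝ)| ^ (2 * s) := by positivity
    calc ‖(a + b) j‖ ^ 2 * |(j.1 : ℝ)| ^ (2 * s)
        ≤ 2 * (‖a j‖ ^ 2 + ‖b j‖ ^ 2) * |(j.1 : ℝ)| ^ (2 * s) :=
          mul_le_mul_of_nonneg_right h1 h2
      _ = _ := by ring
  smul_mem' := by
    intro c a ha
    refine (Summable.mul_left (‖c‖ ^ 2) ha).congr (fun j => ?_)
    simp only [Pi.smul_apply, smul_eq_mul, norm_mul]
    ring

/-- The space `ℓ²_s`. It is a type of its own, so that it carries the topology of its norm and not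
the one of pointwise convergence. -/
def Ell2 (s : ℝ) : Type := ell2Sub s

namespace Ell2

variable {s : ℝ}

instance : AddCommGroup (Ell2 s) := inferInstanceAs (AddCommGroup (ell2Sub s))

instance : Module ℂ (Ell2 s) := inferInstanceAs (Module ℂ (ell2Sub s))

instance : CoeFun (Ell2 s) (fun _ => ZStar → ℂ) := ⟨fun q => q.1⟩

theorem summable (q : Ell2 s) : Summable fun j : ZStar => ‖q j‖ ^ 2 * |(j.1 : ℝ)| ^ (2 * s) := q.2

theorem weight_sq (j : ZStar) (z : ℂ) :
    ‖((|(j.1 : ℝ)| ^ s : ℝ) : ℂ) * z‖ ^ (2 : ℝ) = ‖z‖ ^ 2 * |(j.1 : ℝ)| ^ (2 * s) := by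
  have h : (0 : ℝ) ≤ |(j.1 : ℝ)| := abs_nonneg _
  have h' : (0 : ℝ) ≤ |(j.1 : ℝ)| ^ s := by positivity
  rw [norm_mul, Complex.norm_real, Real.norm_of_nonneg h', Real.rpow_two, mul_pow, mul_comm 2 s,
    Real.rpow_mul h, Real.rpow_two]
  ring

/-- The weighting `(q_j) ↦ (|j|^s q_j)` of `ℓ²_s` into `ℓ²`. -/
def toLp (s : ℝ) : Ell2 s →ₗ[ℂ] lp (fun _ : ZStar => ℂ) 2 where
  toFun q := ⟨fun j => ((|(j.1 : ℝ)| ^ s : ℝ) : ℂ) * q j, by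
    apply memℓp_gen
    refine q.summable.congr (fun j => ?_)
    rw [ENNReal.toReal_ofNat, weight_sq]⟩
  map_add' p q := by
    ext j
    exact mul_add _ _ _
  map_smul' c q := by
    ext j
    exact mul_left_comm _ _ _

theorem toLp_injective (s : ℝ) : Function.Injective (toLp s) := by
  intro p q h
  apply Subtype.ext
  funext j
  have h1 : ((|(j.1 : ℝ)| ^ s : ℝ) : ℂ) * p j = ((|(j.1 : ℝ)| ^ s : ℝ) : ℂ) * q j :=
    congrFun (congrArg Subtype.val h) j
  have h2 : (0 : ℝ) < |(j.1 : ℝ)| ^ s :=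
    Real.rpow_pos_of_pos (abs_pos.2 (Int.cast_ne_zero.2 j.2)) s
  exact mul_left_cancel₀ (Complex.ofReal_ne_zero.2 h2.ne') h1

instance : NormedAddCommGroup (Ell2 s) :=
  NormedAddCommGroup.induced (Ell2 s) (lp (fun _ : ZStar => ℂ) 2) (toLp s) (toLp_injective s)

instance : NormedSpace ℂ (Ell2 s) :=
  NormedSpace.induced ℂ (Ell2 s) (lp (fun _ : ZStar => ℂ) 2) (toLp s)

/-- The norm is the expected one: `‖q‖_s² = ∑ |q_j|² |j|^{2s}`. -/
theorem norm_sq (q : Ell2 s) : ‖q‖ ^ 2 = ∑' j : ZStar, ‖q j‖ ^ 2 * |(j.1 : ℝ)| ^ (2 * s) := by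
  have h : ‖toLp s q‖ ^ (2 : ℝ) = ∑' j : ZStar, ‖(toLp s q) j‖ ^ (2 : ℝ) := by
    simpa using lp.norm_rpow_eq_tsum (p := 2) (by norm_num) (toLp s q)
  rw [Real.rpow_two] at h
  change ‖toLp s q‖ ^ 2 = _
  rw [h]
  exact tsum_congr fun j => weight_sq j (q j)

/-- The sequence with entry `z` at the place `j` and `0` elsewhere. -/
def single (s : ℝ) (j : ZStar) (z : ℂ) : Ell2 s :=
  ⟨Pi.single j z, by
    refine summable_of_ne_finset_zero (s := {j}) (fun k hk => ?_)
    have hk' : k ≠ j := by simpa using hk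
    simp [Pi.single_eq_of_ne hk']⟩

end Ell2

/-- The zero momentum index set
`M_r = {(j_1, …, j_{2r}) : j_1 - j_2 + ⋯ + j_{2r-1} - j_{2r} = 0}` of nonzero integers. The entry
`j_{i+1}` is `j i`, so that even places carry the sign `+`. -/
def zeroMomentum (r : ℕ) : Set (Fin (2 * r) → ZStar) :=
  {j | ∑ i : Fin (2 * r), (-1 : ℤ) ^ (i : ℕ) * (j i).1 = 0}

/-- The monomial `q_{j_1} q̄_{j_2} ⋯ q_{j_{2r-1}} q̄_{j_{2r}}`. -/
def monomial {r : ℕ} (j : Fin (2 * r) → ZStar) (q : ZStar → ℂ) : ℂ :=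
  ∏ i : Fin (2 * r), if Even (i : ℕ) then q (j i) else conj (q (j i))

/-- The decreasing rearrangement `j_1^* ≥ j_2^* ≥ ⋯` of `|j_1|, |j_2|, …`; the entry `j_{i+1}^*` is
`decr j i`. -/
def decr {n : ℕ} (j : Fin n → ZStar) (i : Fin n) : ℤ :=
  |(j (Tuple.sort (fun k => -|(j k).1|) i)).1|

theorem decr_antitone {n : ℕ} (j : Fin n → ZStar) : Antitone (decr j) := fun _ _ h =>
  neg_le_neg_iff.1 (Tuple.monotone_sort (fun k => -|(j k).1|) h)

/-- The quotient `j_2^* j_3^* ⋯ j_n^* / j_1^*`. -/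
def decrQuot {n : ℕ} (j : Fin n → ZStar) : ℝ :=
  ∏ i : Fin n, if (i : ℕ) = 0 then ((decr j i : ℝ))⁻¹ else (decr j i : ℝ)

/-- `Λ = ∑ j |q_j|²`. -/
def Lam {s : ℝ} (q : Ell2 s) : ℝ := ∑' j : ZStar, (j.1 : ℝ) * ‖q j‖ ^ 2

/-- `G = (1/4π) ∑_{j-k+l-m=0} q_j q̄_k q_l q̄_m`. -/
def G {s : ℝ} (q : Ell2 s) : ℂ :=
  1 / (4 * Real.pi) * ∑' j : zeroMomentum 2, monomial j.1 q

/-- The Hamiltonian `H = Λ + G` of the derivative nonlinear Schrödinger equation. -/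
def H {s : ℝ} (q : Ell2 s) : ℂ := Lam q + G q

/-- `B = -(1/4π) ∑ |q_j|⁴ + (1/2π) (∑ |q_j|²)²`. -/
def B {s : ℝ} (q : Ell2 s) : ℝ :=
  -(1 / (4 * Real.pi)) * ∑' j : ZStar, ‖q j‖ ^ 4
    + 1 / (2 * Real.pi) * (∑' j : ZStar, ‖q j‖ ^ 2) ^ 2

/-- The Wirtinger derivative `∂F/∂q̄_j = (1/2) (∂F/∂(Re q_j) + i ∂F/∂(Im q_j))`. -/
def dbar {s : ℝ} (F : Ell2 s → ℂ) (q : Ell2 s) (j : ZStar) : ℂ :=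
  1 / 2 * (fderiv ℝ F q (Ell2.single s j 1) + Complex.I * fderiv ℝ F q (Ell2.single s j Complex.I))

/-- The Hamiltonian vector field of a real-valued `F`, in the coordinates `q_j`:
`(X_F)_j = -i j ∂F/∂q̄_j` (the `q̄_j`-components are the complex conjugates of these). -/
def hamVec {s : ℝ} (F : Ell2 s → ℝ) (q : Ell2 s) (j : ZStar) : ℂ :=
  -Complex.I * (j.1 : ℂ) * dbar (fun p => (F p : ℂ)) q j

/-- The symplectic form `ω = -i ∑ j⁻¹ dq_j ∧ dq̄_j`, where
`(dq_j ∧ dq̄_j)(h, k) = h_j k̄_j - h̄_j k_j`. It is the form that belongs to the vector fields above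
and to the bracket `{H, F} = -i ∑ j (∂H/∂q_j ∂F/∂q̄_j - ∂H/∂q̄_j ∂F/∂q_j) = dH(X_F)`:
the identity `ω(h, X_F) = dF(h)` says `(X_F)_j = -i j ∂F/∂q̄_j`. -/
def symplForm {s : ℝ} (h k : Ell2 s) : ℂ :=
  -Complex.I * ∑' j : ZStar, ((j.1 : ℂ))⁻¹ * (h j * conj (k j) - conj (h j) * k j)

/-- A real analytic symplectic coordinate transformation between neighbourhoods of the origin,
fixing the origin: a bijection of two open sets, real analytic in both directions, whose derivative
preserves the symplectic form. -/
structure IsAnalyticSymplectic {s : ℝ} (Ψ : OpenPartialHomeomorph (Ell2 s) (Ell2 s)) : Prop where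
  zero_mem : (0 : Ell2 s) ∈ Ψ.source
  map_zero : Ψ 0 = 0
  analytic : AnalyticOnNhd ℝ Ψ Ψ.source
  analytic_symm : AnalyticOnNhd ℝ Ψ.symm Ψ.target
  symplectic : ∀ q ∈ Ψ.source, ∀ h k : Ell2 s,
    symplForm (fderiv ℝ Ψ q h) (fderiv ℝ Ψ q k) = symplForm h k

end DNLS

end

noncomputable section

namespace DNLS

/-! ### Sums of products -/

/-! The proof is one step of Birkhoff normal form, with Ψ the time one map of the Hamiltonian flow
of a quartic function F. Under the bracket with Λ the monomial q_k q̄_l q_m q̄_J is multiplied by a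
constant times k² − l² + m² − J², and for k − l + m = J this number is −2(J − k)(J − m). It vanishes
only if {k, m} = {l, J}. These resonant terms of G add up to B; all others are removed by dividing
by the divisor. The vector field of F is therefore trilinear with the kernel `kern`, and the
derivative of Λ along it is B − G (`poly_bracket_lamCoef`, `B_eq_poly`). Taylor expansion of Λ and G
in the time of the flow then leaves Λ + B and terms of degree at least 6.

All estimates rest on one class of coefficients, `QuotBound`: |c_j| max |j_p| ≤ A ∏ |j_p|^{1/2},
which is the bound asserted for R. Three facts make it work. The divisors put the generating field
in this class (`abs_kern_mul_wt_le`, `fieldCoef_quotBound`), although the field of G itself contains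
the unbounded factor J. The class is stable under insertion of the field at one place, with the same
A (`QuotBound.contract`). So m brackets cost only 2^m (m+1)! (`iterBracket_quotBound`), and the
Taylor factor 1/m! leaves geometric growth, which gives a constant C independent of s. At zero
momentum such a form stays bounded when one argument is only in ℓ²_{-s}, because the largest index
is comparable to another one (`QuotBound.summable_pairing`). By duality the generating field maps
ℓ²_s into itself, and the gradient of R lies in ℓ²_s, so that X_R lies in ℓ²_{s-1}.

As the generating field is a bounded polynomial, its flow comes from the analytic inverse function
theorem in a space of curves (`exists_isFlow`). The flow is symplectic because the linearized field
is skew for the symplectic form (`symplBilin_linearized_field`, `symplectic_flow`). -/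

theorem hasSum_pi_prod {α : Type*} {n : ℕ} (a : Fin n → α → ℝ) (h0 : ∀ p z, 0 ≤ a p z)
    (hs : ∀ p, Summable (a p)) :
    HasSum (fun j : Fin n → α => ∏ p, a p (j p)) (∏ p, ∑' z, a p z) := by
  induction n with
  | zero =>
    simp only [Finset.univ_eq_empty, Finset.prod_empty]
    exact hasSum_unique (fun _ : Fin 0 → α => (1 : ℝ))
  | succ n ih =>
    have h1 := ih (fun p => a p.succ) (fun p z => h0 _ _) (fun p => hs _)
    have h2 : Summable fun x : α × (Fin n → α) => a 0 x.1 * ∏ p : Fin n, a p.succ (x.2 p) :=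
      Summable.mul_of_nonneg (f := a 0) (g := fun j : Fin n → α => ∏ p : Fin n, a p.succ (j p))
        (hs 0) h1.summable (fun z => h0 0 z) (fun j => Finset.prod_nonneg fun p _ => h0 _ _)
    have h3 := (hs 0).hasSum.mul h1 h2
    rw [← (Fin.consEquiv (fun _ : Fin (n + 1) => α)).hasSum_iff, Fin.prod_univ_succ]
    have h4 : (fun j : Fin (n + 1) → α => ∏ p, a p (j p)) ∘ Fin.consEquiv (fun _ => α)
        = fun x : α × (Fin n → α) => a 0 x.1 * ∏ p : Fin n, a p.succ (x.2 p) := by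
      funext x
      simp [Fin.prod_univ_succ, Fin.consEquiv]
    rw [h4]
    exact h3

theorem summable_mul_and_tsum_mul_le {ι : Type*} {f g : ι → ℝ} (hf0 : ∀ i, 0 ≤ f i)
    (hg0 : ∀ i, 0 ≤ g i) (hf : Summable fun i => f i ^ 2) (hg : Summable fun i => g i ^ 2) :
    (Summable fun i => f i * g i) ∧
      ∑' i, f i * g i ≤ √(∑' i, f i ^ 2) * √(∑' i, g i ^ 2) := by
  have h := Real.summable_and_inner_le_Lp_mul_Lq_tsum_of_nonneg
    (p := 2) (q := 2) (f := f) (g := g) Real.HolderConjugate.two_two hf0 hg0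
    (by simpa using hf) (by simpa using hg)
  simpa [Real.sqrt_eq_rpow] using h

/-! ### The spaces `ℓ²_s` -/

/-- The absolute value of an index. -/
def wt (j : ZStar) : ℝ := |(j.1 : ℝ)|

theorem one_le_wt (j : ZStar) : 1 ≤ wt j := by
  have h : (1 : ℤ) ≤ |j.1| := Int.one_le_abs j.2
  rw [wt, ← Int.cast_abs]
  exact_mod_cast h

theorem wt_pos (j : ZStar) : 0 < wt j := one_pos.trans_le (one_le_wt j)

theorem wt_rpow_sq (j : ZStar) (s : ℝ) : (wt j ^ s) ^ 2 = wt j ^ (2 * s) := by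
  rw [← Real.rpow_natCast, ← Real.rpow_mul (wt_pos j).le, mul_comm]
  norm_num

theorem summable_wt_rpow {a : ℝ} (ha : 1 < a) : Summable fun j : ZStar => wt j ^ (-a) := by
  have h := (Real.summable_abs_int_rpow ha).comp_injective
    (Subtype.val_injective (p := fun j : ℤ => j ≠ 0))
  exact h.congr fun j => by simp [wt]

namespace Ell2

variable {s : ℝ}

@[simp] theorem add_coe (p q : Ell2 s) (j : ZStar) : (p + q) j = p j + q j := rfl

@[simp] theorem real_smul_coe (c : ℝ) (q : Ell2 s) (j : ZStar) : (c • q) j = (c : ℂ) * q j := rfl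

theorem ext {p q : Ell2 s} (h : ∀ j, p j = q j) : p = q := Subtype.ext (funext h)

theorem summable_wt (q : Ell2 s) : Summable fun j : ZStar => (wt j ^ s * ‖q j‖) ^ 2 :=
  q.summable.congr fun j => by rw [mul_pow, wt_rpow_sq, mul_comm]; rfl

theorem norm_sq_wt (q : Ell2 s) : ‖q‖ ^ 2 = ∑' j : ZStar, (wt j ^ s * ‖q j‖) ^ 2 := by
  rw [norm_sq]
  exact tsum_congr fun j => by rw [mul_pow, wt_rpow_sq, mul_comm]; rfl

theorem norm_eq_sqrt (q : Ell2 s) : ‖q‖ = √(∑' j : ZStar, (wt j ^ s * ‖q j‖) ^ 2) := by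
  rw [← norm_sq_wt, Real.sqrt_sq (norm_nonneg q)]

theorem exists_of_sum_sq_le (f : ZStar → ℂ) {K : ℝ} (hK : 0 ≤ K)
    (h : ∀ S : Finset ZStar, ∑ j ∈ S, (wt j ^ s * ‖f j‖) ^ 2 ≤ K ^ 2) :
    ∃ q : Ell2 s, (∀ j, q j = f j) ∧ ‖q‖ ≤ K := by
  have hsum : Summable fun j : ZStar => (wt j ^ s * ‖f j‖) ^ 2 :=
    summable_of_sum_le (fun j => by positivity) h
  let q : Ell2 s := ⟨f, hsum.congr fun j => by rw [mul_pow, wt_rpow_sq, mul_comm]; rfl⟩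
  refine ⟨q, fun j => rfl, ?_⟩
  refine abs_le_of_sq_le_sq' ?_ hK |>.2
  rw [norm_sq_wt]
  exact hsum.tsum_le_of_sum_le h

/-- A sequence that pairs boundedly with `ℓ²_{-s}` belongs to `ℓ²_s`. -/
theorem exists_of_pairing_le (f : ZStar → ℂ) {K : ℝ} (hK : 0 ≤ K)
    (h : ∀ (a : Ell2 (-s)) (S : Finset ZStar), ∑ j ∈ S, ‖a j‖ * ‖f j‖ ≤ K * ‖a‖) :
    ∃ q : Ell2 s, (∀ j, q j = f j) ∧ ‖q‖ ≤ K := by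
  classical
  refine exists_of_sum_sq_le f hK fun S => ?_
  set X := ∑ j ∈ S, (wt j ^ s * ‖f j‖) ^ 2 with hX
  have hX0 : 0 ≤ X := Finset.sum_nonneg fun _ _ => by positivity
  -- The extremal test sequence for the duality: its pairing with f over S is X, while its norm in
  -- ℓ²_{-s} is at most √X, so the hypothesis becomes X ≤ K √X.
  let g : ZStar → ℂ := fun j => if j ∈ S then ((wt j ^ (2 * s) * ‖f j‖ : ℝ) : ℂ) else 0
  have hg : ∀ j ∈ S, ‖g j‖ = wt j ^ (2 * s) * ‖f j‖ := fun j hj => by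
    have := wt_pos j
    simp only [g, hj, if_true, Complex.norm_real]
    rw [Real.norm_of_nonneg (by positivity)]
  have hg' : ∀ j ∈ S, (wt j ^ (-s) * ‖g j‖) ^ 2 = (wt j ^ s * ‖f j‖) ^ 2 := fun j hj => by
    rw [hg j hj, ← mul_assoc, ← Real.rpow_add (wt_pos j)]
    ring_nf
  have hg0 : ∀ j ∉ S, (wt j ^ (-s) * ‖g j‖) ^ 2 = 0 := fun j hj => by simp [g, hj]
  obtain ⟨a, ha, hna⟩ := exists_of_sum_sq_le (s := -s) g (Real.sqrt_nonneg X) (fun S' => by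
    rw [Real.sq_sqrt hX0]
    calc ∑ j ∈ S', (wt j ^ (-s) * ‖g j‖) ^ 2
        ≤ ∑ j ∈ S' ∪ S, (wt j ^ (-s) * ‖g j‖) ^ 2 :=
          Finset.sum_le_sum_of_subset_of_nonneg Finset.subset_union_left
            fun _ _ _ => by positivity
      _ = ∑ j ∈ S, (wt j ^ (-s) * ‖g j‖) ^ 2 :=
          (Finset.sum_subset Finset.subset_union_right fun j _ hj => hg0 j hj).symm
      _ = X := Finset.sum_congr rfl hg'
      _ ≤ X := le_rfl)
  have h1 : X ≤ K * √X := by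
    calc X = ∑ j ∈ S, ‖a j‖ * ‖f j‖ := by
            refine Finset.sum_congr rfl fun j hj => ?_
            rw [ha, hg j hj, mul_pow, wt_rpow_sq]
            ring
      _ ≤ K * ‖a‖ := h a S
      _ ≤ K * √X := mul_le_mul_of_nonneg_left hna hK
  have h2 : X = √X ^ 2 := (Real.sq_sqrt hX0).symm
  have h3 := Real.sqrt_nonneg X
  rcases h3.eq_or_lt with h4 | h4
  · rw [← h4, mul_zero] at h1
    exact h1.trans (sq_nonneg K)
  · have h5 : √X ≤ K := by
      by_contra hlt
      push Not at hlt
      nlinarith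
    rw [h2]
    exact pow_le_pow_left₀ h3 h5 2

/-- The constant in the embedding of `ℓ²_s`, `s > 1`, in the space `∑ |j|^{1/2} |q_j| < ∞`. -/
def embConst (s : ℝ) : ℝ := √(∑' j : ZStar, (wt j ^ (1 / 2 - s)) ^ 2)

theorem embConst_nonneg (s : ℝ) : 0 ≤ embConst s := Real.sqrt_nonneg _

theorem summable_sqrt_wt_mul (hs : 1 < s) (q : Ell2 s) :
    (Summable fun j : ZStar => √(wt j) * ‖q j‖) ∧
      ∑' j : ZStar, √(wt j) * ‖q j‖ ≤ embConst s * ‖q‖ := by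
  -- The place where s > 1 is needed: the exponent 2s − 1 must exceed 1.
  have h1 : Summable fun j : ZStar => (wt j ^ (1 / 2 - s)) ^ 2 :=
    (summable_wt_rpow (a := 2 * s - 1) (by linarith)).congr fun j => by
      rw [wt_rpow_sq]; congr 1; ring
  have h2 := summable_mul_and_tsum_mul_le
    (fun j => by have := wt_pos j; positivity) (fun j => by have := wt_pos j; positivity)
    h1 q.summable_wt
  have h3 : ∀ j : ZStar, wt j ^ (1 / 2 - s) * (wt j ^ s * ‖q j‖) = √(wt j) * ‖q j‖ := fun j => by
    rw [← mul_assoc, ← Real.rpow_add (wt_pos j), Real.sqrt_eq_rpow]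
    ring_nf
  simp only [h3, ← norm_eq_sqrt] at h2
  exact h2

/-- The weighting as an isometric equivalence of `ℓ²_s` with `ℓ²`. -/
def toLpEquiv (s : ℝ) : Ell2 s ≃ₗᵢ[ℂ] lp (fun _ : ZStar => ℂ) 2 where
  toLinearEquiv := LinearEquiv.ofBijective (toLp s) ⟨toLp_injective s, fun f => by
    have hw : ∀ j : ZStar, (((wt j ^ s : ℝ) : ℂ)) ≠ 0 := fun j =>
      Complex.ofReal_ne_zero.2 (Real.rpow_pos_of_pos (wt_pos j) s).ne'
    have hf := (lp.memℓp f).summable (by norm_num)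
    refine ⟨⟨fun j => ((wt j ^ s : ℝ) : ℂ)⁻¹ * f j, ?_⟩, ?_⟩
    · refine hf.congr fun j => ?_
      rw [ENNReal.toReal_ofNat, ← weight_sq (s := s)]
      congr 2
      exact (mul_inv_cancel_left₀ (hw j) (f j)).symm
    · ext j
      exact mul_inv_cancel_left₀ (hw j) (f j)⟩
  norm_map' _ := rfl

instance : CompleteSpace (Ell2 s) :=
  (toLpEquiv s).toIsometryEquiv.completeSpace

end Ell2

/-! ### Coefficients and multilinear forms -/

/-- The identity at even places, complex conjugation at odd places. -/
def altConj (p : ℕ) (z : ℂ) : ℂ := if Even p then z else conj z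

@[simp] theorem norm_altConj (p : ℕ) (z : ℂ) : ‖altConj p z‖ = ‖z‖ := by
  unfold altConj; split_ifs <;> simp

theorem altConj_add (p : ℕ) (z w : ℂ) : altConj p (z + w) = altConj p z + altConj p w := by
  unfold altConj; split_ifs <;> simp

theorem altConj_real_mul (p : ℕ) (r : ℝ) (z : ℂ) : altConj p (r * z) = r * altConj p z := by
  unfold altConj; split_ifs <;> simp

theorem altConj_mul (p : ℕ) (z w : ℂ) : altConj p (z * w) = altConj p z * altConj p w := by
  unfold altConj; split_ifs <;> simp

theorem altConj_tsum {ι : Type*} (p : ℕ) (f : ι → ℂ) :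
    altConj p (∑' i, f i) = ∑' i, altConj p (f i) := by
  unfold altConj; split_ifs
  · rfl
  · exact Complex.conj_tsum f

variable {n : ℕ} {s : ℝ}

/-- The momentum `j_1 - j_2 + j_3 - ⋯`. -/
def momentum (j : Fin n → ZStar) : ℤ := ∑ p : Fin n, (-1 : ℤ) ^ (p : ℕ) * (j p).1

/-- The product of the numbers `|j_p|^{1/2}`. -/
def rootProd (j : Fin n → ZStar) : ℝ := ∏ p : Fin n, √(wt (j p))

theorem one_le_sqrt_wt (j : ZStar) : 1 ≤ √(wt j) := Real.one_le_sqrt.2 (one_le_wt j)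

theorem sqrt_wt_pos (j : ZStar) : 0 < √(wt j) := Real.sqrt_pos.2 (wt_pos j)

theorem rootProd_pos (j : Fin n → ZStar) : 0 < rootProd j :=
  Finset.prod_pos fun _ _ => sqrt_wt_pos _

/-- Coefficients bounded by `A ∏ |j_p|^{1/2}`. -/
def RootBound (A : ℝ) (c : (Fin n → ZStar) → ℂ) : Prop := ∀ j, ‖c j‖ ≤ A * rootProd j

/-- Coefficients bounded by `A ∏ |j_p|^{1/2} / max |j_p|`. -/
def QuotBound (A : ℝ) (c : (Fin n → ZStar) → ℂ) : Prop :=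
  ∀ j p, ‖c j‖ * wt (j p) ≤ A * rootProd j

/-- Coefficients that vanish off the tuples of zero momentum. -/
def ZeroMom (c : (Fin n → ZStar) → ℂ) : Prop := ∀ j, momentum j ≠ 0 → c j = 0

theorem QuotBound.rootBound {A : ℝ} {c : (Fin (n + 1) → ZStar) → ℂ} (h : QuotBound A c) :
    RootBound A c := fun j =>
  (le_mul_of_one_le_right (norm_nonneg _) (one_le_wt (j 0))).trans (h j 0)

/-- The bound by ∏ |j_p|^{1/2} decouples the indices, and the sum factors into weighted ℓ¹ norms,
each controlled by the embedding of ℓ²_s. No momentum condition is needed. -/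
theorem RootBound.summable (hs : 1 < s) {A : ℝ} (hA : 0 ≤ A) {c : (Fin n → ZStar) → ℂ}
    (hc : RootBound A c) (x : Fin n → Ell2 s) :
    (Summable fun j : Fin n → ZStar => ‖c j‖ * ∏ p, ‖x p (j p)‖) ∧
      ∑' j : Fin n → ZStar, ‖c j‖ * ∏ p, ‖x p (j p)‖
        ≤ A * Ell2.embConst s ^ n * ∏ p, ‖x p‖ := by
  have h1 := hasSum_pi_prod (fun (p : Fin n) (z : ZStar) => √(wt z) * ‖x p z‖)
    (fun p z => by positivity) (fun p => ((x p).summable_sqrt_wt_mul hs).1)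
  have h2 := h1.mul_left A
  have h3 : ∀ j : Fin n → ZStar, ‖c j‖ * ∏ p, ‖x p (j p)‖
      ≤ A * ∏ p, (√(wt (j p)) * ‖x p (j p)‖) := fun j => by
    rw [Finset.prod_mul_distrib, ← mul_assoc]
    exact mul_le_mul_of_nonneg_right (hc j) (Finset.prod_nonneg fun _ _ => norm_nonneg _)
  have h4 : Summable fun j : Fin n → ZStar => ‖c j‖ * ∏ p, ‖x p (j p)‖ :=
    h2.summable.of_nonneg_of_le
      (fun j => mul_nonneg (norm_nonneg _) (Finset.prod_nonneg fun _ _ => norm_nonneg _)) h3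
  refine ⟨h4, (h4.tsum_le_tsum h3 h2.summable).trans ?_⟩
  rw [h2.tsum_eq, mul_assoc]
  refine mul_le_mul_of_nonneg_left ?_ hA
  calc ∏ p, ∑' z : ZStar, √(wt z) * ‖x p z‖
      ≤ ∏ p, (Ell2.embConst s * ‖x p‖) :=
        Finset.prod_le_prod (fun p _ => tsum_nonneg fun z => by positivity)
          fun p _ => ((x p).summable_sqrt_wt_mul hs).2
    _ = _ := by simp [Finset.prod_mul_distrib]

/-- The term of the tuple `j` in the multilinear form with coefficients `c`. -/
def term (c : (Fin n → ZStar) → ℂ) (x : Fin n → Ell2 s) (j : Fin n → ZStar) : ℂ :=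
  c j * ∏ p : Fin n, altConj p (x p (j p))

theorem norm_term (c : (Fin n → ZStar) → ℂ) (x : Fin n → Ell2 s) (j : Fin n → ZStar) :
    ‖term c x j‖ = ‖c j‖ * ∏ p, ‖x p (j p)‖ := by
  simp [term, norm_prod]

theorem RootBound.summable_norm_term (hs : 1 < s) {A : ℝ} (hA : 0 ≤ A)
    {c : (Fin n → ZStar) → ℂ} (hc : RootBound A c) (x : Fin n → Ell2 s) :
    Summable fun j => ‖term c x j‖ := by
  simpa only [norm_term] using (hc.summable hs hA x).1

theorem RootBound.tsum_norm_term_le (hs : 1 < s) {A : ℝ} (hA : 0 ≤ A)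
    {c : (Fin n → ZStar) → ℂ} (hc : RootBound A c) (x : Fin n → Ell2 s) :
    ∑' j, ‖term c x j‖ ≤ A * Ell2.embConst s ^ n * ∏ p, ‖x p‖ := by
  simpa only [norm_term] using (hc.summable hs hA x).2

theorem altConj_update [DecidableEq (Fin n)] (x : Fin n → Ell2 s) (i : Fin n) (y : Ell2 s)
    (j : Fin n → ZStar) :
    ∏ p : Fin n, altConj p (Function.update x i y p (j p))
      = altConj i (y (j i)) * ∏ p ∈ Finset.univ.erase i, altConj p (x p (j p)) := by
  rw [← Finset.mul_prod_erase _ _ (Finset.mem_univ i), Function.update_self]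
  congr 1
  refine Finset.prod_congr rfl fun p hp => ?_
  rw [Function.update_of_ne (Finset.ne_of_mem_erase hp)]

/-- The multilinear form `∑_j c_j x¹_{j_1} x̄²_{j_2} x³_{j_3} ⋯`. -/
def form (hs : 1 < s) {A : ℝ} (hA : 0 ≤ A) {c : (Fin n → ZStar) → ℂ} (hc : RootBound A c) :
    ContinuousMultilinearMap ℝ (fun _ : Fin n => Ell2 s) ℂ :=
  MultilinearMap.mkContinuous
    { toFun := fun x => ∑' j, term c x j
      map_update_add' := fun x i y z => by
        rw [← ((hc.summable_norm_term hs hA _).of_norm).tsum_add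
          ((hc.summable_norm_term hs hA _).of_norm)]
        refine tsum_congr fun j => ?_
        simp only [term, altConj_update, Ell2.add_coe, altConj_add]
        ring
      map_update_smul' := fun x i r y => by
        rw [← tsum_const_smul'' r]
        refine tsum_congr fun j => ?_
        simp only [term, altConj_update, Ell2.real_smul_coe, altConj_real_mul, Complex.real_smul]
        ring }
    (A * Ell2.embConst s ^ n)
    fun x => (norm_tsum_le_tsum_norm (hc.summable_norm_term hs hA x)).trans
      (hc.tsum_norm_term_le hs hA x)

theorem form_apply (hs : 1 < s) {A : ℝ} (hA : 0 ≤ A) {c : (Fin n → ZStar) → ℂ}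
    (hc : RootBound A c) (x : Fin n → Ell2 s) : form hs hA hc x = ∑' j, term c x j := rfl

theorem norm_form_le (hs : 1 < s) {A : ℝ} (hA : 0 ≤ A) {c : (Fin n → ZStar) → ℂ}
    (hc : RootBound A c) : ‖form hs hA hc‖ ≤ A * Ell2.embConst s ^ n :=
  MultilinearMap.mkContinuous_norm_le _
    (mul_nonneg hA (pow_nonneg (Ell2.embConst_nonneg s) n)) _

/-! ### Estimates over tuples of zero momentum -/

theorem prod_erase_eq_prod_succAbove (i : Fin (n + 1)) (f : Fin (n + 1) → ℝ) :
    ∏ p ∈ Finset.univ.erase i, f p = ∏ p : Fin n, f (i.succAbove p) := by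
  rw [← Finset.compl_singleton, ← Fin.image_succAbove_univ,
    Finset.prod_image fun _ _ _ _ h => Fin.succAbove_right_injective h]

/-- Zero momentum recovers the omitted entry from all the others. -/
theorem removeNth_injective_of_momentum (i : Fin (n + 1)) :
    Function.Injective fun j : {j : Fin (n + 1) → ZStar // momentum j = 0} =>
      (fun p => j.1 (i.succAbove p) : Fin n → ZStar) := by
  rintro ⟨j, hj⟩ ⟨k, hk⟩ h
  have h1 : ∀ p, j (i.succAbove p) = k (i.succAbove p) := fun p => congrFun h p
  rw [momentum, Fin.sum_univ_succAbove _ i] at hj hk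
  simp only [h1] at hj
  have h2 : (-1 : ℤ) ^ (i : ℕ) * (j i).1 = (-1 : ℤ) ^ (i : ℕ) * (k i).1 := by linarith
  have h3 : j i = k i :=
    Subtype.ext (mul_left_cancel₀ (pow_ne_zero _ (by norm_num : (-1 : ℤ) ≠ 0)) h2)
  refine Subtype.ext (funext fun p => ?_)
  rcases Fin.eq_self_or_eq_succAbove i p with rfl | ⟨p, rfl⟩
  · exact h3
  · exact h1 p

/-- By the injectivity of omitting one entry, a sum over the momentum hyperplane is part of the free
sum over the remaining entries, which factors. -/
theorem summable_momentum_prod_erase (b : Fin (n + 1) → ZStar → ℝ) (h0 : ∀ p z, 0 ≤ b p z)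
    (hs : ∀ p, Summable (b p)) (i : Fin (n + 1)) :
    (Summable fun j : {j : Fin (n + 1) → ZStar // momentum j = 0} =>
        ∏ p ∈ Finset.univ.erase i, b p (j.1 p)) ∧
      ∑' j : {j : Fin (n + 1) → ZStar // momentum j = 0},
        ∏ p ∈ Finset.univ.erase i, b p (j.1 p) ≤ ∏ p ∈ Finset.univ.erase i, ∑' z, b p z := by
  have h1 := hasSum_pi_prod (fun p : Fin n => b (i.succAbove p)) (fun p z => h0 _ _)
    (fun p => hs _)
  have hinj := removeNth_injective_of_momentum (n := n) i
  simp only [prod_erase_eq_prod_succAbove]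
  refine ⟨h1.summable.comp_injective hinj, ?_⟩
  rw [← h1.tsum_eq]
  exact tsum_comp_le_tsum_of_inj h1.summable
    (fun j => Finset.prod_nonneg fun p _ => h0 _ _) hinj

/-- A Young inequality for two ℓ² factors and otherwise ℓ¹ factors. Half of the product of the e's,
as a square root, goes to u and half to v before Cauchy–Schwarz. In the sum of squares for u the
index k is free to be eliminated by the momentum condition, in that for v the index i. -/
theorem summable_momentum_conv {u v : ZStar → ℝ} (hu0 : ∀ z, 0 ≤ u z) (hv0 : ∀ z, 0 ≤ v z)
    (hu : Summable fun z => u z ^ 2) (hv : Summable fun z => v z ^ 2)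
    (e : Fin (n + 1) → ZStar → ℝ) (h0 : ∀ p z, 0 ≤ e p z) (he : ∀ p, Summable (e p))
    {i k : Fin (n + 1)} (hik : i ≠ k) :
    (Summable fun j : {j : Fin (n + 1) → ZStar // momentum j = 0} =>
        u (j.1 i) * v (j.1 k) * ∏ p ∈ (Finset.univ.erase i).erase k, e p (j.1 p)) ∧
      ∑' j : {j : Fin (n + 1) → ZStar // momentum j = 0},
          u (j.1 i) * v (j.1 k) * ∏ p ∈ (Finset.univ.erase i).erase k, e p (j.1 p)
        ≤ √(∑' z, u z ^ 2) * √(∑' z, v z ^ 2)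
          * ∏ p ∈ (Finset.univ.erase i).erase k, ∑' z, e p z := by
  set S := (Finset.univ.erase i).erase k with hS
  have key : ∀ (w : ZStar → ℝ) (a b : Fin (n + 1)), a ≠ b → (Finset.univ.erase a).erase b = S →
      (∀ z, 0 ≤ w z) → (Summable fun z => w z ^ 2) →
      (Summable fun j : {j : Fin (n + 1) → ZStar // momentum j = 0} =>
        (w (j.1 b) * √(∏ p ∈ S, e p (j.1 p))) ^ 2) ∧
      ∑' j : {j : Fin (n + 1) → ZStar // momentum j = 0},
        (w (j.1 b) * √(∏ p ∈ S, e p (j.1 p))) ^ 2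
        ≤ (∑' z, w z ^ 2) * ∏ p ∈ S, ∑' z, e p z := by
    intro w a b hab hSab hw0 hw
    have hb : b ∈ Finset.univ.erase a := Finset.mem_erase.2 ⟨hab.symm, Finset.mem_univ _⟩
    have h := summable_momentum_prod_erase
      (fun p => if p = b then fun z => w z ^ 2 else e p)
      (fun p z => by split_ifs; exacts [sq_nonneg _, h0 _ _])
      (fun p => by split_ifs; exacts [hw, he _]) a
    have h1 : ∀ j : Fin (n + 1) → ZStar,
        ∏ p ∈ Finset.univ.erase a, (if p = b then fun z => w z ^ 2 else e p) (j p)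
          = (w (j b) * √(∏ p ∈ S, e p (j p))) ^ 2 := fun j => by
      rw [mul_pow, Real.sq_sqrt (Finset.prod_nonneg fun p _ => h0 _ _),
        ← Finset.mul_prod_erase _ _ hb, hSab, if_pos rfl]
      congr 1
      refine Finset.prod_congr rfl fun p hp => ?_
      rw [← hSab] at hp
      rw [if_neg (Finset.ne_of_mem_erase hp)]
    have h2 : ∏ p ∈ Finset.univ.erase a, ∑' z, (if p = b then fun z => w z ^ 2 else e p) z
        = (∑' z, w z ^ 2) * ∏ p ∈ S, ∑' z, e p z := by
      rw [← Finset.mul_prod_erase _ _ hb, hSab, if_pos rfl]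
      congr 1
      refine Finset.prod_congr rfl fun p hp => ?_
      rw [← hSab] at hp
      rw [if_neg (Finset.ne_of_mem_erase hp)]
    simp only [h1, h2] at h
    exact h
  obtain ⟨hf, hf'⟩ := key u k i hik.symm (Finset.erase_right_comm) hu0 hu
  obtain ⟨hg, hg'⟩ := key v i k hik rfl hv0 hv
  have h := summable_mul_and_tsum_mul_le
    (fun j => mul_nonneg (hu0 _) (Real.sqrt_nonneg _))
    (fun j => mul_nonneg (hv0 _) (Real.sqrt_nonneg _)) hf hg
  have h1 : ∀ j : {j : Fin (n + 1) → ZStar // momentum j = 0},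
      u (j.1 i) * √(∏ p ∈ S, e p (j.1 p)) * (v (j.1 k) * √(∏ p ∈ S, e p (j.1 p)))
        = u (j.1 i) * v (j.1 k) * ∏ p ∈ S, e p (j.1 p) := fun j => by
    rw [mul_mul_mul_comm, Real.mul_self_sqrt (Finset.prod_nonneg fun p _ => h0 _ _)]
  simp only [h1] at h
  refine ⟨h.1, h.2.trans ?_⟩
  have hE : 0 ≤ ∏ p ∈ S, ∑' z, e p z := Finset.prod_nonneg fun p _ => tsum_nonneg (h0 p)
  refine (mul_le_mul (Real.sqrt_le_sqrt hf') (Real.sqrt_le_sqrt hg')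
    (Real.sqrt_nonneg _) (Real.sqrt_nonneg _)).trans (le_of_eq ?_)
  rw [Real.sqrt_mul (tsum_nonneg fun _ => sq_nonneg _),
    Real.sqrt_mul (tsum_nonneg fun _ => sq_nonneg _), mul_mul_mul_comm, Real.mul_self_sqrt hE]

/-- In a tuple of zero momentum, every entry is dominated by some other one. -/
theorem exists_wt_le_of_momentum {j : Fin n → ZStar} (hj : momentum j = 0) (i : Fin n) :
    ∃ k ≠ i, wt (j i) ≤ n * wt (j k) := by
  by_contra hcon
  push Not at hcon
  have h1 : wt (j i) ≤ ∑ k ∈ Finset.univ.erase i, wt (j k) := by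
    rw [momentum, ← Finset.add_sum_erase _ _ (Finset.mem_univ i)] at hj
    have h2 : |(j i).1| ≤ ∑ k ∈ Finset.univ.erase i, |(j k).1| := by
      have h3 : (-1 : ℤ) ^ (i : ℕ) * (j i).1
          = -∑ k ∈ Finset.univ.erase i, (-1 : ℤ) ^ (k : ℕ) * (j k).1 := by linarith
      calc |(j i).1| = |(-1 : ℤ) ^ (i : ℕ) * (j i).1| := by simp [abs_mul]
        _ = |∑ k ∈ Finset.univ.erase i, (-1 : ℤ) ^ (k : ℕ) * (j k).1| := by rw [h3, abs_neg]
        _ ≤ ∑ k ∈ Finset.univ.erase i, |(-1 : ℤ) ^ (k : ℕ) * (j k).1| :=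
          Finset.abs_sum_le_sum_abs _ _
        _ = _ := by simp [abs_mul]
    simp only [wt, ← Int.cast_abs]
    exact_mod_cast h2
  have hn : (0 : ℝ) < n := by exact_mod_cast i.pos
  -- If all n − 1 other entries were smaller than a fraction 1/n of this one, they could not balance
  -- it.
  have h2 : ∀ k ∈ Finset.univ.erase i, wt (j k) ≤ wt (j i) / n := fun k hk => by
    rw [le_div_iff₀ hn, mul_comm]
    exact (hcon k (Finset.ne_of_mem_erase hk)).le
  have h3 : ∑ k ∈ Finset.univ.erase i, wt (j k) ≤ (n - 1) * (wt (j i) / n) := by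
    refine (Finset.sum_le_sum h2).trans (le_of_eq ?_)
    rw [Finset.sum_const, Finset.card_erase_of_mem (Finset.mem_univ i), Finset.card_univ,
      Fintype.card_fin, nsmul_eq_mul, Nat.cast_pred i.pos]
  have h4 : (n - 1) * (wt (j i) / n) < wt (j i) := by
    rw [← mul_div_assoc, div_lt_iff₀ hn]
    nlinarith [wt_pos (j i)]
  linarith

/-- Writing a, b for the roots of |j_i|, |j_k|, the bound at the places i and k gives the factors
b/a and a/b. One of them is at most 1, so two arbitrary places can be freed of their weights. -/
theorem QuotBound.norm_le_prod_erase {A : ℝ} (hA : 0 ≤ A) {c : (Fin n → ZStar) → ℂ}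
    (hc : QuotBound A c) (j : Fin n → ZStar) {i k : Fin n} (hik : k ≠ i) :
    ‖c j‖ ≤ A * ∏ p ∈ (Finset.univ.erase i).erase k, √(wt (j p)) := by
  have hk : k ∈ Finset.univ.erase i := Finset.mem_erase.2 ⟨hik, Finset.mem_univ _⟩
  have hr : rootProd j = √(wt (j i)) * (√(wt (j k)) *
      ∏ p ∈ (Finset.univ.erase i).erase k, √(wt (j p))) := by
    rw [Finset.mul_prod_erase _ (fun p => √(wt (j p))) hk,
      Finset.mul_prod_erase _ (fun p => √(wt (j p))) (Finset.mem_univ i), rootProd]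
  set P := ∏ p ∈ (Finset.univ.erase i).erase k, √(wt (j p)) with hP
  have hP0 : 0 ≤ P := Finset.prod_nonneg fun _ _ => Real.sqrt_nonneg _
  have h1 := hc j i
  have h2 := hc j k
  rw [hr] at h1 h2
  have ha := sqrt_wt_pos (j i)
  have hb := sqrt_wt_pos (j k)
  generalize hx : √(wt (j i)) = a at *
  generalize hy : √(wt (j k)) = b at *
  have e1 : wt (j i) = a ^ 2 := by rw [← hx, Real.sq_sqrt (wt_pos (j i)).le]
  have e2 : wt (j k) = b ^ 2 := by rw [← hy, Real.sq_sqrt (wt_pos (j k)).le]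
  rw [e1] at h1
  rw [e2] at h2
  have h1' : ‖c j‖ * a ≤ A * (b * P) := by
    refine le_of_mul_le_mul_right ?_ ha
    linarith
  have h2' : ‖c j‖ * b ≤ A * (a * P) := by
    refine le_of_mul_le_mul_right ?_ hb
    linarith
  rcases le_total a b with hab | hab
  · refine le_of_mul_le_mul_right ?_ hb
    calc ‖c j‖ * b ≤ A * (a * P) := h2'
      _ ≤ A * (b * P) := by gcongr
      _ = A * P * b := by ring
  · refine le_of_mul_le_mul_right ?_ ha
    calc ‖c j‖ * a ≤ A * (b * P) := h1'
      _ ≤ A * (a * P) := by gcongr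
      _ = A * P * a := by ring

/-- The terms of the majorant of a form with the argument `a ∈ ℓ²_{-s}` at the place `i`. -/
def pairTerm (i : Fin n) (a : Ell2 (-s)) (x : Fin n → Ell2 s) (k : Fin n) (j : Fin n → ZStar) :
    ℝ :=
  wt (j i) ^ (-s) * ‖a (j i)‖ * (wt (j k) ^ s * ‖x k (j k)‖)
    * ∏ p ∈ (Finset.univ.erase i).erase k, (√(wt (j p)) * ‖x p (j p)‖)

theorem pairTerm_nonneg (i : Fin n) (a : Ell2 (-s)) (x : Fin n → Ell2 s) (k : Fin n)
    (j : Fin n → ZStar) : 0 ≤ pairTerm i a x k j := by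
  have h1 := wt_pos (j i)
  have h2 := wt_pos (j k)
  exact mul_nonneg (by positivity) (Finset.prod_nonneg fun _ _ => by positivity)

theorem summable_pairTerm (hs : 1 < s) (i : Fin (n + 2)) (a : Ell2 (-s))
    (x : Fin (n + 2) → Ell2 s) {k : Fin (n + 2)} (hk : k ∈ Finset.univ.erase i) :
    (Summable fun j : {j : Fin (n + 2) → ZStar // momentum j = 0} => pairTerm i a x k j.1) ∧
      ∑' j : {j : Fin (n + 2) → ZStar // momentum j = 0}, pairTerm i a x k j.1
        ≤ Ell2.embConst s ^ n * (‖a‖ * ∏ p ∈ Finset.univ.erase i, ‖x p‖) := by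
  have h := summable_momentum_conv (n := n + 1)
    (u := fun z => wt z ^ (-s) * ‖a z‖) (v := fun z => wt z ^ s * ‖x k z‖)
    (fun z => by have := wt_pos z; positivity) (fun z => by have := wt_pos z; positivity)
    a.summable_wt (x k).summable_wt (fun p z => √(wt z) * ‖x p z‖) (fun p z => by positivity)
    (fun p => ((x p).summable_sqrt_wt_mul hs).1) (Finset.ne_of_mem_erase hk).symm
  refine ⟨h.1, h.2.trans ?_⟩
  rw [← Ell2.norm_eq_sqrt, ← Ell2.norm_eq_sqrt, ← Finset.mul_prod_erase _ _ hk]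
  have h2 : ∏ p ∈ (Finset.univ.erase i).erase k, ∑' z, √(wt z) * ‖x p z‖
      ≤ Ell2.embConst s ^ n * ∏ p ∈ (Finset.univ.erase i).erase k, ‖x p‖ := by
    calc _ ≤ ∏ p ∈ (Finset.univ.erase i).erase k, (Ell2.embConst s * ‖x p‖) :=
          Finset.prod_le_prod (fun p _ => tsum_nonneg fun z => by positivity)
            fun p _ => ((x p).summable_sqrt_wt_mul hs).2
      _ = _ := by
        rw [Finset.prod_mul_distrib, Finset.prod_const, Finset.card_erase_of_mem hk,
          Finset.card_erase_of_mem (Finset.mem_univ i), Finset.card_univ, Fintype.card_fin]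
        rfl
  calc ‖a‖ * ‖x k‖ * ∏ p ∈ (Finset.univ.erase i).erase k, ∑' z, √(wt z) * ‖x p z‖
      ≤ ‖a‖ * ‖x k‖ * (Ell2.embConst s ^ n * ∏ p ∈ (Finset.univ.erase i).erase k, ‖x p‖) := by
        gcongr
    _ = _ := by ring

/-- Since |j_i| ≤ n |j_k| for some k, the weight |j_i|^s needed for the argument in ℓ²_{-s} can be
taken from the place k at the cost n^s. The place k depends on the tuple; summing over all k removes
this dependence. -/
theorem QuotBound.pairing_le_pairTerm (hs : 1 < s) {A : ℝ} (hA : 0 ≤ A)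
    {c : (Fin n → ZStar) → ℂ} (hc : QuotBound A c) (i : Fin n)
    (a : Ell2 (-s)) (x : Fin n → Ell2 s) {j : Fin n → ZStar} (hj : momentum j = 0) :
    ‖c j‖ * (‖a (j i)‖ * ∏ p ∈ Finset.univ.erase i, ‖x p (j p)‖)
      ≤ A * (n : ℝ) ^ s * ∑ k ∈ Finset.univ.erase i, pairTerm i a x k j := by
  obtain ⟨k, hki, hk⟩ := exists_wt_le_of_momentum hj i
  have hk' : k ∈ Finset.univ.erase i := Finset.mem_erase.2 ⟨hki, Finset.mem_univ _⟩
  refine le_trans ?_ (mul_le_mul_of_nonneg_left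
    (Finset.single_le_sum (fun k _ => pairTerm_nonneg i a x k j) hk') (by positivity))
  have h1 := hc.norm_le_prod_erase hA j hki
  have h2 : (1 : ℝ) ≤ (n : ℝ) ^ s * (wt (j i) ^ (-s) * wt (j k) ^ s) := by
    have h3 : wt (j i) ^ s ≤ (n * wt (j k)) ^ s :=
      Real.rpow_le_rpow (wt_pos _).le hk (by linarith)
    rw [Real.mul_rpow (by positivity) (wt_pos _).le] at h3
    have h4 : 0 < wt (j i) ^ s := Real.rpow_pos_of_pos (wt_pos _) _
    rw [Real.rpow_neg (wt_pos _).le, mul_left_comm, inv_mul_eq_div, le_div_iff₀ h4, one_mul]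
    exact h3
  rw [pairTerm, ← Finset.mul_prod_erase _ _ hk', Finset.prod_mul_distrib]
  have hP : 0 ≤ ∏ p ∈ (Finset.univ.erase i).erase k, √(wt (j p)) :=
    Finset.prod_nonneg fun _ _ => Real.sqrt_nonneg _
  have hQ : 0 ≤ ∏ p ∈ (Finset.univ.erase i).erase k, ‖x p (j p)‖ :=
    Finset.prod_nonneg fun _ _ => norm_nonneg _
  generalize ∏ p ∈ (Finset.univ.erase i).erase k, √(wt (j p)) = P at *
  generalize ∏ p ∈ (Finset.univ.erase i).erase k, ‖x p (j p)‖ = Q at *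
  calc ‖c j‖ * (‖a (j i)‖ * (‖x k (j k)‖ * Q))
      ≤ A * P * (‖a (j i)‖ * (‖x k (j k)‖ * Q)) := by gcongr
    _ ≤ A * P * (‖a (j i)‖ * (‖x k (j k)‖ * Q))
        * ((n : ℝ) ^ s * (wt (j i) ^ (-s) * wt (j k) ^ s)) :=
        le_mul_of_one_le_right (by positivity) h2
    _ = _ := by ring

/-- Forms of zero momentum with one argument in `ℓ²_{-s}`. -/
theorem QuotBound.summable_pairing (hs : 1 < s) {A : ℝ} (hA : 0 ≤ A)
    {c : (Fin (n + 2) → ZStar) → ℂ} (hc : QuotBound A c) (hm : ZeroMom c) (i : Fin (n + 2))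
    (a : Ell2 (-s)) (x : Fin (n + 2) → Ell2 s) :
    (Summable fun j : Fin (n + 2) → ZStar =>
        ‖c j‖ * (‖a (j i)‖ * ∏ p ∈ Finset.univ.erase i, ‖x p (j p)‖)) ∧
      ∑' j : Fin (n + 2) → ZStar, ‖c j‖ * (‖a (j i)‖ * ∏ p ∈ Finset.univ.erase i, ‖x p (j p)‖)
        ≤ A * ((n + 2 : ℕ) : ℝ) ^ s * ((n + 1 : ℕ) * (Ell2.embConst s ^ n
          * (‖a‖ * ∏ p ∈ Finset.univ.erase i, ‖x p‖))) := by
  have hD0 : 0 ≤ A * ((n + 2 : ℕ) : ℝ) ^ s := by positivity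
  generalize hg : (fun j : Fin (n + 2) → ZStar =>
    ‖c j‖ * (‖a (j i)‖ * ∏ p ∈ Finset.univ.erase i, ‖x p (j p)‖)) = g
  have hgj : ∀ j, ‖c j‖ * (‖a (j i)‖ * ∏ p ∈ Finset.univ.erase i, ‖x p (j p)‖) = g j :=
    fun j => congrFun hg j
  have hgt : ∀ j : {j : Fin (n + 2) → ZStar // momentum j = 0},
      g j.1 ≤ A * ((n + 2 : ℕ) : ℝ) ^ s * ∑ k ∈ Finset.univ.erase i, pairTerm i a x k j.1 :=
    fun j => (hgj j.1) ▸ hc.pairing_le_pairTerm hs hA i a x j.2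
  have hg0 : ∀ j, 0 ≤ g j := fun j => (hgj j) ▸
    mul_nonneg (norm_nonneg _) (mul_nonneg (norm_nonneg _)
      (Finset.prod_nonneg fun _ _ => norm_nonneg _))
  have hsupp : Function.support g ⊆ {j | momentum j = 0} := fun j hj => by
    by_contra h
    refine hj ?_
    rw [← hgj, hm j h, norm_zero, zero_mul]
  have hT : Summable fun j : {j : Fin (n + 2) → ZStar // momentum j = 0} =>
      A * ((n + 2 : ℕ) : ℝ) ^ s * ∑ k ∈ Finset.univ.erase i, pairTerm i a x k j.1 :=
    (summable_sum fun k hk => (summable_pairTerm hs i a x hk).1).mul_left _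
  have hgs : Summable fun j : {j : Fin (n + 2) → ZStar // momentum j = 0} => g j.1 :=
    hT.of_nonneg_of_le (fun j => hg0 _) hgt
  refine ⟨?_, ?_⟩
  · have h : Summable ({j : Fin (n + 2) → ZStar | momentum j = 0}.indicator g) :=
      summable_subtype_iff_indicator.1 hgs
    rwa [Set.indicator_eq_self.2 hsupp] at h
  · have h1 : ∑' j, g j = ∑' j : {j : Fin (n + 2) → ZStar // momentum j = 0}, g j.1 :=
      (tsum_subtype_eq_of_support_subset hsupp).symm
    rw [h1]
    refine (hgs.tsum_le_tsum hgt hT).trans ?_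
    rw [tsum_mul_left, Summable.tsum_finsetSum fun k hk => (summable_pairTerm hs i a x hk).1]
    refine mul_le_mul_of_nonneg_left ?_ hD0
    refine (Finset.sum_le_sum fun k hk => (summable_pairTerm hs i a x hk).2).trans (le_of_eq ?_)
    rw [Finset.sum_const, Finset.card_erase_of_mem (Finset.mem_univ i), Finset.card_univ,
      Fintype.card_fin, nsmul_eq_mul]
    rfl

/-! ### The vector field of the generating function -/

/-- The coefficient of `q_k q̄_l q_m` in the component `J` of the generating vector field. The
resonant terms `J = k` and `J = m` are left out: there the quotient is `0`. -/
def kern (J k l m : ZStar) : ℝ :=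
  if k.1 - l.1 + m.1 = J.1 then
    -(1 / (4 * Real.pi)) * ((J.1 : ℝ) / (((J.1 : ℝ) - k.1) * ((J.1 : ℝ) - m.1))) else 0

theorem kern_of_ne {J k l m : ZStar} (h : J.1 ≠ k.1 - l.1 + m.1) : kern J k l m = 0 :=
  if_neg fun h' => h h'.symm

/-! ### The kernel against its small divisors -/

theorem add_le_two_mul_mul {x y : ℝ} (hx : 1 ≤ x) (hy : 1 ≤ y) : x + y ≤ 2 * (x * y) := by
  nlinarith [mul_nonneg (sub_nonneg.2 hx) (sub_nonneg.2 hy)]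

/-- Here j, k, l, m stand for the absolute values of the four indices, a and d for |J − k| and |J −
m|. Since l = k + m − J, passing from one index to a neighbouring one costs only a or d, and sums
are at most twice products of numbers ≥ 1. Three linear bounds are multiplied in such a way that a
and d occur at most squared. The inequality is squared to avoid roots. -/
theorem mul_sq_le_of_abs_le {j k l m a d b : ℝ} (hj : 1 ≤ j) (hk : 1 ≤ k) (hl : 1 ≤ l)
    (hm : 1 ≤ m) (ha : 1 ≤ a) (hd : 1 ≤ d) (hjk : j ≤ k + a) (hjm : j ≤ m + d)
    (hjl : j ≤ l + a + d) (hkl : k ≤ l + d) (hlk : l ≤ k + d) (hml : m ≤ l + a)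
    (hb : b = j ∨ b = k ∨ b = l ∨ b = m) :
    b ^ 2 * j ≤ 16 * (k * l * m * (a * d) ^ 2) := by
  have h1 : j ≤ 2 * (k * a) := hjk.trans (add_le_two_mul_mul hk ha)
  have h2 : j ≤ 2 * (m * d) := hjm.trans (add_le_two_mul_mul hm hd)
  have h3 : k ≤ 2 * (l * d) := hkl.trans (add_le_two_mul_mul hl hd)
  have h4 : l ≤ 2 * (k * d) := hlk.trans (add_le_two_mul_mul hk hd)
  have h5 : m ≤ 2 * (l * a) := hml.trans (add_le_two_mul_mul hl ha)
  have h6 : j ≤ 4 * (l * (a * d)) := by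
    have h := add_le_two_mul_mul hl (one_le_mul_of_one_le_of_one_le ha hd)
    have h' := add_le_two_mul_mul ha hd
    nlinarith [one_le_mul_of_one_le_of_one_le ha hd, mul_nonneg (sub_nonneg.2 hl)
      (mul_nonneg (zero_le_one.trans ha) (zero_le_one.trans hd))]
  have ha2 : 1 ≤ a ^ 2 := one_le_pow₀ ha
  have hd2 : 1 ≤ d ^ 2 := one_le_pow₀ hd
  have hpos : 0 ≤ k * l * m := by positivity
  have hA : k * l * m * d ^ 2 ≤ k * l * m * (a * d) ^ 2 := by
    rw [mul_pow]
    gcongr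
    exact le_mul_of_one_le_left (by positivity) ha2
  have hB : k * l * m * a ^ 2 ≤ k * l * m * (a * d) ^ 2 := by
    rw [mul_pow]
    gcongr
    exact le_mul_of_one_le_right (by positivity) hd2
  have hX : 0 ≤ k * l * m * (a * d) ^ 2 := by positivity
  rcases hb with rfl | rfl | rfl | rfl
  · calc b ^ 2 * b = b * b * b := by ring
      _ ≤ (2 * (k * a)) * (2 * (m * d)) * (4 * (l * (a * d))) := by gcongr
      _ = 16 * (k * l * m * (a * d) ^ 2) := by ring
  · calc b ^ 2 * j = b * b * j := by ring
      _ ≤ b * (2 * (l * d)) * (2 * (m * d)) := by gcongr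
      _ = 4 * (b * l * m * d ^ 2) := by ring
      _ ≤ _ := by linarith
  · calc b ^ 2 * j = b * b * j := by ring
      _ ≤ b * (2 * (k * d)) * (2 * (m * d)) := by gcongr
      _ = 4 * (k * b * m * d ^ 2) := by ring
      _ ≤ _ := by linarith
  · calc b ^ 2 * j = b * b * j := by ring
      _ ≤ b * (2 * (l * a)) * (2 * (k * a)) := by gcongr
      _ = 4 * (k * l * b * a ^ 2) := by ring
      _ ≤ _ := by linarith

/-- The divisor (J − k)(J − m) compensates both the factor J of the symplectic structure and one
further power of the largest index. It yields `QuotBound` for the generating field with the constant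
1. -/
theorem abs_kern_mul_wt_le (J k l m b : ZStar) (hb : b = J ∨ b = k ∨ b = l ∨ b = m) :
    |kern J k l m| * wt b ≤ √(wt J) * (√(wt k) * √(wt l) * √(wt m)) := by
  have hR : 0 ≤ √(wt J) * (√(wt k) * √(wt l) * √(wt m)) := by positivity
  by_cases h : k.1 - l.1 + m.1 = J.1
  swap
  · rw [kern, if_neg h, abs_zero, zero_mul]; exact hR
  -- In the resonant cases the denominator is 0, and division by zero makes the kernel vanish.
  by_cases hk : J.1 = k.1
  · rw [kern, if_pos h, hk]; simpa using hR
  by_cases hm : J.1 = m.1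
  · rw [kern, if_pos h, hm]; simpa using hR
  have ha : (1 : ℝ) ≤ |(J.1 : ℝ) - k.1| := by
    rw [← Int.cast_sub, ← Int.cast_abs]
    exact_mod_cast Int.one_le_abs (sub_ne_zero.2 hk)
  have hd : (1 : ℝ) ≤ |(J.1 : ℝ) - m.1| := by
    rw [← Int.cast_sub, ← Int.cast_abs]
    exact_mod_cast Int.one_le_abs (sub_ne_zero.2 hm)
  have hR' : (k.1 : ℝ) - l.1 + m.1 = J.1 := by exact_mod_cast h
  have h1 : ∀ x y z : ℝ, x = y + z → |x| ≤ |y| + |z| := fun x y z h => h ▸ abs_add_le y z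
  have h2 : ∀ x y z : ℝ, x = y - z → |x| ≤ |y| + |z| := fun x y z h => h ▸ abs_sub y z
  have hjl : wt J ≤ wt l + |(J.1 : ℝ) - k.1| + |(J.1 : ℝ) - m.1| := by
    refine (h1 (J.1 : ℝ) (l.1 + (J.1 - k.1)) (J.1 - m.1) (by linarith)).trans ?_
    gcongr
    exact abs_add_le _ _
  have key := mul_sq_le_of_abs_le (b := wt b) (one_le_wt J) (one_le_wt k) (one_le_wt l)
    (one_le_wt m) ha hd (h1 _ _ _ (by linarith)) (h1 _ _ _ (by linarith)) hjl
    (h1 _ _ _ (by linarith)) (h2 _ _ _ (by linarith)) (h1 _ _ _ (by linarith))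
    (by rcases hb with h | h | h | h <;> simp [h])
  set X := |(J.1 : ℝ) - k.1| * |(J.1 : ℝ) - m.1| with hX
  have hX0 : 0 < X := by positivity
  -- The 4 is the root of the 16 above; the prefactor 1/(4π) of the kernel absorbs it.
  have hsq : wt b * √(wt J) ≤ 4 * (√(wt k) * √(wt l) * √(wt m) * X) := by
    refine abs_le_of_sq_le_sq' ?_ (by positivity) |>.2
    rw [mul_pow, mul_pow, mul_pow, mul_pow, mul_pow, Real.sq_sqrt (wt_pos _).le,
      Real.sq_sqrt (wt_pos _).le, Real.sq_sqrt (wt_pos _).le, Real.sq_sqrt (wt_pos _).le]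
    linarith
  have hkern : |kern J k l m| = 1 / (4 * Real.pi) * (wt J / X) := by
    have hp : |1 / (4 * Real.pi)| = 1 / (4 * Real.pi) := abs_of_nonneg (by positivity)
    rw [kern, if_pos h, abs_mul, abs_neg, hp, abs_div, abs_mul]
    rfl
  have hpi : 4 / (4 * Real.pi) ≤ 1 := by
    rw [div_le_one (by positivity)]
    nlinarith [Real.pi_gt_three]
  calc |kern J k l m| * wt b
      = 1 / (4 * Real.pi) * (√(wt J) / X) * (wt b * √(wt J)) := by
        rw [hkern]
        nth_rewrite 1 [← Real.mul_self_sqrt (wt_pos J).le]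
        ring
    _ ≤ 1 / (4 * Real.pi) * (√(wt J) / X) * (4 * (√(wt k) * √(wt l) * √(wt m) * X)) := by
        gcongr
    _ = 4 / (4 * Real.pi) * (√(wt J) * (√(wt k) * √(wt l) * √(wt m))) := by
        field_simp
    _ ≤ _ := mul_le_of_le_one_left hR hpi

theorem abs_kern_le (J k l m : ZStar) :
    |kern J k l m| ≤ √(wt J) * (√(wt k) * √(wt l) * √(wt m)) :=
  (le_mul_of_one_le_right (abs_nonneg _) (one_le_wt J)).trans
    (abs_kern_mul_wt_le J k l m J (Or.inl rfl))

theorem abs_kern_mul_sqrt_le (J k l m : ZStar) :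
    |kern J k l m| * √(wt J) ≤ √(wt k) * √(wt l) * √(wt m) := by
  refine le_of_mul_le_mul_right ?_ (sqrt_wt_pos J)
  rw [mul_assoc, Real.mul_self_sqrt (wt_pos J).le]
  exact (abs_kern_mul_wt_le J k l m J (Or.inl rfl)).trans (le_of_eq (mul_comm _ _))

/-- The coefficients of the component `J` of the generating vector field. -/
def vecCoef (J : ZStar) (t : Fin 3 → ZStar) : ℂ := (kern J (t 0) (t 1) (t 2) : ℂ)

theorem vecCoef_rootBound (J : ZStar) : RootBound √(wt J) (vecCoef J) := fun t => by
  rw [vecCoef, Complex.norm_real, rootProd, Fin.prod_univ_three]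
  exact abs_kern_le _ _ _ _

/-- The coefficients of the generating vector field, the last index being that of the component. -/
def fieldCoef (j : Fin 4 → ZStar) : ℂ := vecCoef (j 3) fun p => j p.castSucc

theorem fieldCoef_quotBound : QuotBound 1 fieldCoef := fun j p => by
  rw [fieldCoef, vecCoef, Complex.norm_real, rootProd, Fin.prod_univ_four, one_mul, mul_comm _ √_]
  refine abs_kern_mul_wt_le _ _ _ _ _ ?_
  fin_cases p <;> simp

theorem fieldCoef_zeroMom : ZeroMom fieldCoef := fun j hj => by
  rw [fieldCoef, vecCoef, kern_of_ne, Complex.ofReal_zero]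
  intro h
  refine hj ?_
  simp [momentum, Fin.sum_univ_four] at h ⊢
  linarith

variable {n : ℕ} {s : ℝ}

/-- Duality: pairing the components with a sequence a ∈ ℓ²_{-s} gives a quadrilinear form with
coefficients `fieldCoef` and a in the last place, to which `QuotBound.summable_pairing` applies. -/
theorem exists_field (hs : 1 < s) (x : Fin 3 → Ell2 s) :
    ∃ y : Ell2 s, (∀ J, y J = form hs (Real.sqrt_nonneg _) (vecCoef_rootBound J) x) ∧
      ‖y‖ ≤ (4 : ℕ) ^ s * ((3 : ℕ) * Ell2.embConst s ^ 2) * ∏ p, ‖x p‖ := by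
  have hκ := Ell2.embConst_nonneg s
  refine Ell2.exists_of_pairing_le _ (by positivity) fun a S => ?_
  obtain ⟨h1, h2⟩ := fieldCoef_quotBound.summable_pairing hs zero_le_one fieldCoef_zeroMom
    (Fin.last 3) a (Fin.snoc (α := fun _ => Ell2 s) x 0)
  have h3 : ∀ f : Fin 4 → ℝ, ∏ p ∈ Finset.univ.erase (Fin.last 3), f p
      = ∏ p : Fin 3, f p.castSucc := fun f => by
    rw [prod_erase_eq_prod_succAbove]
    simp only [Fin.succAbove_last]
  simp only [h3, Fin.snoc_castSucc] at h1 h2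
  let e := Fin.snocEquiv (fun _ : Fin 4 => ZStar)
  rw [← e.summable_iff] at h1
  rw [← e.tsum_eq] at h2
  have h4 : ∀ z : ZStar × (Fin 3 → ZStar), ‖fieldCoef (e z)‖ * (‖a (e z (Fin.last 3))‖ *
      ∏ p : Fin 3, ‖x p (e z p.castSucc)‖) = ‖a z.1‖ * ‖term (vecCoef z.1) x z.2‖ := fun z => by
    rw [norm_term]
    have h5 : e z (Fin.last 3) = z.1 := by
      change (Fin.snoc (α := fun _ => ZStar) z.2 z.1 : Fin 4 → ZStar) (Fin.last 3) = z.1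
      exact Fin.snoc_last (α := fun _ => ZStar) _ _
    have h6 : ∀ p : Fin 3, e z p.castSucc = z.2 p := fun p =>
      Fin.snoc_castSucc (α := fun _ => ZStar) _ _ _
    have h7 : fieldCoef (e z) = vecCoef z.1 z.2 := by
      rw [fieldCoef]
      congr 1
      exact funext h6
    rw [h5, h7]
    simp only [h6]
    ring
  have h1' : Summable fun z : ZStar × (Fin 3 → ZStar) =>
      ‖a z.1‖ * ‖term (vecCoef z.1) x z.2‖ := h1.congr h4
  have h2' := (tsum_congr h4).symm.trans_le h2
  rw [h1'.tsum_prod] at h2'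
  have h8 : ∀ J, ‖a J‖ * ‖form hs (Real.sqrt_nonneg _) (vecCoef_rootBound J) x‖
      ≤ ∑' t, ‖a J‖ * ‖term (vecCoef J) x t‖ := fun J => by
    rw [tsum_mul_left]
    refine mul_le_mul_of_nonneg_left ?_ (norm_nonneg _)
    exact norm_tsum_le_tsum_norm
      ((vecCoef_rootBound J).summable_norm_term hs (Real.sqrt_nonneg _) x)
  refine (Finset.sum_le_sum fun J _ => h8 J).trans ?_
  refine (Summable.sum_le_tsum S (fun J _ => tsum_nonneg fun t => by positivity)
    h1'.prod).trans (h2'.trans (le_of_eq ?_))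
  norm_num
  ring

/-- The generating vector field, as a bounded trilinear map. -/
def field (hs : 1 < s) : ContinuousMultilinearMap ℝ (fun _ : Fin 3 => Ell2 s) (Ell2 s) :=
  MultilinearMap.mkContinuous
    -- The chosen sequence is determined by its components, so multilinearity is inherited from the
    -- forms.
    { toFun := fun x => (exists_field hs x).choose
      map_update_add' := fun x i y z => Ell2.ext fun J => by
        rw [Ell2.add_coe, (exists_field hs _).choose_spec.1, (exists_field hs _).choose_spec.1,
          (exists_field hs _).choose_spec.1]
        exact ContinuousMultilinearMap.map_update_add _ x i y z
      map_update_smul' := fun x i r y => Ell2.ext fun J => by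
        rw [Ell2.real_smul_coe, (exists_field hs _).choose_spec.1,
          (exists_field hs _).choose_spec.1]
        exact ContinuousMultilinearMap.map_update_smul _ x i r y }
    _ fun x => (exists_field hs x).choose_spec.2

theorem field_apply (hs : 1 < s) (x : Fin 3 → Ell2 s) (J : ZStar) :
    field hs x J = ∑' t, term (vecCoef J) x t := (exists_field hs x).choose_spec.1 J

/-! ### Contraction of coefficients with the vector field -/

/-- Tuples of length `n + 2` as tuples of length `n` together with two entries inserted at the
places `i` and `i + 1`. -/
def insTwo (i : Fin n) : ZStar × ZStar × (Fin n → ZStar) ≃ (Fin (n + 2) → ZStar) :=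
  (Equiv.prodCongr (Equiv.refl ZStar) (Fin.insertNthEquiv (fun _ => ZStar) i.castSucc)).trans
    (Fin.insertNthEquiv (fun _ => ZStar) i.castSucc.castSucc)

/-- The place in a tuple of length `n + 2` of the entry `p` of the tuple of length `n`. -/
def skipTwo (i p : Fin n) : Fin (n + 2) := i.castSucc.castSucc.succAbove (i.castSucc.succAbove p)

theorem insTwo_fst (i : Fin n) (y : ZStar × ZStar × (Fin n → ZStar)) :
    insTwo i y i.castSucc.castSucc = y.1 :=
  Fin.insertNth_apply_same (α := fun _ => ZStar) _ _ _

theorem insTwo_snd (i : Fin n) (y : ZStar × ZStar × (Fin n → ZStar)) :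
    insTwo i y (i.castSucc.castSucc.succAbove i.castSucc) = y.2.1 :=
  (Fin.insertNth_apply_succAbove (α := fun _ => ZStar) _ _ _ _).trans
    (Fin.insertNth_apply_same (α := fun _ => ZStar) _ _ _)

theorem insTwo_skipTwo (i : Fin n) (y : ZStar × ZStar × (Fin n → ZStar)) (p : Fin n) :
    insTwo i y (skipTwo i p) = y.2.2 p :=
  (Fin.insertNth_apply_succAbove (α := fun _ => ZStar) _ _ _ _).trans
    (Fin.insertNth_apply_succAbove (α := fun _ => ZStar) _ _ _ _)

theorem prod_insTwo {M : Type*} [CommMonoid M] (i : Fin n) (f : Fin (n + 2) → ZStar → M)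
    (y : ZStar × ZStar × (Fin n → ZStar)) :
    ∏ p, f p (insTwo i y p) = f i.castSucc.castSucc y.1 *
      (f (i.castSucc.castSucc.succAbove i.castSucc) y.2.1 * ∏ p, f (skipTwo i p) (y.2.2 p)) := by
  rw [Fin.prod_univ_succAbove _ i.castSucc.castSucc, Fin.prod_univ_succAbove _ i.castSucc,
    insTwo_fst, insTwo_snd]
  exact congrArg _ (congrArg _ (Finset.prod_congr rfl fun p _ =>
    congrArg (f (skipTwo i p)) (insTwo_skipTwo i y p)))

theorem sum_insTwo {M : Type*} [AddCommMonoid M] (i : Fin n) (f : Fin (n + 2) → ZStar → M)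
    (y : ZStar × ZStar × (Fin n → ZStar)) :
    ∑ p, f p (insTwo i y p) = f i.castSucc.castSucc y.1 +
      (f (i.castSucc.castSucc.succAbove i.castSucc) y.2.1 + ∑ p, f (skipTwo i p) (y.2.2 p)) := by
  rw [Fin.sum_univ_succAbove _ i.castSucc.castSucc, Fin.sum_univ_succAbove _ i.castSucc,
    insTwo_fst, insTwo_snd]
  exact congrArg _ (congrArg _ (Finset.sum_congr rfl fun p _ =>
    congrArg (f (skipTwo i p)) (insTwo_skipTwo i y p)))

theorem insTwo_cases (i : Fin n) (y : ZStar × ZStar × (Fin n → ZStar)) (p : Fin (n + 2)) :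
    insTwo i y p = y.1 ∨ insTwo i y p = y.2.1 ∨ ∃ k, insTwo i y p = y.2.2 k := by
  rcases Fin.eq_self_or_eq_succAbove i.castSucc.castSucc p with rfl | ⟨p, rfl⟩
  · exact Or.inl (insTwo_fst i y)
  · right
    rcases Fin.eq_self_or_eq_succAbove i.castSucc p with rfl | ⟨p, rfl⟩
    · exact Or.inl (insTwo_snd i y)
    · exact Or.inr ⟨p, insTwo_skipTwo i y p⟩

theorem val_succAbove_castSucc (i : Fin n) :
    ((i.castSucc.castSucc.succAbove i.castSucc : Fin (n + 2)) : ℕ) = i + 1 := by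
  simp [Fin.succAbove]

/-- Two entries are inserted, so the parity of every old place is kept, and with it the pattern of
conjugations and the signs in the momentum. -/
theorem even_skipTwo (i p : Fin n) : Even (skipTwo i p : ℕ) ↔ Even (p : ℕ) := by
  unfold skipTwo
  by_cases h : (p : ℕ) < i
  · simp [Fin.succAbove, Fin.lt_def, h]
  · have h' : ¬ (p : ℕ) + 1 < i := by omega
    simp [Fin.succAbove, Fin.lt_def, h, h', Nat.even_add_one]

theorem altConj_skipTwo (i p : Fin n) (z : ℂ) : altConj (skipTwo i p) z = altConj p z := by
  simp only [altConj, even_skipTwo]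

theorem neg_one_pow_skipTwo (i p : Fin n) : (-1 : ℤ) ^ (skipTwo i p : ℕ) = (-1) ^ (p : ℕ) := by
  by_cases h : Even (p : ℕ)
  · rw [h.neg_one_pow, ((even_skipTwo i p).2 h).neg_one_pow]
  · rw [(Nat.not_even_iff_odd.1 h).neg_one_pow,
      (Nat.not_even_iff_odd.1 (fun h' => h ((even_skipTwo i p).1 h'))).neg_one_pow]

theorem altConj_add_one (p : ℕ) (z : ℂ) : altConj (p + 1) z = altConj p (conj z) := by
  by_cases h : Even p <;> simp [altConj, h, Nat.even_add_one]

theorem rootProd_insTwo (i : Fin n) (y : ZStar × ZStar × (Fin n → ZStar)) :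
    rootProd (insTwo i y) = √(wt y.1) * (√(wt y.2.1) * rootProd y.2.2) :=
  prod_insTwo i (fun _ z => √(wt z)) y

theorem rootProd_eq_mul_erase (j : Fin n → ZStar) (i : Fin n) :
    rootProd j = √(wt (j i)) * ∏ p ∈ Finset.univ.erase i, √(wt (j p)) :=
  (Finset.mul_prod_erase _ (fun p => √(wt (j p))) (Finset.mem_univ i)).symm

theorem rootProd_update (j : Fin n → ZStar) (i : Fin n) (J : ZStar) :
    rootProd (Function.update j i J) = √(wt J) * ∏ p ∈ Finset.univ.erase i, √(wt (j p)) := by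
  rw [rootProd_eq_mul_erase _ i, Function.update_self]
  congr 1
  refine Finset.prod_congr rfl fun p hp => ?_
  rw [Function.update_of_ne (Finset.ne_of_mem_erase hp)]

/-- The coefficients of the form that arises by inserting the vector field at the place `i`. -/
def contract (i : Fin n) (c : (Fin n → ZStar) → ℂ) (j : Fin (n + 2) → ZStar) : ℂ :=
  ∑' J, c (Function.update ((insTwo i).symm j).2.2 i J) *
    kern J ((insTwo i).symm j).1 ((insTwo i).symm j).2.1 (((insTwo i).symm j).2.2 i)

/-- The terms of `contract`. -/
def contractTerm (i : Fin n) (c : (Fin n → ZStar) → ℂ) (y : ZStar × ZStar × (Fin n → ZStar))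
    (J : ZStar) : ℂ :=
  c (Function.update y.2.2 i J) * kern J y.1 y.2.1 (y.2.2 i)

theorem contract_insTwo (i : Fin n) (c : (Fin n → ZStar) → ℂ)
    (y : ZStar × ZStar × (Fin n → ZStar)) :
    contract i c (insTwo i y) = ∑' J, contractTerm i c y J := by
  simp [contract, contractTerm]

theorem contractTerm_of_ne {i : Fin n} {c : (Fin n → ZStar) → ℂ}
    {y : ZStar × ZStar × (Fin n → ZStar)} {J : ZStar}
    (h : J.1 ≠ y.1.1 - y.2.1.1 + (y.2.2 i).1) : contractTerm i c y J = 0 := by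
  rw [contractTerm, kern_of_ne h, Complex.ofReal_zero, mul_zero]

/-- The momentum condition leaves at most one index J, and none at all if the prescribed value is 0.
Sums over J therefore cost no constant. -/
theorem summable_and_tsum_le_of_eq {f : ZStar → ℝ} {a : ℤ} {B : ℝ} (hB : 0 ≤ B)
    (h : ∀ J : ZStar, J.1 ≠ a → f J = 0) (hb : ∀ J, f J ≤ B) : Summable f ∧ ∑' J, f J ≤ B := by
  by_cases ha : a = 0
  · have : f = 0 := funext fun J => h J (fun hJ => J.2 (hJ.trans ha))
    subst this
    exact ⟨summable_zero, by simpa using hB⟩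
  · have h1 : ∀ J, J ≠ (⟨a, ha⟩ : ZStar) → f J = 0 := fun J hJ =>
      h J fun h' => hJ (Subtype.ext h')
    exact ⟨(hasSum_single _ h1).summable, (hasSum_single _ h1).tsum_eq.trans_le (hb _)⟩

/-- A bound of the terms of `contract` that makes all the sums converge. -/
def ContractBound (A : ℝ) (i : Fin n) (c : (Fin n → ZStar) → ℂ) : Prop :=
  ∀ y J, ‖contractTerm i c y J‖ ≤ A * rootProd (insTwo i y)

theorem ContractBound.summable {A : ℝ} (hA : 0 ≤ A) {i : Fin n} {c : (Fin n → ZStar) → ℂ}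
    (h : ContractBound A i c) (y : ZStar × ZStar × (Fin n → ZStar)) :
    (Summable fun J => ‖contractTerm i c y J‖) ∧
      ∑' J, ‖contractTerm i c y J‖ ≤ A * rootProd (insTwo i y) :=
  summable_and_tsum_le_of_eq (mul_nonneg hA (rootProd_pos _).le)
    (fun J hJ => by rw [contractTerm_of_ne hJ, norm_zero]) (h y)

theorem ContractBound.rootBound {A : ℝ} (hA : 0 ≤ A) {i : Fin n} {c : (Fin n → ZStar) → ℂ}
    (h : ContractBound A i c) : RootBound A (contract i c) := fun j => by
  obtain ⟨y, rfl⟩ := (insTwo i).surjective j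
  rw [contract_insTwo]
  exact (norm_tsum_le_tsum_norm (h.summable hA y).1).trans (h.summable hA y).2

/-- If the weight sits on one of the three indices of the kernel, the kernel bound absorbs it, and
the bound of c at the place i absorbs the leftover √|J|. If it sits on an untouched index, the roles
are exchanged: c absorbs the weight and the kernel, used at its index J, absorbs √|J|. Either way
the constant A is preserved. -/
theorem QuotBound.contractTerm_mul_wt_le {A : ℝ} (hA : 0 ≤ A) {c : (Fin n → ZStar) → ℂ}
    (hc : QuotBound A c) (i : Fin n) (y : ZStar × ZStar × (Fin n → ZStar)) (J : ZStar)
    (p : Fin (n + 2)) :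
    ‖contractTerm i c y J‖ * wt (insTwo i y p) ≤ A * rootProd (insTwo i y) := by
  obtain ⟨k, l, j⟩ := y
  have h1 := hc (Function.update j i J)
  rw [rootProd_update] at h1
  rw [rootProd_insTwo, rootProd_eq_mul_erase j i, contractTerm, norm_mul, Complex.norm_real,
    Real.norm_eq_abs]
  dsimp only
  have hP : 0 ≤ ∏ p ∈ Finset.univ.erase i, √(wt (j p)) :=
    Finset.prod_nonneg fun _ _ => Real.sqrt_nonneg _
  set P := ∏ p ∈ Finset.univ.erase i, √(wt (j p)) with hPdef
  set N := ‖c (Function.update j i J)‖ with hN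
  have hN0 : 0 ≤ N := norm_nonneg _
  have hJ := sqrt_wt_pos J
  have hinner : ∀ b : ZStar, (b = J ∨ b = k ∨ b = l ∨ b = j i) →
      N * |kern J k l (j i)| * wt b ≤ A * (√(wt k) * (√(wt l) * (√(wt (j i)) * P))) := by
    intro b hb
    have h2 := abs_kern_mul_wt_le J k l (j i) b hb
    have h3 := h1 i
    rw [Function.update_self] at h3
    have h4 : N * √(wt J) ≤ A * P := by
      refine le_of_mul_le_mul_right ?_ hJ
      rw [mul_assoc, Real.mul_self_sqrt (wt_pos J).le]
      linarith
    calc N * |kern J k l (j i)| * wt b = N * (|kern J k l (j i)| * wt b) := by ring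
      _ ≤ N * (√(wt J) * (√(wt k) * √(wt l) * √(wt (j i)))) := by gcongr
      _ = N * √(wt J) * (√(wt k) * √(wt l) * √(wt (j i))) := by ring
      _ ≤ A * P * (√(wt k) * √(wt l) * √(wt (j i))) := by gcongr
      _ = _ := by ring
  rcases insTwo_cases i (k, l, j) p with h | h | ⟨p', h⟩
  · rw [h]; exact hinner _ (by simp)
  · rw [h]; exact hinner _ (by simp)
  · rw [h]
    by_cases hp : p' = i
    · subst hp; exact hinner _ (by simp)
    · have h3 := h1 p'
      rw [Function.update_of_ne hp] at h3
      have h2 := abs_kern_mul_sqrt_le J k l (j i)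
      dsimp only
      calc N * |kern J k l (j i)| * wt (j p')
          = |kern J k l (j i)| * (N * wt (j p')) := by ring
        _ ≤ |kern J k l (j i)| * (A * (√(wt J) * P)) := by gcongr
        _ = |kern J k l (j i)| * √(wt J) * (A * P) := by ring
        _ ≤ √(wt k) * √(wt l) * √(wt (j i)) * (A * P) := by gcongr
        _ = _ := by ring

theorem QuotBound.contractBound {A : ℝ} (hA : 0 ≤ A) {c : (Fin n → ZStar) → ℂ}
    (hc : QuotBound A c) (i : Fin n) : ContractBound A i c := fun y J =>
  (le_mul_of_one_le_right (norm_nonneg _) (one_le_wt _)).trans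
    (hc.contractTerm_mul_wt_le hA i y J 0)

theorem QuotBound.contract {A : ℝ} (hA : 0 ≤ A) {c : (Fin n → ZStar) → ℂ}
    (hc : QuotBound A c) (i : Fin n) : QuotBound A (contract i c) := fun j p => by
  obtain ⟨y, rfl⟩ := (insTwo i).surjective j
  rw [contract_insTwo]
  refine (mul_le_mul_of_nonneg_right (norm_tsum_le_tsum_norm
    ((hc.contractBound hA i).summable hA y).1) (wt_pos _).le).trans ?_
  rw [← tsum_mul_right]
  exact (summable_and_tsum_le_of_eq (mul_nonneg hA (rootProd_pos _).le)
    (fun J hJ => by rw [contractTerm_of_ne hJ, norm_zero, zero_mul])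
    (fun J => hc.contractTerm_mul_wt_le hA i y J p)).2

theorem ZeroMom.contract {c : (Fin n → ZStar) → ℂ} (hc : ZeroMom c) (i : Fin n) :
    ZeroMom (contract i c) := fun j hj => by
  obtain ⟨y, rfl⟩ := (insTwo i).surjective j
  rw [contract_insTwo]
  have h : ∀ J, contractTerm i c y J = 0 := fun J => by
    by_cases hJ : J.1 = y.1.1 - y.2.1.1 + (y.2.2 i).1
    · rw [contractTerm, hc, zero_mul]
      intro h0
      refine hj ?_
      rw [momentum, sum_insTwo i (fun p z => (-1 : ℤ) ^ (p : ℕ) * z.1), val_succAbove_castSucc]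
      simp only [neg_one_pow_skipTwo, Fin.val_castSucc, pow_succ]
      rw [momentum, ← Finset.add_sum_erase _ _ (Finset.mem_univ i), Function.update_self] at h0
      have h1 : ∑ p ∈ Finset.univ.erase i, (-1 : ℤ) ^ (p : ℕ) * (Function.update y.2.2 i J p).1
          = ∑ p ∈ Finset.univ.erase i, (-1 : ℤ) ^ (p : ℕ) * (y.2.2 p).1 :=
        Finset.sum_congr rfl fun p hp => by
          rw [Function.update_of_ne (Finset.ne_of_mem_erase hp)]
      rw [h1, hJ] at h0
      rw [← Finset.add_sum_erase _ _ (Finset.mem_univ i)]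
      linarith
    · exact contractTerm_of_ne hJ
  simp [h]

/-- The two ways to index the terms of a form with the vector field at the place `i`. -/
def contractEquiv (i : Fin n) :
    (ZStar × ZStar × (Fin n → ZStar)) × ZStar ≃ (Fin n → ZStar) × (Fin 3 → ZStar) where
  toFun z := (Function.update z.1.2.2 i z.2, ![z.1.1, z.1.2.1, z.1.2.2 i])
  invFun w := ((w.2 0, w.2 1, Function.update w.1 i (w.2 2)), w.1 i)
  left_inv z := by simp
  right_inv w := by
    simp only [Function.update_idem, Function.update_eq_self, Function.update_self]
    refine Prod.ext rfl (funext fun p => ?_)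
    fin_cases p <;> rfl

/-- Fubini and a change of indices. Inserting q_k q̄_l q_m, or its conjugate when i is odd, at the
place i fills the places i, i + 1, i + 2 with the right alternation of conjugates; the kernel is
real and unaffected. `ContractBound` supplies the absolute convergence. -/
theorem form_update_field (hs : 1 < s) {A A' : ℝ} (hA : 0 ≤ A) (hA' : 0 ≤ A')
    {c : (Fin n → ZStar) → ℂ} (hc : RootBound A c) {i : Fin n} (h : ContractBound A' i c)
    (q : Ell2 s) :
    form hs hA hc (Function.update (fun _ => q) i (field hs fun _ => q))
      = form hs hA' (h.rootBound hA') fun _ => q := by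
  let m : (ZStar × ZStar × (Fin n → ZStar)) → ℂ := fun y =>
    ∏ p, altConj (p : Fin (n + 2)) (q (insTwo i y p))
  let F : (ZStar × ZStar × (Fin n → ZStar)) × ZStar → ℂ := fun z =>
    contractTerm i c z.1 z.2 * m z.1
  have hm : ∀ y : ZStar × ZStar × (Fin n → ZStar),
      m y = altConj i (q y.1) * (altConj i (conj (q y.2.1)) *
      ∏ p, altConj (p : Fin n) (q (y.2.2 p))) := fun y => by
    simp only [m]
    rw [prod_insTwo i (fun p z => altConj p (q z)), val_succAbove_castSucc, altConj_add_one]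
    simp only [altConj_skipTwo, Fin.val_castSucc]
  have hFs : Summable fun z => ‖F z‖ := by
    rw [summable_prod_of_nonneg fun _ => norm_nonneg _]
    have h1 : ∀ y J, ‖F (y, J)‖ = ‖contractTerm i c y J‖ * ‖m y‖ := fun y J => norm_mul _ _
    simp only [h1]
    refine ⟨fun y => (h.summable hA' y).1.mul_right _, ?_⟩
    simp only [tsum_mul_right]
    -- The majorant is the form with coefficients A' ∏ |j_p|^{1/2}, the extreme case of `RootBound`.
    have h2 := (RootBound.summable_norm_term hs hA' (c := fun j => ((A' * rootProd j : ℝ) : ℂ))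
      (n := n + 2) (fun j => by
        rw [Complex.norm_real, Real.norm_of_nonneg (mul_nonneg hA' (rootProd_pos _).le)])
      (fun _ => q))
    rw [← (insTwo i).summable_iff] at h2
    refine h2.of_nonneg_of_le
      (fun y => mul_nonneg (tsum_nonneg fun _ => norm_nonneg _) (norm_nonneg _)) fun y => ?_
    rw [Function.comp_apply, term, norm_mul, Complex.norm_real,
      Real.norm_of_nonneg (mul_nonneg hA' (rootProd_pos _).le)]
    exact mul_le_mul_of_nonneg_right (h.summable hA' y).2 (norm_nonneg _)
  -- The same double sequence, indexed by the outer tuple with J at the place i and by the three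
  -- indices of the field.
  let Fl : (Fin n → ZStar) × (Fin 3 → ZStar) → ℂ := fun w =>
    c w.1 * (altConj i (term (vecCoef (w.1 i)) (fun _ => q) w.2) *
      ∏ p ∈ Finset.univ.erase i, altConj p (q (w.1 p)))
  have hFl : ∀ z, Fl (contractEquiv i z) = F z := by
    rintro ⟨⟨k, l, j⟩, J⟩
    simp only [Fl, F, contractEquiv, Equiv.coe_fn_mk, term, vecCoef, Function.update_self,
      Fin.prod_univ_three, contractTerm, hm]
    have h1 : ∏ p ∈ Finset.univ.erase i, altConj p (q (Function.update j i J p))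
        = ∏ p ∈ Finset.univ.erase i, altConj p (q (j p)) :=
      Finset.prod_congr rfl fun p hp => by
        rw [Function.update_of_ne (Finset.ne_of_mem_erase hp)]
    rw [h1, ← Finset.mul_prod_erase _ _ (Finset.mem_univ i), altConj_real_mul, altConj_mul,
      altConj_mul]
    have e0 : ∀ z, altConj ((0 : Fin 3) : ℕ) z = z := fun z => by simp [altConj]
    have e1 : ∀ z, altConj ((1 : Fin 3) : ℕ) z = conj z := fun z => by simp [altConj]
    have e2 : ∀ z, altConj ((2 : Fin 3) : ℕ) z = z := fun z => by simp [altConj]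
    simp only [e0, e1, e2, Matrix.cons_val_zero, Matrix.cons_val_one, Matrix.cons_val]
    ring
  have hFls : Summable Fl := by
    rw [← (contractEquiv i).summable_iff]
    exact hFs.of_norm.congr fun z => (hFl z).symm
  calc form hs hA hc (Function.update (fun _ => q) i (field hs fun _ => q))
      = ∑' j, ∑' t, Fl (j, t) := by
        rw [form_apply]
        refine tsum_congr fun j => ?_
        rw [term, altConj_update, field_apply, altConj_tsum, ← tsum_mul_right, ← tsum_mul_left]
    _ = ∑' w, Fl w := hFls.tsum_prod.symm
    _ = ∑' z, F z := by
        rw [← (contractEquiv i).tsum_eq]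
        exact tsum_congr hFl
    _ = ∑' y, ∑' J, F (y, J) := hFs.of_norm.tsum_prod
    _ = form hs hA' (h.rootBound hA') fun _ => q := by
        rw [form_apply, ← (insTwo i).tsum_eq]
        refine tsum_congr fun y => ?_
        rw [term, contract_insTwo, ← tsum_mul_right]

/-! ### Flows of homogeneous vector fields -/

section Flow

open scoped ContDiff

variable {E : Type*} [NormedAddCommGroup E]

/-- Curves in `E` over the unit interval. -/
abbrev Curve (E : Type*) [NormedAddCommGroup E] : Type _ := C(Set.Icc (0 : ℝ) 1, E)

/-- The value at time `t`, extended by constants outside of the unit interval. -/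
def Curve.at (γ : Curve E) (t : ℝ) : E := Set.IccExtend zero_le_one γ t

theorem Curve.continuous_at' (γ : Curve E) : Continuous γ.at := γ.continuous.Icc_extend'

theorem Curve.at_coe (γ : Curve E) (t : Set.Icc (0 : ℝ) 1) : γ.at t = γ t :=
  Set.IccExtend_val _ _ _

theorem Curve.norm_at_le (γ : Curve E) (t : ℝ) : ‖γ.at t‖ ≤ ‖γ‖ := γ.norm_coe_le_norm _

variable [NormedSpace ℝ E]

/-- The primitive that vanishes at time `0`. -/
def primitive : Curve E →L[ℝ] Curve E :=
  LinearMap.mkContinuous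
    { toFun := fun γ => ⟨fun t => ∫ r in (0 : ℝ)..t, γ.at r,
        (intervalIntegral.continuous_primitive
          (fun a b => γ.continuous_at'.intervalIntegrable a b) 0).comp continuous_subtype_val⟩
      map_add' := fun γ δ => by
        ext t
        exact intervalIntegral.integral_add (γ.continuous_at'.intervalIntegrable _ _)
          (δ.continuous_at'.intervalIntegrable _ _)
      map_smul' := fun c γ => by
        ext t
        exact intervalIntegral.integral_smul c γ.at } 1 fun γ => by
    rw [one_mul]
    refine (ContinuousMap.norm_le _ (norm_nonneg _)).2 fun t => ?_
    have h := intervalIntegral.norm_integral_le_of_norm_le_const (a := 0) (b := (t : ℝ))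
      (f := γ.at) (C := ‖γ‖) fun r _ => γ.norm_at_le r
    refine h.trans (mul_le_of_le_one_right (norm_nonneg _) ?_)
    rw [sub_zero, abs_of_nonneg t.2.1]
    exact t.2.2

theorem primitive_apply (γ : Curve E) (t : Set.Icc (0 : ℝ) 1) :
    primitive γ t = ∫ r in (0 : ℝ)..t, γ.at r := rfl

theorem primitive_zero_right (γ : Curve E) : (primitive γ).at 0 = 0 := by
  have h := (primitive γ).at_coe ⟨0, by simp⟩
  rw [primitive_apply, intervalIntegral.integral_same] at h
  exact h

theorem hasDerivWithinAt_primitive [CompleteSpace E] (γ : Curve E) {t : ℝ}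
    (ht : t ∈ Set.Icc (0 : ℝ) 1) :
    HasDerivWithinAt (primitive γ).at (γ.at t) (Set.Icc 0 1) t := by
  have h := intervalIntegral.integral_hasDerivAt_right
    (γ.continuous_at'.intervalIntegrable 0 t)
    (γ.continuous_at'.stronglyMeasurableAtFilter _ _) γ.continuous_at'.continuousAt
  have h1 : ∀ r ∈ Set.Icc (0 : ℝ) 1, (primitive γ).at r = ∫ u in (0 : ℝ)..r, γ.at u :=
    fun r hr => (primitive γ).at_coe ⟨r, hr⟩
  exact h.hasDerivWithinAt.congr h1 (h1 t ht)

variable {n : ℕ}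

/-- A multilinear map acts on curves pointwise. -/
def liftCurve (V : ContinuousMultilinearMap ℝ (fun _ : Fin n => E) E) :
    ContinuousMultilinearMap ℝ (fun _ : Fin n => Curve E) (Curve E) :=
  MultilinearMap.mkContinuous
    { toFun := fun x => ⟨fun t => V fun p => x p t, by
        exact V.cont.comp (continuous_pi fun p => (x p).continuous)⟩
      map_update_add' := fun x i y z => by
        ext t
        have h : ∀ w : Curve E, (fun p => Function.update x i w p t)
            = Function.update (fun p => x p t) i (w t) := fun w => by
          funext p
          by_cases hp : p = i
          · subst hp; simp
          · simp [Function.update_of_ne hp]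
        simp [h]
      map_update_smul' := fun x i c y => by
        ext t
        have h : ∀ w : Curve E, (fun p => Function.update x i w p t)
            = Function.update (fun p => x p t) i (w t) := fun w => by
          funext p
          by_cases hp : p = i
          · subst hp; simp
          · simp [Function.update_of_ne hp]
        simp [h] }
    ‖V‖ fun x => by
      refine (ContinuousMap.norm_le _ (by positivity)).2 fun t => ?_
      refine (V.le_opNorm _).trans ?_
      gcongr with p
      exact (x p).norm_coe_le_norm t

theorem hasFDerivAt_diag {F : Type*} [NormedAddCommGroup F] [NormedSpace ℝ F]
    (V : ContinuousMultilinearMap ℝ (fun _ : Fin n => E) F) (x : E) :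
    HasFDerivAt (fun q => V fun _ => q)
      ((V.linearDeriv fun _ => x).comp (ContinuousLinearMap.pi fun _ => .id ℝ E)) x :=
  (V.hasFDerivAt (fun _ => x)).comp x
    (ContinuousLinearMap.pi fun _ : Fin n => ContinuousLinearMap.id ℝ E).hasFDerivAt

theorem contDiff_diag {F : Type*} [NormedAddCommGroup F] [NormedSpace ℝ F]
    (V : ContinuousMultilinearMap ℝ (fun _ : Fin n => E) F) :
    ContDiff ℝ ω (fun q => V fun _ => q) :=
  V.contDiff.comp (contDiff_pi.2 fun _ => contDiff_id)

theorem linearDeriv_diag_apply {F : Type*} [NormedAddCommGroup F] [NormedSpace ℝ F]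
    (V : ContinuousMultilinearMap ℝ (fun _ : Fin n => E) F) (x h : E) :
    (V.linearDeriv fun _ => x).comp (ContinuousLinearMap.pi fun _ => .id ℝ E) h
      = ∑ i, V (Function.update (fun _ => x) i h) := by
  simp

/-- The constant curves. -/
def constCurve : E →L[ℝ] Curve E :=
  LinearMap.mkContinuous
    { toFun := fun q => ContinuousMap.const _ q
      map_add' := fun _ _ => rfl
      map_smul' := fun _ _ => rfl } 1 fun q => by
    rw [one_mul]
    exact (ContinuousMap.norm_le _ (norm_nonneg _)).2 fun _ => le_rfl

/-- A family `Φ` of curves solves the initial value problem `γ' = V(γ, …, γ)`, `γ(0) = q`, for `q`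
near the origin, and depends analytically on `q`. -/
structure IsFlow (V : ContinuousMultilinearMap ℝ (fun _ : Fin n => E) E) (Φ : E → Curve E) :
    Prop where
  map_zero : Φ 0 = 0
  analytic : ∀ᶠ q in 𝓝 (0 : E), ContDiffAt ℝ ω Φ q
  eq : ∀ᶠ q in 𝓝 (0 : E), Φ q = constCurve q + primitive (liftCurve V fun _ => Φ q)

/-- The Picard operator γ ↦ γ − ∫ V(γ, …, γ) is a polynomial on the Banach space of curves. V has
degree at least 2, so its derivative at 0 is the identity and it has an analytic local inverse.
Applied to constant curves, the inverse gives solutions on the whole unit interval, analytic in the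
initial value. -/
theorem exists_isFlow [CompleteSpace E]
    (V : ContinuousMultilinearMap ℝ (fun _ : Fin (n + 2) => E) E) :
    ∃ Φ : E → Curve E, IsFlow V Φ := by
  let N : Curve E → Curve E := fun γ => γ - primitive (liftCurve V fun _ => γ)
  have hN : ContDiff ℝ ω N := contDiff_id.sub
    ((primitive (E := E)).contDiff.comp (contDiff_diag (liftCurve V)))
  have hN' : HasFDerivAt N (ContinuousLinearEquiv.refl ℝ (Curve E) : Curve E →L[ℝ] Curve E) 0 := by
    have h := (hasFDerivAt_id (𝕜 := ℝ) (0 : Curve E)).sub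
      ((primitive (E := E)).hasFDerivAt.comp (0 : Curve E) (hasFDerivAt_diag (liftCurve V) 0))
    refine h.congr_fderiv ?_
    ext1 γ
    -- There are at least two slots, so one of them still contains the zero curve.
    have h0 : ∀ i : Fin (n + 2),
        liftCurve V (Function.update (fun _ => (0 : Curve E)) i γ) = 0 := fun i => by
      obtain ⟨k, hk⟩ := exists_ne i
      refine (liftCurve V).map_coord_zero k ?_
      rw [Function.update_of_ne hk]
    simp [h0]
  have hN0 : N 0 = 0 := by
    have : liftCurve V (fun _ => (0 : Curve E)) = 0 := (liftCurve V).map_coord_zero 0 rfl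
    simp [N, this]
  let L := hN.contDiffAt.localInverse hN' (by simp)
  have hL : ContDiffAt ℝ ω L 0 := by
    have := hN.contDiffAt.to_localInverse hN' (by simp)
    rwa [hN0] at this
  have hst := (hN.contDiffAt (x := 0)).hasStrictFDerivAt' hN' (by simp)
  have hLN : ∀ᶠ y in 𝓝 (0 : Curve E), N (L y) = y := by
    have := hst.eventually_right_inverse
    rwa [hN0] at this
  have hL0 : L 0 = 0 := by
    have := hst.localInverse_apply_image
    rwa [hN0] at this
  have hc0 : Filter.Tendsto (constCurve (E := E)) (𝓝 0) (𝓝 0) := by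
    have := (constCurve (E := E)).continuous.tendsto 0
    rwa [map_zero] at this
  refine ⟨fun q => L (constCurve q), ?_, ?_, ?_⟩
  · simp [hL0]
  · have h1 : ContDiffAt ℝ ω L (constCurve (0 : E)) := by rwa [map_zero]
    exact (h1.comp (0 : E) (constCurve (E := E)).contDiff.contDiffAt).eventually (by simp)
  · filter_upwards [hc0.eventually hLN] with q hq
    exact (sub_eq_iff_eq_add.1 hq)

/-! ### The linearized flow and invariant bilinear forms -/

variable {V : ContinuousMultilinearMap ℝ (fun _ : Fin n => E) E}
  {Φ : E → Curve E}

/-- The integrand δ is kept general so as to cover both the flow equation and its linearization. -/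
theorem hasDerivWithinAt_of_eq [CompleteSpace E] {γ δ : Curve E} {q : E}
    (h : γ = constCurve q + primitive δ) {t : ℝ} (ht : t ∈ Set.Icc (0 : ℝ) 1) :
    HasDerivWithinAt γ.at (δ.at t) (Set.Icc 0 1) t := by
  have h1 := (hasDerivWithinAt_primitive δ ht).const_add q
  refine h1.congr (fun r _ => ?_) ?_ <;> rw [h] <;> rfl

theorem at_zero_of_eq {γ δ : Curve E} {q : E} (h : γ = constCurve q + primitive δ) :
    γ.at 0 = q := by
  have h1 : γ.at 0 = q + (primitive δ).at 0 := by rw [h]; rfl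
  rw [h1, primitive_zero_right, add_zero]

/-- The derivative of the flow solves the linearized equation. -/
theorem fderiv_flow_eq {q : E} (ha : DifferentiableAt ℝ Φ q)
    (heq : ∀ᶠ p in 𝓝 q, Φ p = constCurve p + primitive (liftCurve V fun _ => Φ p)) (h : E) :
    fderiv ℝ Φ q h = constCurve h
      + primitive (∑ i, liftCurve V (Function.update (fun _ => Φ q) i (fderiv ℝ Φ q h))) := by
  have h1 := ha.hasFDerivAt
  have h2 := (constCurve (E := E)).hasFDerivAt (x := q) |>.add
    ((primitive (E := E)).hasFDerivAt.comp q ((hasFDerivAt_diag (liftCurve V) (Φ q)).comp q h1))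
  have h3 := h1.unique (h2.congr_of_eventuallyEq heq)
  have h4 := congrArg (fun L : E →L[ℝ] Curve E => L h) h3
  simpa using h4

/-- Along two solutions of the linearized equation the value of b has derivative b(DX η, κ) + b(η,
DX κ) = 0, so it is the same at times 1 and 0. -/
theorem symplectic_flow [CompleteSpace E] {W : Type*} [NormedAddCommGroup W] [NormedSpace ℝ W]
    (b : E →L[ℝ] E →L[ℝ] W)
    (hb : ∀ q h k : E, b (∑ i, V (Function.update (fun _ => q) i h)) k
      + b h (∑ i, V (Function.update (fun _ => q) i k)) = 0)
    {q : E} (ha : DifferentiableAt ℝ Φ q)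
    (heq : ∀ᶠ p in 𝓝 q, Φ p = constCurve p + primitive (liftCurve V fun _ => Φ p)) (h k : E) :
    b ((fderiv ℝ Φ q h).at 1) ((fderiv ℝ Φ q k).at 1) = b h k := by
  have e1 := fderiv_flow_eq ha heq h
  have e2 := fderiv_flow_eq ha heq k
  generalize fderiv ℝ Φ q h = η at e1 ⊢
  generalize fderiv ℝ Φ q k = κ at e2 ⊢
  have hat : ∀ (ξ : Curve E) (t : ℝ),
      (∑ i, liftCurve V (Function.update (fun _ => Φ q) i ξ)).at t
        = ∑ i, V (Function.update (fun _ => (Φ q).at t) i (ξ.at t)) := fun ξ t => by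
    rw [Curve.at, Set.IccExtend, Function.comp_apply, ContinuousMap.coe_sum, Finset.sum_apply]
    refine Finset.sum_congr rfl fun i _ => ?_
    change V _ = V _
    congr 1
    funext p
    by_cases hp : p = i
    · subst hp; simp [Curve.at, Set.IccExtend]
    · simp [Function.update_of_ne hp, Curve.at, Set.IccExtend]
  have hd : ∀ t ∈ Set.Icc (0 : ℝ) 1,
      HasDerivWithinAt (fun t => b (η.at t) (κ.at t)) 0 (Set.Icc 0 1) t := fun t ht => by
    have h1 := hasDerivWithinAt_of_eq e1 ht
    have h2 := hasDerivWithinAt_of_eq e2 ht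
    have h3 := (b.hasFDerivAt.comp_hasDerivWithinAt t h1).clm_apply h2
    refine h3.congr_deriv ?_
    rw [hat, hat]
    exact hb _ _ _
  have h1 := norm_image_sub_le_of_norm_deriv_le_segment_01' (C := 0) hd
    (fun t _ => by simp)
  have h2 := sub_eq_zero.1 (norm_le_zero_iff.1 h1)
  simp only [at_zero_of_eq e1, at_zero_of_eq e2] at h2
  exact h2

end Flow

/-! ### The symplectic form and the generating vector field -/

section Symplectic

variable {s : ℝ}

theorem summable_norm_mul_norm (hs : 0 ≤ s) (h k : Ell2 s) :
    (Summable fun j => ‖h j‖ * ‖k j‖) ∧ ∑' j, ‖h j‖ * ‖k j‖ ≤ ‖h‖ * ‖k‖ := by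
  obtain ⟨h1, h2⟩ := summable_mul_and_tsum_mul_le
    (fun j => by have := wt_pos j; positivity) (fun j => by have := wt_pos j; positivity)
    h.summable_wt k.summable_wt
  rw [← Ell2.norm_eq_sqrt, ← Ell2.norm_eq_sqrt] at h2
  have h3 : ∀ j, ‖h j‖ * ‖k j‖ ≤ wt j ^ s * ‖h j‖ * (wt j ^ s * ‖k j‖) := fun j => by
    have hw := Real.one_le_rpow (one_le_wt j) hs
    gcongr
    · exact le_mul_of_one_le_left (norm_nonneg _) hw
    · exact le_mul_of_one_le_left (norm_nonneg _) hw
  have h4 := h1.of_nonneg_of_le (fun j => by positivity) h3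
  exact ⟨h4, (h4.tsum_le_tsum h3 h1).trans h2⟩

theorem norm_inv_index_le (j : ZStar) : ‖((j.1 : ℂ))⁻¹‖ ≤ 1 := by
  rw [norm_inv, Complex.norm_intCast]
  exact inv_le_one_of_one_le₀ (one_le_wt j)

theorem summable_index_inv_mul (hs : 0 ≤ s) (h k : Ell2 s) :
    Summable fun j : ZStar => ((j.1 : ℂ))⁻¹ * (h j * conj (k j)) := by
  refine Summable.of_norm_bounded (summable_norm_mul_norm hs h k).1 fun j => ?_
  rw [norm_mul, norm_mul, RCLike.norm_conj]
  exact mul_le_of_le_one_left (by positivity) (norm_inv_index_le j)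

theorem symplForm_eq_sub (hs : 0 ≤ s) (h k : Ell2 s) :
    symplForm h k = -Complex.I * (∑' j : ZStar, ((j.1 : ℂ))⁻¹ * (h j * conj (k j))
      - ∑' j : ZStar, ((j.1 : ℂ))⁻¹ * (k j * conj (h j))) := by
  rw [symplForm, ← (summable_index_inv_mul hs h k).tsum_sub (summable_index_inv_mul hs k h)]
  congr 1
  exact tsum_congr fun j => by ring

theorem symplForm_swap (hs : 0 ≤ s) (h k : Ell2 s) : symplForm h k = -symplForm k h := by
  rw [symplForm_eq_sub hs, symplForm_eq_sub hs]
  ring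

/-- The symplectic form as a bounded bilinear form. -/
def symplBilin (hs : 0 ≤ s) : Ell2 s →L[ℝ] Ell2 s →L[ℝ] ℂ :=
  LinearMap.mkContinuous₂
    (LinearMap.mk₂ ℝ (fun h k => symplForm h k)
      (fun h h' k => by
        simp only [symplForm_eq_sub hs, Ell2.add_coe, map_add, mul_add, add_mul]
        rw [(summable_index_inv_mul hs h k).tsum_add (summable_index_inv_mul hs h' k),
          (summable_index_inv_mul hs k h).tsum_add (summable_index_inv_mul hs k h')]
        ring)
      (fun c h k => by
        simp only [symplForm, Complex.real_smul]
        rw [mul_left_comm (c : ℂ), ← tsum_mul_left (a := (c : ℂ))]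
        congr 1
        refine tsum_congr fun j => ?_
        simp only [Ell2.real_smul_coe, map_mul, Complex.conj_ofReal]
        ring)
      (fun h k k' => by
        simp only [symplForm_eq_sub hs, Ell2.add_coe, map_add, mul_add, add_mul]
        rw [(summable_index_inv_mul hs h k).tsum_add (summable_index_inv_mul hs h k'),
          (summable_index_inv_mul hs k h).tsum_add (summable_index_inv_mul hs k' h)]
        ring)
      (fun c h k => by
        simp only [symplForm, Complex.real_smul]
        rw [mul_left_comm (c : ℂ), ← tsum_mul_left (a := (c : ℂ))]
        congr 1
        refine tsum_congr fun j => ?_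
        simp only [Ell2.real_smul_coe, map_mul, Complex.conj_ofReal]
        ring))
    2 fun h k => by
      obtain ⟨h1, h2⟩ := summable_norm_mul_norm hs h k
      rw [LinearMap.mk₂_apply, symplForm, norm_mul, norm_neg, Complex.norm_I, one_mul]
      refine (tsum_of_norm_bounded (h1.hasSum.mul_left 2) fun j => ?_).trans (by linarith)
      rw [norm_mul]
      refine (mul_le_of_le_one_left (norm_nonneg _) (norm_inv_index_le j)).trans ?_
      refine (norm_sub_le _ _).trans (le_of_eq ?_)
      simp only [norm_mul, RCLike.norm_conj]
      ring

theorem symplBilin_apply (hs : 0 ≤ s) (h k : Ell2 s) : symplBilin hs h k = symplForm h k := rfl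

/-- The coefficients of the generating function, up to a constant factor. -/
def genCoef (j : Fin 4 → ZStar) : ℂ := ((j 3).1 : ℂ)⁻¹ * fieldCoef j

theorem genCoef_rootBound : RootBound 1 genCoef := fun j => by
  rw [genCoef, norm_mul]
  exact (mul_le_of_le_one_left (norm_nonneg _) (norm_inv_index_le _)).trans
    (fieldCoef_quotBound.rootBound j)

/-- The factor J of the field cancels the 1/J of the symplectic form. The remaining denominator
displays the symmetries in the indices. -/
theorem genCoef_eq (j : Fin 4 → ZStar) :
    genCoef j = if (j 0).1 - (j 1).1 + (j 2).1 = (j 3).1 then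
      -(1 / (4 * Real.pi)) / ((((j 3).1 : ℂ) - (j 0).1) * (((j 3).1 : ℂ) - (j 2).1)) else 0 := by
  have h3 : ((j 3).1 : ℂ) ≠ 0 := Int.cast_ne_zero.2 (j 3).2
  rw [genCoef, fieldCoef, vecCoef, kern]
  change _ * (((if (j 0).1 - (j 1).1 + (j 2).1 = (j 3).1 then
    -(1 / (4 * Real.pi)) * (((j 3).1 : ℝ) / ((((j 3).1 : ℝ) - (j 0).1) *
      (((j 3).1 : ℝ) - (j 2).1))) else 0 : ℝ)) : ℂ) = _
  split_ifs
  · push_cast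
    field_simp
  · simp

/-- The polarized generating function, up to a constant factor. -/
def genForm (x₀ x₁ x₂ x₃ : Ell2 s) : ℂ :=
  ∑' j : Fin 4 → ZStar, genCoef j * (x₀ (j 0) * conj (x₁ (j 1)) * x₂ (j 2) * conj (x₃ (j 3)))

/-! ### Symmetries of the generating function -/

theorem tsum_comp_perm {n : ℕ} (σ : Equiv.Perm (Fin n)) (f : (Fin n → ZStar) → ℂ) :
    ∑' j, f (j ∘ σ) = ∑' j, f j :=
  (Equiv.arrowCongr σ.symm (Equiv.refl ZStar)).tsum_eq f

theorem genForm_swap_even (x₀ x₁ x₂ x₃ : Ell2 s) :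
    genForm x₂ x₁ x₀ x₃ = genForm x₀ x₁ x₂ x₃ := by
  rw [genForm, ← tsum_comp_perm (Equiv.swap 0 2), genForm]
  refine tsum_congr fun j => ?_
  have e0 : (Equiv.swap (0 : Fin 4) 2) 0 = 2 := by decide
  have e1 : (Equiv.swap (0 : Fin 4) 2) 1 = 1 := by decide
  have e2 : (Equiv.swap (0 : Fin 4) 2) 2 = 0 := by decide
  have e3 : (Equiv.swap (0 : Fin 4) 2) 3 = 3 := by decide
  have h : genCoef (j ∘ Equiv.swap 0 2) = genCoef j := by
    rw [genCoef_eq, genCoef_eq]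
    simp only [Function.comp_apply, e0, e1, e2, e3]
    refine if_congr (by constructor <;> intro h <;> linarith) ?_ rfl
    rw [mul_comm (((j 3).1 : ℂ) - _)]
  rw [h]
  simp only [Function.comp_apply, e0, e1, e2, e3]
  ring

/-- At zero momentum (j₃ − j₀)(j₃ − j₂) = (j₁ − j₀)(j₁ − j₂). -/
theorem genForm_swap_odd (x₀ x₁ x₂ x₃ : Ell2 s) :
    genForm x₀ x₃ x₂ x₁ = genForm x₀ x₁ x₂ x₃ := by
  rw [genForm, ← tsum_comp_perm (Equiv.swap 1 3), genForm]
  refine tsum_congr fun j => ?_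
  have e0 : (Equiv.swap (1 : Fin 4) 3) 0 = 0 := by decide
  have e1 : (Equiv.swap (1 : Fin 4) 3) 1 = 3 := by decide
  have e2 : (Equiv.swap (1 : Fin 4) 3) 2 = 2 := by decide
  have e3 : (Equiv.swap (1 : Fin 4) 3) 3 = 1 := by decide
  have h : genCoef (j ∘ Equiv.swap 1 3) = genCoef j := by
    rw [genCoef_eq, genCoef_eq]
    simp only [Function.comp_apply, e0, e1, e2, e3]
    by_cases hj : (j 0).1 - (j 1).1 + (j 2).1 = (j 3).1
    · rw [if_pos hj, if_pos (by linarith)]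
      have h' : ((j 0).1 : ℂ) - (j 1).1 + (j 2).1 = (j 3).1 := by exact_mod_cast hj
      congr 1
      rw [← h']
      ring
    · rw [if_neg hj, if_neg fun h => hj (by linarith)]
  rw [h]
  simp only [Function.comp_apply, e0, e1, e2, e3]
  ring

/-- Exchanging conjugated and unconjugated places turns the denominator into its negative. On the
diagonal the form is thus purely imaginary, and i times it is a real generating function. -/
theorem conj_genForm (x₀ x₁ x₂ x₃ : Ell2 s) :
    conj (genForm x₀ x₁ x₂ x₃) = -genForm x₁ x₀ x₃ x₂ := by
  rw [genForm, Complex.conj_tsum, ← tsum_comp_perm (Equiv.swap 0 1 * Equiv.swap 2 3), genForm,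
    ← tsum_neg]
  refine tsum_congr fun j => ?_
  have e0 : (Equiv.swap 0 1 * Equiv.swap 2 3 : Equiv.Perm (Fin 4)) 0 = 1 := by decide
  have e1 : (Equiv.swap 0 1 * Equiv.swap 2 3 : Equiv.Perm (Fin 4)) 1 = 0 := by decide
  have e2 : (Equiv.swap 0 1 * Equiv.swap 2 3 : Equiv.Perm (Fin 4)) 2 = 3 := by decide
  have e3 : (Equiv.swap 0 1 * Equiv.swap 2 3 : Equiv.Perm (Fin 4)) 3 = 2 := by decide
  have h : conj (genCoef (j ∘ (Equiv.swap 0 1 * Equiv.swap 2 3 : Equiv.Perm (Fin 4))))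
      = -genCoef j := by
    rw [genCoef_eq, genCoef_eq]
    simp only [Function.comp_apply, e0, e1, e2, e3]
    by_cases hj : (j 0).1 - (j 1).1 + (j 2).1 = (j 3).1
    · rw [if_pos hj, if_pos (by linarith)]
      have h' : ((j 0).1 : ℂ) - (j 1).1 + (j 2).1 = (j 3).1 := by exact_mod_cast hj
      simp only [map_neg, map_div₀, map_mul, map_sub, map_one, Complex.conj_ofReal,
        Complex.conj_ofNat, map_intCast]
      have hd : (((j 2).1 : ℂ) - (j 1).1) * (((j 2).1 : ℂ) - (j 3).1)
          = -((((j 3).1 : ℂ) - (j 0).1) * (((j 3).1 : ℂ) - (j 2).1)) := by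
        rw [← h']
        ring
      rw [hd, div_neg]
    · rw [if_neg hj, if_neg fun h => hj (by linarith), map_zero, neg_zero]
  rw [map_mul, h]
  simp only [Function.comp_apply, e0, e1, e2, e3, map_mul, Complex.conj_conj]
  ring

/-- Pairing with the symplectic form supplies 1/J for each component J, which turns the kernel into
`genCoef`. The field is thereby expressed by a scalar form with good symmetries. -/
theorem symplForm_field (hs : 1 < s) (h : Ell2 s) (x : Fin 3 → Ell2 s) :
    symplForm h (field hs x) = Complex.I *
      (genForm (x 0) (x 1) (x 2) h - conj (genForm (x 0) (x 1) (x 2) h)) := by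
  have h0 : 0 ≤ s := by linarith
  have key : ∑' J : ZStar, ((J.1 : ℂ))⁻¹ * (field hs x J * conj (h J))
      = genForm (x 0) (x 1) (x 2) h := by
    let e := Fin.snocEquiv (fun _ : Fin 4 => ZStar)
    have h1 := (genCoef_rootBound.summable_norm_term hs zero_le_one
      ![x 0, x 1, x 2, h]).of_norm
    have h2 : ∀ j, term genCoef ![x 0, x 1, x 2, h] j
        = genCoef j * (x 0 (j 0) * conj (x 1 (j 1)) * x 2 (j 2) * conj (h (j 3))) := fun j => by
      rw [term, Fin.prod_univ_four]
      have : ¬ Even 3 := by decide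
      simp [altConj, this]
    replace h1 := h1.congr h2
    rw [genForm, ← e.tsum_eq]
    rw [← e.summable_iff] at h1
    have h3 := h1.tsum_prod
    simp only [Function.comp_apply] at h3
    rw [h3]
    refine tsum_congr fun J => ?_
    rw [field_apply, ← tsum_mul_right, ← tsum_mul_left]
    refine tsum_congr fun t => ?_
    have e3 : e (J, t) 3 = J := by
      change (Fin.snoc (α := fun _ => ZStar) t J : Fin 4 → ZStar) (Fin.last 3) = J
      exact Fin.snoc_last (α := fun _ => ZStar) _ _
    have e' : ∀ p : Fin 3, e (J, t) p.castSucc = t p := fun p =>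
      Fin.snoc_castSucc (α := fun _ => ZStar) _ _ _
    have hg : genCoef (e (J, t)) = ((J.1 : ℂ))⁻¹ * vecCoef J t := by
      rw [genCoef, fieldCoef, e3]
      congr 2
      exact funext e'
    have e0 : e (J, t) 0 = t 0 := e' 0
    have e1 : e (J, t) 1 = t 1 := e' 1
    have e2 : e (J, t) 2 = t 2 := e' 2
    rw [hg, e0, e1, e2, e3, term, Fin.prod_univ_three]
    simp [altConj]
    ring
  have key' : ∑' J : ZStar, ((J.1 : ℂ))⁻¹ * (h J * conj (field hs x J))
      = conj (genForm (x 0) (x 1) (x 2) h) := by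
    rw [← key, Complex.conj_tsum]
    refine tsum_congr fun J => ?_
    simp only [map_mul, map_inv₀, map_intCast, Complex.conj_conj]
    ring
  rw [symplForm_eq_sub h0, key, key']
  ring

/-- The generating vector field is Hamiltonian: its linearization is skew for the symplectic
form. -/
theorem symplBilin_linearized_field (hs : 1 < s) (q h k : Ell2 s) :
    symplBilin (by linarith : 0 ≤ s) (∑ i, field hs (Function.update (fun _ => q) i h)) k
      + symplBilin (by linarith : 0 ≤ s) h
        (∑ i, field hs (Function.update (fun _ => q) i k)) = 0 := by
  have h0 : 0 ≤ s := by linarith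
  -- Up to a factor the right side is the second derivative of the generating function, which is
  -- symmetric in a and b. Against the skew symplectic form the two summands cancel.
  have key : ∀ a b : Ell2 s,
      symplBilin h0 a (∑ i, field hs (Function.update (fun _ => q) i b))
        = Complex.I * (2 * genForm b a q q + 2 * genForm a b q q + genForm q a q b
          + genForm a q b q) := fun a b => by
    rw [map_sum, Fin.sum_univ_three]
    simp only [symplBilin_apply, symplForm_field, conj_genForm, Function.update_apply]
    simp only [if_true, Fin.isValue, reduceIte, Fin.reduceEq]
    rw [genForm_swap_even b q q a, genForm_swap_odd b a q q, genForm_swap_odd q b q a,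
      genForm_swap_even a q q b, genForm_swap_odd a b q q,
      genForm_swap_even a b q q, genForm_swap_even a q b q]
    ring
  rw [symplBilin_apply, symplForm_swap h0, ← symplBilin_apply h0, key, key,
    genForm_swap_odd q h q k, genForm_swap_even k q h q]
  ring

end Symplectic

/-! ### Homogeneous polynomials and their derivatives along the vector field -/

section Polynomials

variable {n : ℕ} {s : ℝ}

/-- The homogeneous polynomial `∑_j c_j q_{j_1} q̄_{j_2} q_{j_3} ⋯`. -/
def poly (c : (Fin n → ZStar) → ℂ) (q : Ell2 s) : ℂ := ∑' j, term c (fun _ => q) j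

/-- The coefficients of the derivative of a polynomial along the generating vector field. -/
def bracket (c : (Fin n → ZStar) → ℂ) (j : Fin (n + 2) → ZStar) : ℂ := ∑ i, contract i c j

theorem QuotBound.bracket {A : ℝ} (hA : 0 ≤ A) {c : (Fin n → ZStar) → ℂ}
    (hc : QuotBound A c) : QuotBound (n * A) (bracket c) := fun j p => by
  calc ‖DNLS.bracket c j‖ * wt (j p)
      ≤ (∑ i, ‖DNLS.contract i c j‖) * wt (j p) :=
        mul_le_mul_of_nonneg_right (norm_sum_le _ _) (wt_pos _).le
    _ = ∑ i, ‖DNLS.contract i c j‖ * wt (j p) := Finset.sum_mul _ _ _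
    _ ≤ ∑ _i : Fin n, A * rootProd j := Finset.sum_le_sum fun i _ => hc.contract hA i j p
    _ = n * A * rootProd j := by simp [mul_assoc]

theorem ZeroMom.bracket {c : (Fin n → ZStar) → ℂ} (hc : ZeroMom c) : ZeroMom (bracket c) :=
  fun j hj => Finset.sum_eq_zero fun i _ => hc.contract i j hj

theorem norm_poly_le (hs : 1 < s) {A : ℝ} (hA : 0 ≤ A) {c : (Fin n → ZStar) → ℂ}
    (hc : RootBound A c) (q : Ell2 s) : ‖poly c q‖ ≤ A * (Ell2.embConst s * ‖q‖) ^ n := by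
  refine (norm_tsum_le_tsum_norm (hc.summable_norm_term hs hA _)).trans
    ((hc.tsum_norm_term_le hs hA _).trans (le_of_eq ?_))
  rw [Finset.prod_const, Finset.card_univ, Fintype.card_fin, mul_pow, mul_assoc]

theorem poly_bracket (hs : 1 < s) {A : ℝ} (hA : 0 ≤ A) {c : (Fin n → ZStar) → ℂ}
    (h : ∀ i, ContractBound A i c) (q : Ell2 s) :
    poly (bracket c) q = ∑ i, poly (contract i c) q := by
  simp only [poly]
  rw [← Summable.tsum_finsetSum fun i _ =>
    (((h i).rootBound hA).summable_norm_term hs hA (fun _ => q)).of_norm]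
  refine tsum_congr fun j => ?_
  simp only [term, bracket, Finset.sum_mul]

theorem hasFDerivAt_poly (hs : 1 < s) {A : ℝ} (hA : 0 ≤ A) {c : (Fin n → ZStar) → ℂ}
    (hc : RootBound A c) (q : Ell2 s) :
    HasFDerivAt (poly c) (((form hs hA hc).linearDeriv fun _ => q).comp
      (ContinuousLinearMap.pi fun _ => .id ℝ (Ell2 s))) q :=
  hasFDerivAt_diag (form hs hA hc) q

/-- Chain rule, with `form_update_field` for each slot. Only a bound of the contracted terms is
required, not `QuotBound`, since Λ must be covered as well. -/
theorem hasDerivWithinAt_poly (hs : 1 < s) {A A' : ℝ} (hA : 0 ≤ A) (hA' : 0 ≤ A')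
    {c : (Fin n → ZStar) → ℂ} (hc : RootBound A c) (h : ∀ i, ContractBound A' i c)
    {γ : ℝ → Ell2 s} {S : Set ℝ} {t : ℝ}
    (hγ : HasDerivWithinAt γ (field hs fun _ => γ t) S t) :
    HasDerivWithinAt (fun t => poly c (γ t)) (poly (bracket c) (γ t)) S t := by
  refine ((hasFDerivAt_poly hs hA hc (γ t)).comp_hasDerivWithinAt t hγ).congr_deriv ?_
  rw [linearDeriv_diag_apply, poly_bracket hs hA' h]
  exact Finset.sum_congr rfl fun i _ => form_update_field hs hA hA' hc (h i) (γ t)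

/-! ### Iterated derivatives -/

/-- The coefficients of the `m`-th derivative of a quartic polynomial along the vector field. -/
def iterBracket (c : (Fin 4 → ZStar) → ℂ) : (m : ℕ) → (Fin (2 * (m + 2)) → ZStar) → ℂ
  | 0 => c
  | m + 1 => bracket (iterBracket c m)

/-- Each bracket multiplies the constant by the current degree, and the product of the degrees 2(k +
2), k < m, is 2^m (m + 1)!. -/
theorem iterBracket_quotBound {A : ℝ} (hA : 0 ≤ A) {c : (Fin 4 → ZStar) → ℂ}
    (hc : QuotBound A c) (m : ℕ) :
    QuotBound (A * 2 ^ m * (m + 1).factorial) (iterBracket c m) := by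
  induction m with
  | zero =>
    have h : A * 2 ^ 0 * (0 + 1).factorial = A := by simp
    rw [h]
    exact hc
  | succ m ih =>
    have h := ih.bracket (by positivity)
    have h1 : ((2 * (m + 2) : ℕ) : ℝ) * (A * 2 ^ m * (m + 1).factorial)
        = A * 2 ^ (m + 1) * (m + 1 + 1).factorial := by
      rw [Nat.factorial_succ (m + 1)]
      push_cast
      ring
    rw [h1] at h
    exact h

theorem iterBracket_zeroMom {c : (Fin 4 → ZStar) → ℂ} (hc : ZeroMom c) (m : ℕ) :
    ZeroMom (iterBracket c m) := by
  induction m with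
  | zero => exact hc
  | succ m ih => exact ih.bracket

/-! ### The Hamiltonian and its normal form -/

/-- The coefficients of `G`. -/
def quarticCoef (j : Fin 4 → ZStar) : ℂ := if momentum j = 0 then 1 / (4 * Real.pi) else 0

/-- The coefficients of the nonresonant part of `-G`. -/
def nonresCoef (j : Fin 4 → ZStar) : ℂ :=
  if momentum j = 0 ∧ j 0 ≠ j 1 ∧ j 0 ≠ j 3 then -(1 / (4 * Real.pi)) else 0

theorem momentum_four (j : Fin 4 → ZStar) :
    momentum j = (j 0).1 - (j 1).1 + (j 2).1 - (j 3).1 := by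
  simp [momentum, Fin.sum_univ_four]
  ring

theorem sqrt_wt_mul_le_rootProd (j : Fin n → ZStar) {i k : Fin n} (h : k ≠ i) :
    √(wt (j i)) * √(wt (j k)) ≤ rootProd j := by
  have hk : k ∈ Finset.univ.erase i := Finset.mem_erase.2 ⟨h, Finset.mem_univ _⟩
  rw [rootProd_eq_mul_erase j i, ← Finset.mul_prod_erase _ _ hk]
  have h1 : 1 ≤ ∏ p ∈ (Finset.univ.erase i).erase k, √(wt (j p)) := by
    have := Finset.prod_le_prod (s := (Finset.univ.erase i).erase k)
      (f := fun _ => (1 : ℝ)) (g := fun p => √(wt (j p))) (fun _ _ => zero_le_one)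
      (fun p _ => one_le_sqrt_wt (j p))
    simpa using this
  gcongr
  exact le_mul_of_one_le_right (Real.sqrt_nonneg _) h1

/-- Zero momentum provides another entry of at least a quarter of the size, whence the 2 = √4. The
other factors are at least 1. -/
theorem wt_le_rootProd {j : Fin 4 → ZStar} (hj : momentum j = 0) (p : Fin 4) :
    wt (j p) ≤ 2 * rootProd j := by
  obtain ⟨k, hk, h⟩ := exists_wt_le_of_momentum hj p
  have h1 : √(wt (j p)) ≤ 2 * √(wt (j k)) := by
    have h2 : √(wt (j p)) ≤ √(2 ^ 2 * wt (j k)) :=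
      Real.sqrt_le_sqrt (h.trans (le_of_eq (by norm_num)))
    rwa [Real.sqrt_mul (by positivity), Real.sqrt_sq (by norm_num)] at h2
  have h3 := sqrt_wt_mul_le_rootProd j hk
  calc wt (j p) = √(wt (j p)) * √(wt (j p)) := (Real.mul_self_sqrt (wt_pos _).le).symm
    _ ≤ √(wt (j p)) * (2 * √(wt (j k))) := by gcongr
    _ ≤ 2 * rootProd j := by linarith

theorem quotBound_of_norm_le {c : (Fin 4 → ZStar) → ℂ} (hc : ZeroMom c)
    (h : ∀ j, ‖c j‖ ≤ 1 / (4 * Real.pi)) : QuotBound 1 c := fun j p => by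
  have hr := rootProd_pos j
  by_cases hj : momentum j = 0
  · have hpi : 1 / (4 * Real.pi) ≤ 1 / 2 := by
      apply one_div_le_one_div_of_le <;> nlinarith [Real.pi_gt_three]
    have hw := wt_le_rootProd hj p
    calc ‖c j‖ * wt (j p) ≤ 1 / 2 * (2 * rootProd j) := by
          have := wt_pos (j p)
          gcongr
          exact (h j).trans hpi
      _ = 1 * rootProd j := by ring
  · rw [hc j hj, norm_zero, zero_mul]
    linarith

theorem norm_one_div_four_pi : ‖(1 / (4 * Real.pi) : ℂ)‖ = 1 / (4 * Real.pi) := by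
  have h : (1 / (4 * Real.pi) : ℂ) = ((1 / (4 * Real.pi) : ℝ) : ℂ) := by push_cast; rfl
  rw [h, Complex.norm_real, Real.norm_of_nonneg (by positivity)]

theorem quarticCoef_zeroMom : ZeroMom quarticCoef := fun _ hj => if_neg hj

theorem nonresCoef_zeroMom : ZeroMom nonresCoef := fun _ hj => if_neg fun h => hj h.1

theorem quarticCoef_quotBound : QuotBound 1 quarticCoef :=
  quotBound_of_norm_le quarticCoef_zeroMom fun _ => by
    unfold quarticCoef
    split_ifs
    · exact norm_one_div_four_pi.le
    · rw [norm_zero]; positivity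

theorem nonresCoef_quotBound : QuotBound 1 nonresCoef :=
  quotBound_of_norm_le nonresCoef_zeroMom fun _ => by
    unfold nonresCoef
    split_ifs
    · rw [norm_neg]; exact norm_one_div_four_pi.le
    · rw [norm_zero]; positivity

theorem G_eq_poly (q : Ell2 s) : G q = poly quarticCoef q := by
  have h := tsum_subtype_eq_of_support_subset (s := zeroMomentum 2)
    (f := term quarticCoef fun _ => q) fun j hj => by
      by_contra h
      exact hj (by rw [term, quarticCoef_zeroMom j h, zero_mul])
  rw [poly, ← h, G, ← tsum_mul_left]
  refine tsum_congr fun j => ?_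
  have hj : momentum j.1 = 0 := j.2
  rw [term, quarticCoef, if_pos hj]
  rfl

theorem prod_altConj_four (x : Fin 4 → Ell2 s) (j : Fin 4 → ZStar) :
    ∏ p : Fin 4, altConj p (x p (j p))
      = x 0 (j 0) * conj (x 1 (j 1)) * x 2 (j 2) * conj (x 3 (j 3)) := by
  have : ¬ Even 3 := by decide
  simp [Fin.prod_univ_four, altConj, this]

/-- Conjugation is undone by exchanging neighbouring places, which only changes the sign of the
momentum. Hence H is real valued and taking its real part loses nothing. -/
theorem conj_G (q : Ell2 s) : conj (G q) = G q := by
  rw [G_eq_poly, poly, Complex.conj_tsum,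
    ← tsum_comp_perm (Equiv.swap 0 1 * Equiv.swap 2 3 : Equiv.Perm (Fin 4))]
  refine tsum_congr fun j => ?_
  have e0 : (Equiv.swap 0 1 * Equiv.swap 2 3 : Equiv.Perm (Fin 4)) 0 = 1 := by decide
  have e1 : (Equiv.swap 0 1 * Equiv.swap 2 3 : Equiv.Perm (Fin 4)) 1 = 0 := by decide
  have e2 : (Equiv.swap 0 1 * Equiv.swap 2 3 : Equiv.Perm (Fin 4)) 2 = 3 := by decide
  have e3 : (Equiv.swap 0 1 * Equiv.swap 2 3 : Equiv.Perm (Fin 4)) 3 = 2 := by decide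
  have h : conj (quarticCoef (j ∘ (Equiv.swap 0 1 * Equiv.swap 2 3 : Equiv.Perm (Fin 4))))
      = quarticCoef j := by
    rw [quarticCoef, quarticCoef, momentum_four, momentum_four, apply_ite conj]
    simp only [Function.comp_apply, e0, e1, e2, e3, map_div₀, map_mul, map_one,
      Complex.conj_ofReal, Complex.conj_ofNat, map_zero]
    exact if_congr (by constructor <;> intro h <;> linarith) rfl rfl
  rw [term, term, prod_altConj_four, prod_altConj_four, map_mul, h]
  simp only [Function.comp_apply, e0, e1, e2, e3, map_mul, Complex.conj_conj]
  ring

/-- The coefficients of `Λ`. -/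
def lamCoef (j : Fin 2 → ZStar) : ℂ := if j 0 = j 1 then ((j 0).1 : ℂ) else 0

theorem rootProd_two (j : Fin 2 → ZStar) : rootProd j = √(wt (j 0)) * √(wt (j 1)) :=
  Fin.prod_univ_two _

theorem norm_lamCoef_le (j : Fin 2 → ZStar) : ‖lamCoef j‖ ≤ wt (j 0) := by
  unfold lamCoef
  split_ifs
  · rw [Complex.norm_intCast]; rfl
  · rw [norm_zero]; exact (wt_pos _).le

theorem lamCoef_rootBound : RootBound 1 lamCoef := fun j => by
  rw [rootProd_two, one_mul]
  by_cases h : j 0 = j 1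
  · rw [← h, Real.mul_self_sqrt (wt_pos _).le]
    exact norm_lamCoef_le j
  · rw [lamCoef, if_neg h, norm_zero]
    positivity

theorem lam_eq_poly (q : Ell2 s) : (Lam q : ℂ) = poly lamCoef q := by
  have hinj : Function.Injective fun z : ZStar => (![z, z] : Fin 2 → ZStar) :=
    fun a b h => congrFun h 0
  have h := hinj.tsum_eq (f := term lamCoef fun _ => q) fun j hj => by
    have h0 : j 0 = j 1 := by
      by_contra h
      exact hj (by rw [term, lamCoef, if_neg h, zero_mul])
    refine ⟨j 0, funext fun p => ?_⟩
    fin_cases p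
    · rfl
    · exact h0
  rw [poly, ← h, Lam, Complex.ofReal_tsum]
  refine tsum_congr fun z => ?_
  rw [term, Fin.prod_univ_two]
  simp [lamCoef, altConj, Complex.mul_conj, Complex.normSq_eq_norm_sq]

/-- Λ itself violates `QuotBound`, its coefficient j being paired with a root product of only |j|.
The kernel rescues the contraction: its weight at J absorbs the coefficient J, and the other entry
of the diagonal pair equals J and takes over √|J|. -/
theorem lamCoef_contractBound (i : Fin 2) : ContractBound 1 i lamCoef := by
  rintro ⟨k, l, j⟩ J
  rw [rootProd_insTwo, rootProd_two, contractTerm, norm_mul, Complex.norm_real, Real.norm_eq_abs]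
  dsimp only
  have h := abs_kern_mul_wt_le J k l (j i) J (Or.inl rfl)
  have hpos : 0 ≤ 1 * (√(wt k) * (√(wt l) * (√(wt (j 0)) * √(wt (j 1))))) := by positivity
  by_cases hJ : Function.update j i J 0 = Function.update j i J 1
  · have h1 : ‖lamCoef (Function.update j i J)‖ ≤ wt J := by
      refine (norm_lamCoef_le _).trans (le_of_eq ?_)
      fin_cases i
      · simp
      · rw [hJ]; simp
    refine (mul_le_mul_of_nonneg_right h1 (abs_nonneg _)).trans ?_
    rw [mul_comm]
    refine h.trans (le_of_eq ?_)
    fin_cases i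
    · have : J = j 1 := by simpa using hJ
      subst this
      simp; ring
    · have : J = j 0 := by simpa using hJ.symm
      subst this
      simp; ring
  · rw [lamCoef, if_neg hJ, norm_zero, zero_mul]
    exact hpos

/-! ### The homological equation and the resonant part -/

theorem bracket_lamCoef (j : Fin 4 → ZStar) :
    bracket lamCoef j = ((j 3).1 : ℂ) * kern (j 3) (j 0) (j 1) (j 2)
      + ((j 0).1 : ℂ) * kern (j 0) (j 1) (j 2) (j 3) := by
  have h0 : j = insTwo (0 : Fin 2) (j 0, j 1, ![j 2, j 3]) := by
    funext p; fin_cases p <;> rfl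
  have h1 : j = insTwo (1 : Fin 2) (j 1, j 2, ![j 0, j 3]) := by
    funext p; fin_cases p <;> rfl
  have hc0 : contract (0 : Fin 2) lamCoef j
      = ((j 3).1 : ℂ) * kern (j 3) (j 0) (j 1) (j 2) := by
    conv_lhs => rw [h0, contract_insTwo]
    rw [tsum_eq_single (j 3)]
    · simp [contractTerm, lamCoef]
    · intro J hJ
      simp [contractTerm, lamCoef, hJ]
  have hc1 : contract (1 : Fin 2) lamCoef j
      = ((j 0).1 : ℂ) * kern (j 0) (j 1) (j 2) (j 3) := by
    conv_lhs => rw [h1, contract_insTwo]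
    rw [tsum_eq_single (j 0)]
    · simp [contractTerm, lamCoef]
    · intro J hJ
      simp [contractTerm, lamCoef, hJ.symm]
  rw [bracket, Fin.sum_univ_two, hc0, hc1]

/-- The homological equation. It holds for coefficients only after symmetrization under rotation by
two places. In the nonresonant case the four denominators agree up to sign, the numerators combine
to j₀² − j₁² + j₂² − j₃² = 2(j₀ − j₁)(j₀ − j₃), and the divisor cancels. In the resonant cases all
four kernels vanish. -/
theorem bracket_lamCoef_add_perm (j : Fin 4 → ZStar) :
    bracket lamCoef j + bracket lamCoef ![j 2, j 3, j 0, j 1] = 2 * nonresCoef j := by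
  rw [bracket_lamCoef, bracket_lamCoef]
  simp only [Matrix.cons_val_zero, Matrix.cons_val_one, Matrix.cons_val, nonresCoef,
    momentum_four]
  by_cases hj : (j 0).1 - (j 1).1 + (j 2).1 - (j 3).1 = 0
  swap
  · rw [if_neg fun h => hj h.1, kern_of_ne fun h => hj (by linarith),
      kern_of_ne fun h => hj (by linarith), kern_of_ne fun h => hj (by linarith),
      kern_of_ne fun h => hj (by linarith)]
    simp
  rw [kern, kern, kern, kern, if_pos (by linarith), if_pos (by linarith), if_pos (by linarith),
    if_pos (by linarith)]
  by_cases h01 : j 0 = j 1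
  · have h23 : j 2 = j 3 := Subtype.ext (by rw [h01] at hj; linarith)
    simp [h01, h23]
  by_cases h03 : j 0 = j 3
  · have h12 : j 1 = j 2 := Subtype.ext (by rw [h03] at hj; linarith)
    simp [h03, h12]
  rw [if_pos ⟨hj, h01, h03⟩]
  have h2 : ((j 2).1 : ℂ) = (j 1).1 + (j 3).1 - (j 0).1 := by
    have : (j 2).1 = (j 1).1 + (j 3).1 - (j 0).1 := by linarith
    exact_mod_cast this
  have ha : ((j 0).1 : ℂ) - (j 1).1 ≠ 0 := sub_ne_zero.2 fun h =>
    h01 (Subtype.ext (by exact_mod_cast h))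
  have hd : ((j 0).1 : ℂ) - (j 3).1 ≠ 0 := sub_ne_zero.2 fun h =>
    h03 (Subtype.ext (by exact_mod_cast h))
  push_cast
  rw [h2]
  generalize ((j 0).1 : ℂ) = a at *
  generalize ((j 1).1 : ℂ) = b at *
  generalize ((j 3).1 : ℂ) = d at *
  have e1 : (d - a) * (d - (b + d - a)) = -((a - d) * (a - b)) := by ring
  have e2 : (a - b) * (a - d) = (a - d) * (a - b) := by ring
  have e3 : (b - (b + d - a)) * (b - a) = -((a - d) * (a - b)) := by ring
  have e4 : (b + d - a - d) * (b + d - a - b) = (a - d) * (a - b) := by ring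
  rw [e1, e2, e3, e4]
  have hpi : (Real.pi : ℂ) ≠ 0 := Complex.ofReal_ne_zero.2 Real.pi_ne_zero
  field_simp
  ring

/-- Rotation by two places keeps parities and leaves the monomial unchanged, so only the symmetrized
coefficients matter. -/
theorem poly_eq_of_add_perm {c c' : (Fin 4 → ZStar) → ℂ} {q : Ell2 s}
    (hsum : Summable (term c fun _ => q))
    (h : ∀ j : Fin 4 → ZStar, c j + c ![j 2, j 3, j 0, j 1] = 2 * c' j) :
    poly c q = poly c' q := by
  let σ : Equiv.Perm (Fin 4) := Equiv.swap 0 2 * Equiv.swap 1 3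
  have hp : ∑' j, term c (fun _ => q) (j ∘ σ) = ∑' j, term c (fun _ => q) j :=
    tsum_comp_perm σ (term c fun _ => q)
  have hsum' : Summable fun j : Fin 4 → ZStar => term c (fun _ => q) (j ∘ σ) :=
    (Equiv.arrowCongr σ.symm (Equiv.refl ZStar)).summable_iff.2 hsum
  have h2 : 2 * poly c q = 2 * poly c' q := by
    rw [two_mul]
    nth_rewrite 2 [poly]
    rw [← hp, poly, poly, ← hsum.tsum_add hsum', ← tsum_mul_left]
    refine tsum_congr fun j => ?_
    have e : j ∘ σ = ![j 2, j 3, j 0, j 1] := by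
      funext p; fin_cases p <;> rfl
    rw [e, term, term, term, ← mul_assoc, ← h, prod_altConj_four, prod_altConj_four]
    simp only [Matrix.cons_val_zero, Matrix.cons_val_one, Matrix.cons_val]
    ring
  exact mul_left_cancel₀ two_ne_zero h2

theorem poly_bracket_lamCoef (hs : 1 < s) (q : Ell2 s) :
    poly (bracket lamCoef) q = poly nonresCoef q := by
  have h : ∀ i, Summable (term (contract i lamCoef) fun _ => q) := fun i =>
    (((lamCoef_contractBound i).rootBound zero_le_one).summable_norm_term hs zero_le_one
      (fun _ => q)).of_norm
  refine poly_eq_of_add_perm ?_ bracket_lamCoef_add_perm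
  refine (summable_sum fun i (_ : i ∈ Finset.univ) => h i).congr fun j => ?_
  simp only [term, bracket, Finset.sum_mul]

theorem tsum_diag_four {α : Type*} (e : α → Fin 4 → ZStar) (he : Function.Injective e)
    {c : (Fin 4 → ZStar) → ℂ} (hc : ∀ j, c j ≠ 0 → j ∈ Set.range e) (q : Ell2 s) :
    poly c q = ∑' a, c (e a) * (q (e a 0) * conj (q (e a 1)) * q (e a 2) * conj (q (e a 3))) := by
  rw [poly, ← he.tsum_eq fun j hj => hc j fun h => hj (by rw [term, h, zero_mul])]
  refine tsum_congr fun a => ?_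
  rw [term, prod_altConj_four]

theorem rootBound_of_norm_le_one {c : (Fin 4 → ZStar) → ℂ} (h : ∀ j, ‖c j‖ ≤ 1) :
    RootBound 1 c := fun j => by
  have h1 : 1 ≤ rootProd j := by
    have := sqrt_wt_mul_le_rootProd j (i := 0) (k := 1) (by decide)
    exact (one_le_mul_of_one_le_of_one_le (one_le_sqrt_wt _) (one_le_sqrt_wt _)).trans this
  linarith [h j]

theorem summable_norm_sq (hs : 0 ≤ s) (q : Ell2 s) : Summable fun j => ‖q j‖ ^ 2 :=
  (summable_norm_mul_norm hs q q).1.congr fun _ => (sq _).symm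

/-- What remains of G are the tuples pairing each index with a conjugated one. There are two
pairings, each contributing (∑ |q_j|²)², and they overlap in the constant tuples, which contribute ∑
|q_j|⁴. -/
theorem B_eq_poly (hs : 1 < s) (q : Ell2 s) :
    (B q : ℂ) = poly quarticCoef q + poly nonresCoef q := by
  let c₁ : (Fin 4 → ZStar) → ℂ := fun j => if j 0 = j 1 ∧ j 2 = j 3 then 1 else 0
  let c₂ : (Fin 4 → ZStar) → ℂ := fun j => if j 0 = j 3 ∧ j 1 = j 2 then 1 else 0
  let c₃ : (Fin 4 → ZStar) → ℂ := fun j => if j 0 = j 1 ∧ j 1 = j 2 ∧ j 2 = j 3 then 1 else 0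
  have hb : ∀ P : Prop, ∀ _ : Decidable P, ‖(if P then 1 else 0 : ℂ)‖ ≤ 1 := fun P _ => by
    split_ifs <;> simp
  have hs₁ : Summable (term c₁ fun _ => q) := ((rootBound_of_norm_le_one fun _ =>
    hb _ _).summable_norm_term hs zero_le_one _).of_norm
  have hs₂ : Summable (term c₂ fun _ => q) := ((rootBound_of_norm_le_one fun _ =>
    hb _ _).summable_norm_term hs zero_le_one _).of_norm
  have hs₃ : Summable (term c₃ fun _ => q) := ((rootBound_of_norm_le_one fun _ =>
    hb _ _).summable_norm_term hs zero_le_one _).of_norm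
  have hsq : Summable fun z => ((‖q z‖ ^ 2 : ℝ) : ℂ) :=
    Complex.ofRealCLM.summable (summable_norm_sq (by linarith) q)
  have hsqn : Summable fun z => ‖((‖q z‖ ^ 2 : ℝ) : ℂ)‖ := hsq.norm
  have hmc : ∀ z, q z * conj (q z) = ((‖q z‖ ^ 2 : ℝ) : ℂ) := fun z => by
    rw [Complex.mul_conj, Complex.normSq_eq_norm_sq]
  have hprod : ∑' a : ZStar × ZStar, ((‖q a.1‖ ^ 2 : ℝ) : ℂ) * ((‖q a.2‖ ^ 2 : ℝ) : ℂ)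
      = ((∑' z, ‖q z‖ ^ 2 : ℝ) : ℂ) ^ 2 := by
    rw [← tsum_mul_tsum_of_summable_norm hsqn hsqn, Complex.ofReal_tsum, sq]
  have h₁ : poly c₁ q = ((∑' z, ‖q z‖ ^ 2 : ℝ) : ℂ) ^ 2 := by
    rw [tsum_diag_four (fun a : ZStar × ZStar => ![a.1, a.1, a.2, a.2])
      (fun a b h => Prod.ext (congrFun h 0) (congrFun h 2)) (fun j hj => ?_), ← hprod]
    · refine tsum_congr fun a => ?_
      simp only [Matrix.cons_val_zero, Matrix.cons_val_one, Matrix.cons_val, c₁, and_self,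
        if_true, ← hmc]
      ring
    · have h : j 0 = j 1 ∧ j 2 = j 3 := by
        by_contra h
        exact hj (if_neg h)
      exact ⟨(j 0, j 2), by funext p; fin_cases p <;> simp [h.1, h.2]⟩
  have h₂ : poly c₂ q = ((∑' z, ‖q z‖ ^ 2 : ℝ) : ℂ) ^ 2 := by
    rw [tsum_diag_four (fun a : ZStar × ZStar => ![a.1, a.2, a.2, a.1])
      (fun a b h => Prod.ext (congrFun h 0) (congrFun h 1)) (fun j hj => ?_), ← hprod]
    · refine tsum_congr fun a => ?_
      simp only [Matrix.cons_val_zero, Matrix.cons_val_one, Matrix.cons_val, c₂, and_self,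
        if_true, ← hmc]
      ring
    · have h : j 0 = j 3 ∧ j 1 = j 2 := by
        by_contra h
        exact hj (if_neg h)
      exact ⟨(j 0, j 1), by funext p; fin_cases p <;> simp [h.1, h.2]⟩
  have h₃ : poly c₃ q = ((∑' z, ‖q z‖ ^ 4 : ℝ) : ℂ) := by
    rw [tsum_diag_four (fun a : ZStar => ![a, a, a, a])
      (fun a b h => congrFun h 0) (fun j hj => ?_), Complex.ofReal_tsum]
    · refine tsum_congr fun a => ?_
      simp only [Matrix.cons_val_zero, Matrix.cons_val_one, Matrix.cons_val, c₃, and_self,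
        if_true]
      rw [one_mul, mul_assoc, hmc]
      push_cast
      ring
    · have h : j 0 = j 1 ∧ j 1 = j 2 ∧ j 2 = j 3 := by
        by_contra h
        exact hj (if_neg h)
      exact ⟨j 0, by funext p; fin_cases p <;> simp [h.1, h.2.1, h.2.2]⟩
  -- Inclusion and exclusion over the two pairings; at zero momentum one equality of indices forces
  -- the other.
  have hcoef : ∀ j, quarticCoef j + nonresCoef j
      = 1 / (4 * Real.pi) * (c₁ j + c₂ j - c₃ j) := fun j => by
    simp only [quarticCoef, nonresCoef, c₁, c₂, c₃, momentum_four]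
    by_cases hj : (j 0).1 - (j 1).1 + (j 2).1 - (j 3).1 = 0
    · by_cases h01 : j 0 = j 1
      · have h23 : j 2 = j 3 := Subtype.ext (by rw [h01] at hj; linarith)
        by_cases h12 : j 1 = j 2 <;> simp [h01, h23, h12]
      · by_cases h03 : j 0 = j 3
        · have h12 : j 1 = j 2 := Subtype.ext (by rw [h03] at hj; linarith)
          have h31 : ¬ j 3 = j 1 := fun h => h01 (h03.trans h)
          have h32 : ¬ j 3 = j 2 := fun h => h31 (h.trans h12.symm)
          simp [h03, h12, h32]
        · simp [hj, h01, h03]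
    · have h1 : ¬ (j 0 = j 1 ∧ j 2 = j 3) := fun h => hj (by rw [h.1, h.2]; ring)
      have h2 : ¬ (j 0 = j 3 ∧ j 1 = j 2) := fun h => hj (by rw [h.1, h.2]; ring)
      have h3 : ¬ (j 0 = j 1 ∧ j 1 = j 2 ∧ j 2 = j 3) := fun h => h1 ⟨h.1, h.2.2⟩
      rw [if_neg h1, if_neg h2, if_neg h3, if_neg hj, if_neg fun h => hj h.1]
      ring
  have hsumq := (quarticCoef_quotBound.rootBound.summable_norm_term hs zero_le_one
    (fun _ => q)).of_norm
  have hsumn := (nonresCoef_quotBound.rootBound.summable_norm_term hs zero_le_one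
    (fun _ => q)).of_norm
  have hsplit : poly quarticCoef q + poly nonresCoef q
      = 1 / (4 * Real.pi) * (poly c₁ q + poly c₂ q - poly c₃ q) := by
    simp only [poly]
    rw [← hsumq.tsum_add hsumn, ← hs₁.tsum_add hs₂, ← (hs₁.add hs₂).tsum_sub hs₃,
      ← tsum_mul_left]
    refine tsum_congr fun j => ?_
    simp only [term]
    rw [← add_mul, hcoef]
    ring
  rw [hsplit, h₁, h₂, h₃, B]
  push_cast
  ring

end Polynomials

/-! ### The Taylor series along the flow -/

section Taylor

theorem norm_sub_taylor_le {f : ℕ → ℝ → ℂ}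
    (hf : ∀ m, ∀ t ∈ Set.Icc (0 : ℝ) 1,
      HasDerivWithinAt (f m) (f (m + 1) t) (Set.Icc 0 1) t)
    (N : ℕ) {K : ℝ} (hK : ∀ t ∈ Set.Icc (0 : ℝ) 1, ‖f (N + 1) t‖ ≤ K) :
    ‖f 0 1 - ∑ m ∈ Finset.range (N + 1), f m 0 / m.factorial‖ ≤ K / N.factorial := by
  -- The Taylor polynomial of order N based at t, evaluated at time 1. Its derivative in t
  -- telescopes to (1 − t)^N/N! f_{N+1}(t); it runs from the Taylor sum at t = 0 to f₀(1) at t = 1.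
  let g : ℕ → ℝ → ℂ := fun N t => ∑ m ∈ Finset.range (N + 1),
    ((1 - t : ℝ) : ℂ) ^ m / m.factorial * f m t
  have hpow : ∀ (m : ℕ) (t : ℝ), HasDerivAt (fun t : ℝ => ((1 - t : ℝ) : ℂ) ^ (m + 1) /
      (m + 1).factorial) (-(((1 - t : ℝ) : ℂ) ^ m / m.factorial)) t := fun m t => by
    have h1 : HasDerivAt (fun t : ℝ => ((1 - t : ℝ) : ℂ)) (-1 : ℂ) t := by
      have := ((hasDerivAt_id t).const_sub 1).ofReal_comp
      simpa using this
    have h2 := (h1.fun_pow (m + 1)).div_const ((m + 1).factorial : ℂ)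
    refine h2.congr_deriv ?_
    have h3 : (m.factorial : ℂ) ≠ 0 := Nat.cast_ne_zero.2 m.factorial_ne_zero
    have h4 : ((m : ℂ) + 1) ≠ 0 := by exact_mod_cast m.succ_ne_zero
    rw [Nat.factorial_succ, Nat.add_sub_cancel]
    push_cast
    field_simp
  have hg : ∀ N, ∀ t ∈ Set.Icc (0 : ℝ) 1, HasDerivWithinAt (g N)
      (((1 - t : ℝ) : ℂ) ^ N / N.factorial * f (N + 1) t) (Set.Icc 0 1) t := by
    intro N t ht
    induction N with
    | zero =>
      have := hf 0 t ht
      simpa [g] using this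
    | succ N ih =>
      have h1 := (hpow N t).hasDerivWithinAt.mul (hf (N + 1) t ht)
      have h2 : g (N + 1) = fun t => g N t
          + ((1 - t : ℝ) : ℂ) ^ (N + 1) / (N + 1).factorial * f (N + 1) t := by
        funext t
        simp only [g]
        rw [Finset.sum_range_succ]
      rw [h2]
      refine (ih.add h1).congr_deriv ?_
      ring
  have hb : ∀ t ∈ Set.Ico (0 : ℝ) 1,
      ‖((1 - t : ℝ) : ℂ) ^ N / N.factorial * f (N + 1) t‖ ≤ K / N.factorial := fun t ht => by
    rw [norm_mul, norm_div, norm_pow, Complex.norm_real, Complex.norm_natCast,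
      Real.norm_of_nonneg (by linarith [ht.2]), div_mul_eq_mul_div]
    have h1 : (1 - t) ^ N ≤ 1 := pow_le_one₀ (by linarith [ht.2]) (by linarith [ht.1])
    have h2 := hK t (Set.Ico_subset_Icc_self ht)
    gcongr
    exact (mul_le_of_le_one_left (norm_nonneg _) h1).trans h2
  have h := norm_image_sub_le_of_norm_deriv_le_segment_01' (hg N) hb
  have h1 : g N 1 = f 0 1 := by
    simp only [g]
    rw [Finset.sum_eq_single 0]
    · simp
    · intro m _ hm
      simp [hm]
    · simp
  have h0 : g N 0 = ∑ m ∈ Finset.range (N + 1), f m 0 / m.factorial := by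
    simp only [g]
    refine Finset.sum_congr rfl fun m _ => ?_
    simp
    ring
  rwa [h1, h0] at h

/-- The common shape of the majorants below: a power of the degree 2(m + 3) times a geometric
factor. -/
theorem summable_two_mul_pow (k : ℕ) :
    Summable fun m : ℕ => ((2 * (m + 3) : ℕ) : ℝ) ^ k * (1 / 4) ^ m := by
  have h := summable_pow_mul_geometric_of_norm_lt_one (R := ℝ) k (r := 1 / 4) (by norm_num)
  have h1 := ((summable_nat_add_iff 3).2 h).mul_left (2 ^ k * 4 ^ 3)
  refine h1.congr fun m => ?_
  push_cast
  rw [mul_pow, pow_add]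
  norm_num
  ring

/-- The factor (m + 1)! exceeds m! only by m + 1, and the Taylor remainder is of size N² 4^{-N}. -/
theorem hasSum_taylor {f : ℕ → ℝ → ℂ}
    (hf : ∀ m, ∀ t ∈ Set.Icc (0 : ℝ) 1,
      HasDerivWithinAt (f m) (f (m + 1) t) (Set.Icc 0 1) t)
    {A : ℝ} (hA : ∀ m, ∀ t ∈ Set.Icc (0 : ℝ) 1,
      ‖f m t‖ ≤ A * (1 / 4) ^ m * (m + 1).factorial) :
    HasSum (fun m => f m 0 / m.factorial) (f 0 1) := by
  have h0 : (0 : ℝ) ∈ Set.Icc (0 : ℝ) 1 := by simp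
  have hA0 : 0 ≤ A := by
    have := (norm_nonneg _).trans (hA 0 0 h0)
    simpa using this
  have hsum : Summable fun m => ‖f m 0 / m.factorial‖ := by
    refine ((summable_two_mul_pow 1).mul_left A).of_nonneg_of_le (fun _ => norm_nonneg _)
      fun m => ?_
    rw [norm_div, Complex.norm_natCast, div_le_iff₀ (by positivity)]
    refine (hA m 0 h0).trans ?_
    rw [Nat.factorial_succ]
    push_cast
    have h1 : (m : ℝ) + 1 ≤ 2 * (m + 3) := by linarith [m.cast_nonneg (α := ℝ)]
    calc A * (1 / 4) ^ m * ((m + 1) * m.factorial)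
        = A * (((m : ℝ) + 1) * (1 / 4) ^ m) * m.factorial := by ring
      _ ≤ A * ((2 * (m + 3)) * (1 / 4) ^ m) * m.factorial := by gcongr
      _ = _ := by ring
  rw [hsum.of_norm.hasSum_iff_tendsto_nat, ← Filter.tendsto_add_atTop_iff_nat 1,
    tendsto_iff_norm_sub_tendsto_zero]
  have hlim : Filter.Tendsto (fun N : ℕ => A * (((2 * (N + 3) : ℕ) : ℝ) ^ 2 * (1 / 4) ^ N))
      Filter.atTop (𝓝 0) := by
    simpa using (summable_two_mul_pow 2).tendsto_atTop_zero.const_mul A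
  refine squeeze_zero (fun _ => norm_nonneg _) (fun N => ?_) hlim
  rw [norm_sub_rev]
  refine (norm_sub_taylor_le hf N (hA (N + 1))).trans ?_
  rw [div_le_iff₀ (by positivity), Nat.factorial_succ, Nat.factorial_succ, pow_succ]
  push_cast
  have h1 : ((N : ℝ) + 2) * (N + 1) * (1 / 4) ≤ (2 * (N + 3)) ^ 2 := by
    nlinarith [N.cast_nonneg (α := ℝ)]
  calc A * ((1 / 4) ^ N * (1 / 4)) * (((N : ℝ) + 1 + 1) * ((N + 1) * N.factorial))
      = A * (1 / 4) ^ N * ((((N : ℝ) + 2) * (N + 1) * (1 / 4)) * N.factorial) := by ring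
    _ ≤ A * (1 / 4) ^ N * ((2 * (N + 3)) ^ 2 * N.factorial) := by gcongr
    _ = _ := by ring

variable {s : ℝ}

/-- A radius for which all the series converge. -/
def goodRadius (s : ℝ) : ℝ := 1 / (4 * (Ell2.embConst s + 1))

theorem goodRadius_pos (s : ℝ) : 0 < goodRadius s := by
  have := Ell2.embConst_nonneg s
  unfold goodRadius
  positivity

theorem embConst_mul_le {x : ℝ} (hx : x ≤ goodRadius s) : Ell2.embConst s * x ≤ 1 / 4 := by
  have h := Ell2.embConst_nonneg s
  calc Ell2.embConst s * x ≤ Ell2.embConst s * goodRadius s := by gcongr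
    _ = 1 / 4 * (Ell2.embConst s / (Ell2.embConst s + 1)) := by
      unfold goodRadius
      field_simp
    _ ≤ 1 / 4 * 1 := by
      gcongr
      rw [div_le_one (by positivity)]
      linarith
    _ = 1 / 4 := mul_one _

theorem norm_poly_iterBracket_le (hs : 1 < s) {c : (Fin 4 → ZStar) → ℂ} (hc : QuotBound 1 c)
    (m : ℕ) {q : Ell2 s} (hq : ‖q‖ ≤ goodRadius s) :
    ‖poly (iterBracket c m) q‖ ≤ (1 / 4) ^ m * (m + 1).factorial := by
  have h := norm_poly_le hs (by positivity) (iterBracket_quotBound zero_le_one hc m).rootBound q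
  refine h.trans ?_
  have h0 : 0 ≤ Ell2.embConst s * ‖q‖ := mul_nonneg (Ell2.embConst_nonneg s) (norm_nonneg q)
  have h1 : (Ell2.embConst s * ‖q‖) ^ (2 * (m + 2)) ≤ (1 / 8) ^ m := by
    calc (Ell2.embConst s * ‖q‖) ^ (2 * (m + 2)) ≤ (1 / 4) ^ (2 * (m + 2)) :=
          pow_le_pow_left₀ h0 (embConst_mul_le hq) _
      _ = (1 / 16) ^ m * (1 / 256) := by rw [pow_mul, pow_add]; norm_num
      _ ≤ (1 / 8) ^ m * 1 := by
        gcongr <;> norm_num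
      _ = _ := mul_one _
  calc 1 * 2 ^ m * ((m + 1).factorial : ℝ) * (Ell2.embConst s * ‖q‖) ^ (2 * (m + 2))
      ≤ 1 * 2 ^ m * ((m + 1).factorial : ℝ) * (1 / 8) ^ m := by gcongr
    _ = (2 * (1 / 8)) ^ m * (m + 1).factorial := by rw [mul_pow]; ring
    _ = _ := by norm_num

/-! ### Expansion of G and Λ along the flow -/

theorem hasSum_poly_flow (hs : 1 < s) {γ : ℝ → Ell2 s}
    (hγ : ∀ t ∈ Set.Icc (0 : ℝ) 1,
      HasDerivWithinAt γ (field hs fun _ => γ t) (Set.Icc 0 1) t)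
    (hn : ∀ t, ‖γ t‖ ≤ goodRadius s) {c : (Fin 4 → ZStar) → ℂ} (hc : QuotBound 1 c) :
    HasSum (fun m => poly (iterBracket c m) (γ 0) / m.factorial) (poly c (γ 1)) := by
  refine hasSum_taylor (f := fun m t => poly (iterBracket c m) (γ t)) (A := 1) ?_ ?_
  · intro m t ht
    have h := iterBracket_quotBound zero_le_one hc m
    exact hasDerivWithinAt_poly hs (by positivity) (by positivity) h.rootBound
      (fun i => h.contractBound (by positivity) i) (hγ t ht)
  · intro m t _
    rw [one_mul]
    exact norm_poly_iterBracket_le hs hc m (hn t)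

/-- By the homological equation the first derivative of Λ is already the quartic nonresonant
polynomial. Its iterated brackets are the later derivatives, one order ahead, hence the factorial (m
+ 1)!. -/
theorem hasSum_lam_flow (hs : 1 < s) {γ : ℝ → Ell2 s}
    (hγ : ∀ t ∈ Set.Icc (0 : ℝ) 1,
      HasDerivWithinAt γ (field hs fun _ => γ t) (Set.Icc 0 1) t)
    (hn : ∀ t, ‖γ t‖ ≤ goodRadius s) :
    HasSum (fun m => poly (iterBracket nonresCoef m) (γ 0) / (m + 1).factorial)
      (poly lamCoef (γ 1) - poly lamCoef (γ 0)) := by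
  let f : ℕ → ℝ → ℂ := fun m t => match m with
    | 0 => poly lamCoef (γ t)
    | m + 1 => poly (iterBracket nonresCoef m) (γ t)
  have h : HasSum (fun m => f m 0 / m.factorial) (f 0 1) := by
    -- The 4 pays for the shift of the index in (1/4)^m.
    refine hasSum_taylor (A := 4) ?_ ?_
    · rintro (_ | m) t ht
      · have := hasDerivWithinAt_poly hs zero_le_one zero_le_one lamCoef_rootBound
          lamCoef_contractBound (hγ t ht)
        rw [poly_bracket_lamCoef hs] at this
        exact this
      · have h := iterBracket_quotBound zero_le_one nonresCoef_quotBound m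
        exact hasDerivWithinAt_poly hs (by positivity) (by positivity) h.rootBound
          (fun i => h.contractBound (by positivity) i) (hγ t ht)
    · rintro (_ | m) t _
      · refine (norm_poly_le hs zero_le_one lamCoef_rootBound (γ t)).trans ?_
        have h0 : 0 ≤ Ell2.embConst s * ‖γ t‖ :=
          mul_nonneg (Ell2.embConst_nonneg s) (norm_nonneg _)
        have h1 := pow_le_pow_left₀ h0 (embConst_mul_le (hn t)) 2
        norm_num at h1 ⊢
        linarith
      · refine (norm_poly_iterBracket_le hs nonresCoef_quotBound m (hn t)).trans ?_
        have h1 : ((m + 1).factorial : ℝ) ≤ ((m + 1 + 1).factorial : ℝ) := by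
          exact_mod_cast Nat.factorial_le (Nat.le_succ _)
        calc (1 / 4) ^ m * ((m + 1).factorial : ℝ)
            ≤ (1 / 4) ^ m * ((m + 1 + 1).factorial : ℝ) := by gcongr
          _ = _ := by rw [pow_succ]; ring
  have h1 := (hasSum_nat_add_iff' 1).2 h
  simpa [f] using h1

/-! ### The remainder -/

/-- The coefficients of the remainder of degree `2 (m + 3)`. -/
def remTerm (m : ℕ) (j : Fin (2 * (m + 3)) → ZStar) : ℂ :=
  iterBracket quarticCoef (m + 1) j / (m + 1).factorial
    + iterBracket nonresCoef (m + 1) j / (m + 2).factorial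

/-- Dividing 2^{m+1} (m + 2)! by (m + 1)! and by (m + 2)! leaves 2^{m+1} times (m + 2) + 1. -/
theorem remTerm_quotBound (m : ℕ) :
    QuotBound (2 ^ (m + 1) * (m + 3)) (remTerm m) := fun j p => by
  have h1 := iterBracket_quotBound zero_le_one quarticCoef_quotBound (m + 1) j p
  have h2 := iterBracket_quotBound zero_le_one nonresCoef_quotBound (m + 1) j p
  have h3 : ((m + 1 + 1).factorial : ℝ) = (m + 2) * (m + 1).factorial := by
    rw [Nat.factorial_succ]
    push_cast
    ring
  have hf1 : (0 : ℝ) < (m + 1).factorial := by positivity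
  have hf2 : (0 : ℝ) < (m + 2).factorial := by positivity
  calc ‖remTerm m j‖ * wt (j p)
      ≤ (‖iterBracket quarticCoef (m + 1) j‖ / (m + 1).factorial
        + ‖iterBracket nonresCoef (m + 1) j‖ / (m + 2).factorial) * wt (j p) := by
        refine mul_le_mul_of_nonneg_right ((norm_add_le _ _).trans (le_of_eq ?_)) (wt_pos _).le
        rw [norm_div, norm_div, Complex.norm_natCast, Complex.norm_natCast]
    _ = ‖iterBracket quarticCoef (m + 1) j‖ * wt (j p) / (m + 1).factorial
        + ‖iterBracket nonresCoef (m + 1) j‖ * wt (j p) / (m + 2).factorial := by ring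
    _ ≤ 1 * 2 ^ (m + 1) * (m + 1 + 1).factorial * rootProd j / (m + 1).factorial
        + 1 * 2 ^ (m + 1) * (m + 1 + 1).factorial * rootProd j / (m + 2).factorial := by
        gcongr
    _ = 1 * 2 ^ (m + 1) * ((m + 2) * (m + 1).factorial) * rootProd j / (m + 1).factorial
        + 1 * 2 ^ (m + 1) * (m + 2).factorial * rootProd j / (m + 2).factorial := by
        rw [← h3]
    _ = 2 ^ (m + 1) * (m + 3) * rootProd j := by
        field_simp
        ring

theorem remTerm_zeroMom (m : ℕ) : ZeroMom (remTerm m) := fun j hj => by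
  rw [remTerm, iterBracket_zeroMom quarticCoef_zeroMom _ j hj,
    iterBracket_zeroMom nonresCoef_zeroMom _ j hj]
  simp

theorem poly_div_add_div {n : ℕ} {c c' : (Fin n → ZStar) → ℂ} {q : Ell2 s}
    (hc : Summable (term c fun _ => q)) (hc' : Summable (term c' fun _ => q)) (a b : ℂ) :
    poly (fun j => c j / a + c' j / b) q = poly c q / a + poly c' q / b := by
  simp only [poly]
  rw [← tsum_div_const, ← tsum_div_const, ← (hc.div_const _).tsum_add (hc'.div_const _)]
  refine tsum_congr fun j => ?_
  simp only [term]
  ring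

theorem poly_remTerm (hs : 1 < s) (m : ℕ) (q : Ell2 s) :
    poly (remTerm m) q = poly (iterBracket quarticCoef (m + 1)) q / (m + 1).factorial
      + poly (iterBracket nonresCoef (m + 1)) q / (m + 2).factorial :=
  poly_div_add_div
    ((iterBracket_quotBound zero_le_one quarticCoef_quotBound
      (m + 1)).rootBound.summable_norm_term hs (by positivity) (fun _ => q)).of_norm
    ((iterBracket_quotBound zero_le_one nonresCoef_quotBound
      (m + 1)).rootBound.summable_norm_term hs (by positivity) (fun _ => q)).of_norm _ _

theorem hasSum_remTerm_flow (hs : 1 < s) {γ : ℝ → Ell2 s}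
    (hγ : ∀ t ∈ Set.Icc (0 : ℝ) 1,
      HasDerivWithinAt γ (field hs fun _ => γ t) (Set.Icc 0 1) t)
    (hn : ∀ t, ‖γ t‖ ≤ goodRadius s) :
    HasSum (fun m => poly (remTerm m) (γ 0)) (H (γ 1) - Lam (γ 0) - B (γ 0)) := by
  have h1 := (hasSum_nat_add_iff' 1).2 (hasSum_poly_flow hs hγ hn quarticCoef_quotBound)
  have h2 := (hasSum_nat_add_iff' 1).2 (hasSum_lam_flow hs hγ hn)
  have h3 := h1.add h2
  simp only [← poly_remTerm hs] at h3
  -- The terms of index 0 in the two series are G and its nonresonant part with the opposite sign.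
  -- Together they are B.
  have h4 : H (γ 1) - Lam (γ 0) - B (γ 0) = poly quarticCoef (γ 1) - poly quarticCoef (γ 0)
      + (poly lamCoef (γ 1) - poly lamCoef (γ 0) - poly nonresCoef (γ 0)) := by
    rw [H, G_eq_poly, lam_eq_poly, lam_eq_poly, B_eq_poly hs]
    ring
  rw [h4]
  simpa [iterBracket] using h3

end Taylor

section Remainder

variable {n : ℕ} {s : ℝ}

/-! ### The decreasing rearrangement -/

theorem sqrt_prod_wt {m : ℕ} (j : Fin m → ZStar) : √(∏ p, wt (j p)) = rootProd j := by
  rw [Real.sqrt_eq_iff_mul_self_eq (Finset.prod_nonneg fun _ _ => (wt_pos _).le)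
    (rootProd_pos j).le, rootProd, ← Finset.prod_mul_distrib]
  exact Finset.prod_congr rfl fun p _ => (Real.mul_self_sqrt (wt_pos _).le).symm

/-- At the place of the largest entry `QuotBound` is exactly the bound by the root of `decrQuot`. -/
theorem exists_decrQuot_mul_wt (j : Fin (n + 1) → ZStar) :
    ∃ p, decrQuot j ^ (1 / 2 : ℝ) * wt (j p) = rootProd j := by
  let σ := Tuple.sort fun k => -|(j k).1|
  have hd : ∀ i, (decr j i : ℝ) = wt (j (σ i)) := fun i => by
    rw [decr, wt, Int.cast_abs]
  refine ⟨σ 0, ?_⟩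
  have h1 : decrQuot j = (wt (j (σ 0)))⁻¹ * ∏ i : Fin n, wt (j (σ i.succ)) := by
    rw [decrQuot, Fin.prod_univ_succ]
    simp [hd]
  have h2 : rootProd j = √(wt (j (σ 0))) * ∏ i : Fin n, √(wt (j (σ i.succ))) := by
    rw [rootProd, ← Equiv.prod_comp σ, Fin.prod_univ_succ]
  have h3 := sqrt_prod_wt fun i : Fin n => j (σ i.succ)
  rw [h1, h2, ← Real.sqrt_eq_rpow, Real.sqrt_mul (inv_nonneg.2 (wt_pos _).le), h3, Real.sqrt_inv,
    rootProd]
  have h4 := sqrt_wt_pos (j (σ 0))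
  nth_rewrite 2 [← Real.mul_self_sqrt (wt_pos (j (σ 0))).le]
  field_simp

/-! ### The vector field of the remainder -/

/-- The sum of the terms of a form with the index `J` at the place `i`. -/
def slice (c : (Fin n → ZStar) → ℂ) (i : Fin n) (q : Ell2 s) (J : ZStar) : ℝ :=
  ∑' j : Fin n → ZStar, ‖c j‖ * ((if j i = J then 1 else 0) *
    ∏ p ∈ Finset.univ.erase i, ‖q (j p)‖)

theorem prod_norm_update (q y : Ell2 s) (i : Fin n) (j : Fin n → ZStar) :
    ∏ p, ‖Function.update (fun _ => q) i y p (j p)‖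
      = ‖y (j i)‖ * ∏ p ∈ Finset.univ.erase i, ‖q (j p)‖ := by
  rw [← Finset.mul_prod_erase _ _ (Finset.mem_univ i), Function.update_self]
  congr 1
  refine Finset.prod_congr rfl fun p hp => ?_
  rw [Function.update_of_ne (Finset.ne_of_mem_erase hp)]

theorem norm_single_apply (J k : ZStar) (z : ℂ) :
    ‖Ell2.single s J z k‖ = ‖z‖ * if k = J then 1 else 0 := by
  change ‖(Pi.single J z : ZStar → ℂ) k‖ = _
  by_cases h : k = J
  · subst h; simp
  · simp [h]

theorem summable_slice (hs : 1 < s) {A : ℝ} (hA : 0 ≤ A) {c : (Fin n → ZStar) → ℂ}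
    (hc : RootBound A c) (i : Fin n) (q : Ell2 s) (J : ZStar) :
    Summable fun j : Fin n → ZStar => ‖c j‖ * ((if j i = J then 1 else 0) *
      ∏ p ∈ Finset.univ.erase i, ‖q (j p)‖) := by
  have h := (hc.summable hs hA (Function.update (fun _ => q) i (Ell2.single s J 1))).1
  refine h.congr fun j => ?_
  rw [prod_norm_update, norm_single_apply, norm_one, one_mul]

theorem norm_form_update_single_le (hs : 1 < s) {A : ℝ} (hA : 0 ≤ A)
    {c : (Fin n → ZStar) → ℂ} (hc : RootBound A c) (i : Fin n) (q : Ell2 s) (J : ZStar) (z : ℂ) :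
    ‖form hs hA hc (Function.update (fun _ => q) i (Ell2.single s J z))‖
      ≤ ‖z‖ * slice c i q J := by
  rw [form_apply]
  refine (norm_tsum_le_tsum_norm (hc.summable_norm_term hs hA _)).trans (le_of_eq ?_)
  rw [slice, ← tsum_mul_left]
  refine tsum_congr fun j => ?_
  rw [norm_term, prod_norm_update, norm_single_apply]
  ring

/-- Summing the slices against a puts a into the place i, so the sum is part of the pairing already
estimated. -/
theorem QuotBound.sum_slice_le (hs : 1 < s) {A : ℝ} (hA : 0 ≤ A)
    {c : (Fin (n + 2) → ZStar) → ℂ} (hc : QuotBound A c) (hm : ZeroMom c) (i : Fin (n + 2))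
    (q : Ell2 s) (a : Ell2 (-s)) (S : Finset ZStar) :
    ∑ J ∈ S, ‖a J‖ * slice c i q J
      ≤ A * ((n + 2 : ℕ) : ℝ) ^ s * ((n + 1 : ℕ) * (Ell2.embConst s ^ n
        * (‖a‖ * ‖q‖ ^ (n + 1)))) := by
  obtain ⟨h1, h2⟩ := hc.summable_pairing hs hA hm i a fun _ => q
  have hprod : ∏ _p ∈ Finset.univ.erase i, ‖q‖ = ‖q‖ ^ (n + 1) := by
    rw [Finset.prod_const, Finset.card_erase_of_mem (Finset.mem_univ i), Finset.card_univ,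
      Fintype.card_fin]
    rfl
  rw [hprod] at h2
  refine le_trans ?_ h2
  have hsl := summable_slice hs hA hc.rootBound i q
  simp only [slice, ← tsum_mul_left]
  rw [← Summable.tsum_finsetSum fun J _ => (hsl J).mul_left _]
  refine Summable.tsum_le_tsum (fun j => ?_)
    (summable_sum fun J _ => (hsl J).mul_left _) h1
  have hP : 0 ≤ ∏ p ∈ Finset.univ.erase i, ‖q (j p)‖ :=
    Finset.prod_nonneg fun _ _ => norm_nonneg _
  calc ∑ J ∈ S, ‖a J‖ * (‖c j‖ * ((if j i = J then 1 else 0) *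
        ∏ p ∈ Finset.univ.erase i, ‖q (j p)‖))
      = ‖c j‖ * ((∑ J ∈ S, if j i = J then ‖a J‖ else 0) *
        ∏ p ∈ Finset.univ.erase i, ‖q (j p)‖) := by
        rw [Finset.sum_mul, Finset.mul_sum]
        refine Finset.sum_congr rfl fun J _ => ?_
        split_ifs <;> ring
    _ ≤ _ := by
        gcongr
        rw [Finset.sum_ite_eq]
        split_ifs
        · exact le_rfl
        · exact norm_nonneg _

/-- The derivative of a homogeneous polynomial. -/
def polyDeriv (hs : 1 < s) {A : ℝ} (hA : 0 ≤ A) {c : (Fin n → ZStar) → ℂ} (hc : RootBound A c)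
    (q : Ell2 s) : Ell2 s →L[ℝ] ℂ :=
  ((form hs hA hc).linearDeriv fun _ => q).comp (ContinuousLinearMap.pi fun _ => .id ℝ (Ell2 s))

theorem polyDeriv_apply (hs : 1 < s) {A : ℝ} (hA : 0 ≤ A) {c : (Fin n → ZStar) → ℂ}
    (hc : RootBound A c) (q h : Ell2 s) :
    polyDeriv hs hA hc q h = ∑ i, form hs hA hc (Function.update (fun _ => q) i h) :=
  linearDeriv_diag_apply _ _ _

theorem norm_polyDeriv_le (hs : 1 < s) {A : ℝ} (hA : 0 ≤ A) {c : (Fin (n + 1) → ZStar) → ℂ}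
    (hc : RootBound A c) (q : Ell2 s) :
    ‖polyDeriv hs hA hc q‖ ≤ (n + 1 : ℕ) * (A * Ell2.embConst s ^ (n + 1) * ‖q‖ ^ n) := by
  have hκ := Ell2.embConst_nonneg s
  refine ContinuousLinearMap.opNorm_le_bound _ (by positivity) fun h => ?_
  rw [polyDeriv_apply]
  have h1 : ∀ i, ‖form hs hA hc (Function.update (fun _ => q) i h)‖
      ≤ A * Ell2.embConst s ^ (n + 1) * ‖q‖ ^ n * ‖h‖ := fun i => by
    refine ((form hs hA hc).le_of_opNorm_le (norm_form_le hs hA hc) _).trans (le_of_eq ?_)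
    rw [← Finset.mul_prod_erase _ _ (Finset.mem_univ i), Function.update_self]
    have h2 : ∏ p ∈ Finset.univ.erase i, ‖Function.update (fun _ => q) i h p‖ = ‖q‖ ^ n := by
      rw [Finset.prod_congr rfl fun p hp => by
        rw [Function.update_of_ne (Finset.ne_of_mem_erase hp)], Finset.prod_const,
        Finset.card_erase_of_mem (Finset.mem_univ i), Finset.card_univ, Fintype.card_fin]
      rfl
    rw [h2]
    ring
  refine (norm_sum_le _ _).trans ((Finset.sum_le_sum fun i _ => h1 i).trans (le_of_eq ?_))
  rw [Finset.sum_const, Finset.card_univ, Fintype.card_fin, nsmul_eq_mul]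
  ring

/-- The remainder, as a series of homogeneous polynomials. -/
def remSeries (q : Ell2 s) : ℂ := ∑' m, poly (remTerm m) q

theorem remBound_nonneg (m : ℕ) : (0 : ℝ) ≤ 2 ^ (m + 1) * (m + 3) := by positivity

theorem two_pow_mul_pow_le {x : ℝ} (h0 : 0 ≤ x) (hx : x ≤ 1 / 4) (m : ℕ) :
    2 ^ m * x ^ (2 * m) ≤ (1 / 4) ^ m := by
  have h : x ^ 2 ≤ 1 / 8 := by nlinarith
  calc 2 ^ m * x ^ (2 * m) = (2 * x ^ 2) ^ m := by rw [mul_pow, pow_mul]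
    _ ≤ (1 / 4) ^ m := pow_le_pow_left₀ (by positivity) (by linarith) m

theorem tsum_norm_term_remTerm_le (hs : 1 < s) {q : Ell2 s} (hq : ‖q‖ ≤ goodRadius s) (m : ℕ) :
    ∑' j, ‖term (remTerm m) (fun _ => q) j‖
      ≤ (Ell2.embConst s * ‖q‖) ^ 6 * (((2 * (m + 3) : ℕ) : ℝ) ^ 1 * (1 / 4) ^ m) := by
  have h := (remTerm_quotBound m).rootBound.tsum_norm_term_le hs (remBound_nonneg m) fun _ => q
  have h0 : 0 ≤ Ell2.embConst s * ‖q‖ := mul_nonneg (Ell2.embConst_nonneg s) (norm_nonneg q)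
  have h1 := two_pow_mul_pow_le h0 (embConst_mul_le hq) m
  refine h.trans ?_
  rw [Finset.prod_const, Finset.card_univ, Fintype.card_fin]
  calc (2 : ℝ) ^ (m + 1) * (m + 3) * Ell2.embConst s ^ (2 * (m + 3)) * ‖q‖ ^ (2 * (m + 3))
      = (Ell2.embConst s * ‖q‖) ^ 6 * (2 * (m + 3) *
        (2 ^ m * (Ell2.embConst s * ‖q‖) ^ (2 * m))) := by
        simp only [mul_pow, mul_add, pow_add]
        ring
    _ ≤ (Ell2.embConst s * ‖q‖) ^ 6 * (2 * (m + 3) * (1 / 4) ^ m) := by gcongr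
    _ = _ := by push_cast; ring

theorem norm_poly_remTerm_le (hs : 1 < s) {q : Ell2 s} (hq : ‖q‖ ≤ goodRadius s) (m : ℕ) :
    ‖poly (remTerm m) q‖
      ≤ (Ell2.embConst s * ‖q‖) ^ 6 * (((2 * (m + 3) : ℕ) : ℝ) ^ 1 * (1 / 4) ^ m) :=
  (norm_tsum_le_tsum_norm ((remTerm_quotBound m).rootBound.summable_norm_term hs
    (remBound_nonneg m) _)).trans (tsum_norm_term_remTerm_le hs hq m)

theorem norm_remSeries_le (hs : 1 < s) {q : Ell2 s} (hq : ‖q‖ ≤ goodRadius s) :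
    ‖remSeries q‖ ≤ (Ell2.embConst s ^ 6 *
      ∑' m : ℕ, ((2 * (m + 3) : ℕ) : ℝ) ^ 1 * (1 / 4) ^ m) * ‖q‖ ^ 6 := by
  refine (tsum_of_norm_bounded ((summable_two_mul_pow 1).hasSum.mul_left _)
    (norm_poly_remTerm_le hs hq)).trans (le_of_eq ?_)
  ring

/-- The derivative of the term of degree `2 (m + 3)` of the remainder. -/
def remDeriv (hs : 1 < s) (m : ℕ) (q : Ell2 s) : Ell2 s →L[ℝ] ℂ :=
  polyDeriv hs (remBound_nonneg m) (remTerm_quotBound m).rootBound q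

theorem norm_remDeriv_le (hs : 1 < s) {q : Ell2 s} (hq : ‖q‖ ≤ goodRadius s) (m : ℕ) :
    ‖remDeriv hs m q‖
      ≤ Ell2.embConst s * (((2 * (m + 3) : ℕ) : ℝ) ^ 2 * (1 / 4) ^ m) := by
  have h := norm_polyDeriv_le (n := 2 * (m + 2) + 1) hs (remBound_nonneg m)
    (remTerm_quotBound m).rootBound q
  have hκ := Ell2.embConst_nonneg s
  have h0 : 0 ≤ Ell2.embConst s * ‖q‖ := mul_nonneg hκ (norm_nonneg q)
  have h4 := embConst_mul_le hq
  have h1 := two_pow_mul_pow_le h0 h4 m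
  have h5 : (Ell2.embConst s * ‖q‖) ^ 5 ≤ 1 := pow_le_one₀ h0 (by linarith)
  refine h.trans ?_
  calc ((2 * (m + 2) + 1 + 1 : ℕ) : ℝ) * (2 ^ (m + 1) * (m + 3) *
        Ell2.embConst s ^ (2 * (m + 2) + 1 + 1) * ‖q‖ ^ (2 * (m + 2) + 1))
      = Ell2.embConst s * (((2 * (m + 3) : ℕ) : ℝ) ^ 2 * (2 ^ m *
        (Ell2.embConst s * ‖q‖) ^ (2 * m))) * (Ell2.embConst s * ‖q‖) ^ 5 := by
        push_cast
        simp only [mul_pow, mul_add, pow_add]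
        ring
    _ ≤ Ell2.embConst s * (((2 * (m + 3) : ℕ) : ℝ) ^ 2 * (1 / 4) ^ m) * 1 := by gcongr
    _ = _ := mul_one _

theorem hasFDerivAt_remSeries (hs : 1 < s) {q : Ell2 s}
    (hq : q ∈ Metric.ball (0 : Ell2 s) (goodRadius s)) :
    HasFDerivAt remSeries (∑' m, remDeriv hs m q) q := by
  have hle : ∀ x ∈ Metric.ball (0 : Ell2 s) (goodRadius s), ‖x‖ ≤ goodRadius s := fun x hx =>
    (mem_ball_zero_iff.1 hx).le
  refine hasFDerivAt_tsum_of_isPreconnected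
    ((summable_two_mul_pow 2).mul_left (Ell2.embConst s)) Metric.isOpen_ball
    (convex_ball (0 : Ell2 s) (goodRadius s)).isPreconnected
    (fun m x _ => hasFDerivAt_poly hs (remBound_nonneg m) (remTerm_quotBound m).rootBound x)
    (fun m x hx => norm_remDeriv_le hs (hle x hx) m) hq ?_ hq
  exact Summable.of_norm_bounded ((summable_two_mul_pow 1).mul_left _)
    (norm_poly_remTerm_le hs (hle q hq))

/-- The constant in the bound of the vector field of the remainder. -/
def remFieldConst (s : ℝ) : ℝ :=
  Ell2.embConst s ^ 4 * ∑' m : ℕ, ((2 * (m + 3) : ℕ) : ℝ) ^ (⌈s⌉₊ + 3) * (1 / 4) ^ m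

theorem remFieldConst_nonneg (s : ℝ) : 0 ≤ remFieldConst s :=
  mul_nonneg (pow_nonneg (Ell2.embConst_nonneg s) 4) (tsum_nonneg fun _ => by positivity)

/-- With N = 2(m + 3) the powers of N come from the number of places, the constant of the
coefficients, the choice of the dominating index, and the cost N^s of moving the weight: the
exponent is ⌈s⌉ + 3. -/
theorem sum_norm_remDeriv_single_le (hs : 1 < s) {q : Ell2 s} (hq : ‖q‖ ≤ goodRadius s) (m : ℕ)
    {z : ℂ} (hz : ‖z‖ = 1) (a : Ell2 (-s)) (S : Finset ZStar) :
    ∑ J ∈ S, ‖a J‖ * ‖remDeriv hs m q (Ell2.single s J z)‖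
      ≤ Ell2.embConst s ^ 4 * ‖q‖ ^ 5 * ‖a‖ *
        (((2 * (m + 3) : ℕ) : ℝ) ^ (⌈s⌉₊ + 3) * (1 / 4) ^ m) := by
  have hκ := Ell2.embConst_nonneg s
  have hc := remTerm_quotBound m
  have h1 : ∀ J, ‖remDeriv hs m q (Ell2.single s J z)‖ ≤ ∑ i, slice (remTerm m) i q J := fun J => by
    rw [remDeriv, polyDeriv_apply]
    refine (norm_sum_le _ _).trans (Finset.sum_le_sum fun i _ => ?_)
    refine (norm_form_update_single_le hs (remBound_nonneg m) hc.rootBound i q J z).trans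
      (le_of_eq ?_)
    rw [hz, one_mul]
  calc ∑ J ∈ S, ‖a J‖ * ‖remDeriv hs m q (Ell2.single s J z)‖
      ≤ ∑ J ∈ S, ‖a J‖ * ∑ i, slice (remTerm m) i q J :=
        Finset.sum_le_sum fun J _ => mul_le_mul_of_nonneg_left (h1 J) (norm_nonneg _)
    _ = ∑ i, ∑ J ∈ S, ‖a J‖ * slice (remTerm m) i q J := by
        simp only [Finset.mul_sum]
        exact Finset.sum_comm
    _ ≤ ∑ _i : Fin (2 * (m + 3)), 2 ^ (m + 1) * (m + 3) * ((2 * (m + 2) + 2 : ℕ) : ℝ) ^ s *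
        ((2 * (m + 2) + 1 : ℕ) * (Ell2.embConst s ^ (2 * (m + 2)) *
          (‖a‖ * ‖q‖ ^ (2 * (m + 2) + 1)))) :=
        Finset.sum_le_sum fun i _ => hc.sum_slice_le (n := 2 * (m + 2)) hs (remBound_nonneg m)
          (remTerm_zeroMom m) i q a S
    _ ≤ ((2 * (m + 3) : ℕ) : ℝ) * (2 ^ (m + 1) * (m + 3) * ((2 * (m + 3) : ℕ) : ℝ) ^ ⌈s⌉₊ *
        (((2 * (m + 3) : ℕ) : ℝ) * (Ell2.embConst s ^ (2 * (m + 2)) *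
          (‖a‖ * ‖q‖ ^ (2 * (m + 2) + 1))))) := by
        rw [Finset.sum_const, Finset.card_univ, Fintype.card_fin, nsmul_eq_mul]
        have h2 : ((2 * (m + 2) + 2 : ℕ) : ℝ) ^ s ≤ ((2 * (m + 3) : ℕ) : ℝ) ^ ⌈s⌉₊ := by
          rw [← Real.rpow_natCast]
          refine Real.rpow_le_rpow_of_exponent_le ?_ (Nat.le_ceil s)
          push_cast
          linarith [m.cast_nonneg (α := ℝ)]
        have h3 : ((2 * (m + 2) + 1 : ℕ) : ℝ) ≤ ((2 * (m + 3) : ℕ) : ℝ) := by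
          push_cast
          linarith
        gcongr
    _ = Ell2.embConst s ^ 4 * ‖q‖ ^ 5 * ‖a‖ * (((2 * (m + 3) : ℕ) : ℝ) ^ (⌈s⌉₊ + 3) *
        (2 ^ m * (Ell2.embConst s * ‖q‖) ^ (2 * m))) := by
        have h2 : (2 : ℝ) ^ (m + 1) * (m + 3) = 2 ^ m * ((2 * (m + 3) : ℕ) : ℝ) := by
          push_cast
          ring
        rw [h2]
        generalize ((2 * (m + 3) : ℕ) : ℝ) = N
        simp only [mul_pow, mul_add, pow_add]
        ring
    _ ≤ _ := by
        have h2 := two_pow_mul_pow_le (mul_nonneg hκ (norm_nonneg q)) (embConst_mul_le hq) m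
        gcongr

theorem sum_norm_fderiv_single_le (hs : 1 < s) {q : Ell2 s} (hq : ‖q‖ ≤ goodRadius s)
    {z : ℂ} (hz : ‖z‖ = 1) (a : Ell2 (-s)) (S : Finset ZStar) :
    ∑ J ∈ S, ‖a J‖ * ‖(∑' m, remDeriv hs m q) (Ell2.single s J z)‖
      ≤ remFieldConst s * ‖q‖ ^ 5 * ‖a‖ := by
  have hn : Summable fun m => ‖remDeriv hs m q‖ :=
    ((summable_two_mul_pow 2).mul_left _).of_nonneg_of_le (fun _ => norm_nonneg _)
      (norm_remDeriv_le hs hq)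
  have hJ : ∀ J, Summable fun m => ‖remDeriv hs m q (Ell2.single s J z)‖ := fun J =>
    (hn.mul_right ‖Ell2.single s J z‖).of_nonneg_of_le (fun _ => norm_nonneg _)
      fun m => (remDeriv hs m q).le_opNorm _
  have h1 : ∀ J, ‖(∑' m, remDeriv hs m q) (Ell2.single s J z)‖
      ≤ ∑' m, ‖remDeriv hs m q (Ell2.single s J z)‖ := fun J => by
    have h2 : (∑' m, remDeriv hs m q) (Ell2.single s J z)
        = ∑' m, remDeriv hs m q (Ell2.single s J z) :=
      (ContinuousLinearMap.apply ℝ ℂ (Ell2.single s J z)).map_tsum hn.of_norm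
    rw [h2]
    exact norm_tsum_le_tsum_norm (hJ J)
  calc ∑ J ∈ S, ‖a J‖ * ‖(∑' m, remDeriv hs m q) (Ell2.single s J z)‖
      ≤ ∑ J ∈ S, ∑' m, ‖a J‖ * ‖remDeriv hs m q (Ell2.single s J z)‖ := by
        refine Finset.sum_le_sum fun J _ => ?_
        rw [tsum_mul_left]
        exact mul_le_mul_of_nonneg_left (h1 J) (norm_nonneg _)
    _ = ∑' m, ∑ J ∈ S, ‖a J‖ * ‖remDeriv hs m q (Ell2.single s J z)‖ :=
        (Summable.tsum_finsetSum fun J _ => (hJ J).mul_left _).symm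
    _ ≤ ∑' m : ℕ, Ell2.embConst s ^ 4 * ‖q‖ ^ 5 * ‖a‖ *
        (((2 * (m + 3) : ℕ) : ℝ) ^ (⌈s⌉₊ + 3) * (1 / 4) ^ m) :=
        Summable.tsum_le_tsum (fun m => sum_norm_remDeriv_single_le hs hq m hz a S)
          (summable_sum fun J _ => (hJ J).mul_left _) ((summable_two_mul_pow _).mul_left _)
    _ = _ := by
        rw [tsum_mul_left, remFieldConst]
        ring

/-- Duality with ℓ²_{-s} places ∂F/∂q̄ in ℓ²_s, and the factor j costs one power of the weight. Only
the derivative of F at q enters, so F may agree with the series merely near q. -/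
theorem exists_field_of_fderiv (hs : 1 < s) {q : Ell2 s} (hq : ‖q‖ ≤ goodRadius s)
    {F : Ell2 s → ℂ} (hF : HasFDerivAt F (∑' m, remDeriv hs m q) q) :
    ∃ x : Ell2 (s - 1), (∀ J : ZStar, x J = -Complex.I * (J.1 : ℂ) * dbar F q J) ∧
      ‖x‖ ≤ remFieldConst s * ‖q‖ ^ 5 := by
  have hK : 0 ≤ remFieldConst s * ‖q‖ ^ 5 :=
    mul_nonneg (remFieldConst_nonneg s) (by positivity)
  obtain ⟨y, hy, hyn⟩ := Ell2.exists_of_pairing_le (s := s) (dbar F q) hK fun a S => by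
    have h1 := sum_norm_fderiv_single_le hs hq (z := 1) (by simp) a S
    have h2 := sum_norm_fderiv_single_le hs hq (z := Complex.I) (by simp) a S
    have h3 : ∀ J, ‖a J‖ * ‖dbar F q J‖
        ≤ 1 / 2 * (‖a J‖ * ‖(∑' m, remDeriv hs m q) (Ell2.single s J 1)‖)
          + 1 / 2 * (‖a J‖ * ‖(∑' m, remDeriv hs m q) (Ell2.single s J Complex.I)‖) := fun J => by
      rw [dbar, hF.fderiv, norm_mul]
      have h4 := norm_add_le ((∑' m, remDeriv hs m q) (Ell2.single s J 1))
        (Complex.I * (∑' m, remDeriv hs m q) (Ell2.single s J Complex.I))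
      rw [norm_mul Complex.I, Complex.norm_I, one_mul] at h4
      have h5 : ‖(1 / 2 : ℂ)‖ = 1 / 2 := by norm_num
      rw [h5]
      have h6 := mul_le_mul_of_nonneg_left h4 (norm_nonneg (a J))
      linarith
    refine (Finset.sum_le_sum fun J _ => h3 J).trans ?_
    rw [Finset.sum_add_distrib, ← Finset.mul_sum, ← Finset.mul_sum]
    linarith
  have hw : ∀ J : ZStar, wt J ^ (s - 1) * ‖-Complex.I * (J.1 : ℂ) * dbar F q J‖
      = wt J ^ s * ‖y J‖ := fun J => by
    rw [norm_mul, norm_mul, norm_neg, Complex.norm_I, one_mul, Complex.norm_intCast, hy,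
      Real.rpow_sub_one (wt_pos J).ne']
    change wt J ^ s / wt J * (wt J * _) = _
    have := (wt_pos J).ne'
    field_simp
  refine Ell2.exists_of_sum_sq_le _ hK fun S => ?_
  simp only [hw]
  refine (y.summable_wt.sum_le_tsum S fun _ _ => by positivity).trans ?_
  rw [← Ell2.norm_sq_wt]
  exact pow_le_pow_left₀ (norm_nonneg _) hyn 2

/-! ### The series of monomials -/

/-- The coefficients of the remainder. -/
def remCoef : (r : ℕ) → (Fin (2 * r) → ZStar) → ℂ
  | 0 => 0
  | 1 => 0
  | 2 => 0
  | m + 3 => remTerm m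

/-- The constant 2^{m+1}(m + 3) is smaller than 4^{m+3}, independently of s, because m + 3 <
2^{m+3}. -/
theorem norm_remCoef_lt {r : ℕ} (hr : 3 ≤ r) (j : Fin (2 * r) → ZStar) :
    ‖remCoef r j‖ < 4 ^ r * decrQuot j ^ (1 / 2 : ℝ) := by
  obtain ⟨m, rfl⟩ := Nat.exists_eq_add_of_le' hr
  obtain ⟨p, hp⟩ := exists_decrQuot_mul_wt (n := 2 * (m + 2) + 1) j
  have h := remTerm_quotBound m j p
  have h1 : (2 : ℝ) ^ (m + 1) * (m + 3) < 4 ^ (m + 3) := by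
    have h2 : ((m + 3 : ℕ) : ℝ) < 2 ^ (m + 3) := by exact_mod_cast Nat.lt_two_pow_self
    push_cast at h2
    calc (2 : ℝ) ^ (m + 1) * (m + 3) ≤ 2 ^ (m + 3) * (m + 3) := by
          gcongr
          · norm_num
          · omega
      _ < 2 ^ (m + 3) * 2 ^ (m + 3) := by gcongr
      _ = 4 ^ (m + 3) := by rw [← mul_pow]; norm_num
  refine lt_of_mul_lt_mul_right ?_ (wt_pos (j p)).le
  calc ‖remTerm m j‖ * wt (j p) ≤ 2 ^ (m + 1) * (m + 3) * rootProd j := h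
    _ < 4 ^ (m + 3) * rootProd j := mul_lt_mul_of_pos_right h1 (rootProd_pos j)
    _ = 4 ^ (m + 3) * decrQuot j ^ (1 / 2 : ℝ) * wt (j p) := by
      rw [mul_assoc]
      exact congrArg _ hp.symm

theorem hasSum_remTerm_zeroMomentum (hs : 1 < s) (q : Ell2 s) (m : ℕ) :
    HasSum (fun j : zeroMomentum (m + 3) => term (remTerm m) (fun _ => q) j.1)
      (poly (remTerm m) q) := by
  have h1 : HasSum (term (remTerm m) fun _ => q) (poly (remTerm m) q) :=
    ((remTerm_quotBound m).rootBound.summable_norm_term hs (remBound_nonneg m)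
      (fun _ => q)).of_norm.hasSum
  have h2 : Function.support (term (remTerm m) fun _ => q) ⊆ zeroMomentum (m + 3) := by
    intro j hj
    by_contra h
    refine hj ?_
    have h3 : remTerm m j = 0 := remTerm_zeroMom m j h
    rw [term, h3, zero_mul]
  exact (hasSum_subtype_iff_of_support_subset h2).2 h1

theorem hasSum_remCoef (hs : 1 < s) {q : Ell2 s} (hq : ‖q‖ ≤ goodRadius s) :
    HasSum (fun x : Σ r : {r : ℕ // 3 ≤ r}, zeroMomentum r.1 =>
      remCoef x.1.1 x.2.1 * monomial x.2.1 q) (remSeries q) := by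
  let e : ℕ ≃ {r : ℕ // 3 ≤ r} :=
    { toFun := fun m => ⟨m + 3, by omega⟩
      invFun := fun r => r.1 - 3
      left_inv := fun m => by simp
      right_inv := fun r => Subtype.ext (by have := r.2; simp; omega) }
  let f : (Σ m : ℕ, zeroMomentum (m + 3)) → ℂ := fun x =>
    term (remTerm x.1) (fun _ => q) x.2.1
  have hfib : ∀ m, HasSum (fun j : zeroMomentum (m + 3) => term (remTerm m) (fun _ => q) j.1)
      (poly (remTerm m) q) := hasSum_remTerm_zeroMomentum hs q
  have hsum : Summable fun x => ‖f x‖ := by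
    have hS : ∀ m, Summable fun j : Fin (2 * (m + 3)) → ZStar =>
        ‖term (remTerm m) (fun _ => q) j‖ := fun m =>
      (remTerm_quotBound m).rootBound.summable_norm_term hs (remBound_nonneg m) (fun _ => q)
    have h1 : ∀ m, Summable fun j : zeroMomentum (m + 3) =>
        ‖term (remTerm m) (fun _ => q) j.1‖ := fun m =>
      (hS m).subtype (zeroMomentum (m + 3))
    have h2 : ∀ m, ∑' j : zeroMomentum (m + 3), ‖term (remTerm m) (fun _ => q) j.1‖
        ≤ ∑' j : Fin (2 * (m + 3)) → ZStar, ‖term (remTerm m) (fun _ => q) j‖ := fun m =>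
      (hS m).tsum_subtype_le _ (zeroMomentum (m + 3)) fun _ => norm_nonneg _
    have h3 : Summable fun m => ∑' j : zeroMomentum (m + 3),
        ‖term (remTerm m) (fun _ => q) j.1‖ := by
      refine ((summable_two_mul_pow 1).mul_left ((Ell2.embConst s * ‖q‖) ^ 6)).of_nonneg_of_le
        (fun m => tsum_nonneg fun _ => norm_nonneg _) fun m => ?_
      exact (h2 m).trans (tsum_norm_term_remTerm_le hs hq m)
    exact (summable_sigma_of_nonneg (f := fun x => ‖f x‖) fun _ => norm_nonneg _).2 ⟨h1, h3⟩
  have hf : HasSum f (remSeries q) := by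
    have h1 := hsum.of_norm.hasSum
    have h2 := (h1.sigma hfib).tsum_eq
    rw [← h2] at h1
    exact h1
  let E : (Σ m : ℕ, zeroMomentum (m + 3)) ≃ (Σ r : {r : ℕ // 3 ≤ r}, zeroMomentum r.1) :=
    Equiv.sigmaCongrLeft (β := fun r : {r : ℕ // 3 ≤ r} => zeroMomentum r.1) e
  rw [← E.hasSum_iff]
  exact hf

end Remainder

/-! ### The time one map -/

section TimeOne

open scoped ContDiff

variable {E : Type*} [NormedAddCommGroup E] [NormedSpace ℝ E]

/-- Evaluation of curves at time `1`. -/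
def endpoint : Curve E →L[ℝ] E := ContinuousMap.evalCLM ℝ ⟨1, by simp⟩

theorem endpoint_apply (γ : Curve E) : endpoint γ = γ.at 1 := (γ.at_coe ⟨1, by simp⟩).symm

theorem hasFDerivAt_endpoint_comp {Φ : E → Curve E} {q : E} (h : DifferentiableAt ℝ Φ q) :
    HasFDerivAt (fun p => endpoint (Φ p)) (endpoint.comp (fderiv ℝ Φ q)) q :=
  (endpoint (E := E)).hasFDerivAt.comp q h.hasFDerivAt

/-- Along the zero solution the linearized field vanishes, so the linearized flow is constant. -/
theorem IsFlow.hasFDerivAt_zero {n : ℕ}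
    {V : ContinuousMultilinearMap ℝ (fun _ : Fin (n + 2) => E) E} {Φ : E → Curve E}
    (h : IsFlow V Φ) :
    HasFDerivAt (fun p => endpoint (Φ p)) (ContinuousLinearEquiv.refl ℝ E : E →L[ℝ] E) 0 := by
  have hd : DifferentiableAt ℝ Φ 0 := h.analytic.self_of_nhds.differentiableAt (by simp)
  refine (hasFDerivAt_endpoint_comp hd).congr_fderiv ?_
  ext1 k
  have h0 : ∀ i : Fin (n + 2),
      liftCurve V (Function.update (fun _ => Φ 0) i (fderiv ℝ Φ 0 k)) = 0 := fun i => by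
    obtain ⟨l, hl⟩ := exists_ne i
    refine (liftCurve V).map_coord_zero l ?_
    rw [Function.update_of_ne hl, h.map_zero]
  rw [ContinuousLinearMap.comp_apply, fderiv_flow_eq hd h.eq k]
  simp only [h0, Finset.sum_const_zero, _root_.map_zero, add_zero]
  rfl

/-- Near the origin the time one map of a flow is an analytic coordinate transformation; its domain
may be taken within any neighbourhood of the origin. -/
theorem IsFlow.exists_openPartialHomeomorph [CompleteSpace E] {n : ℕ}
    {V : ContinuousMultilinearMap ℝ (fun _ : Fin (n + 2) => E) E} {Φ : E → Curve E}
    (h : IsFlow V Φ) {p : E → Prop} (hp : ∀ᶠ q in 𝓝 0, p q) :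
    ∃ Ψ : OpenPartialHomeomorph E E, (∀ q, Ψ q = endpoint (Φ q)) ∧ 0 ∈ Ψ.source ∧
      (∀ q ∈ Ψ.source, p q) ∧ AnalyticOnNhd ℝ Ψ Ψ.source ∧ AnalyticOnNhd ℝ Ψ.symm Ψ.target := by
  let f : E → E := fun q => endpoint (Φ q)
  have hf0 : f 0 = 0 := by simp only [f, h.map_zero, _root_.map_zero]
  have hf : ∀ᶠ q in 𝓝 0, ContDiffAt ℝ ω f q := by
    filter_upwards [h.analytic] with q hq
    exact (endpoint (E := E)).contDiff.contDiffAt.comp q hq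
  have hfa : ContDiffAt ℝ ω f 0 := hf.self_of_nhds
  let P := hfa.toOpenPartialHomeomorph f h.hasFDerivAt_zero (by simp)
  have hP : (P : E → E) = f := rfl
  have h0 : 0 ∈ P.source := hfa.mem_toOpenPartialHomeomorph_source h.hasFDerivAt_zero (by simp)
  have hi : ∀ᶠ y in 𝓝 (f 0), ContDiffAt ℝ ω P.symm y :=
    (hfa.to_localInverse h.hasFDerivAt_zero (by simp)).eventually (by simp)
  have hi' : ∀ᶠ q in 𝓝 0, ContDiffAt ℝ ω P.symm (f q) := hfa.continuousAt.eventually hi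
  -- Analyticity of the inverse is known near f 0; pulled back by f it becomes one more open
  -- condition on q, and the domain is shrunk to meet all conditions at once.
  obtain ⟨U, hU, hUo, hU0⟩ := eventually_nhds_iff.1 (hp.and (hf.and hi'))
  refine ⟨P.restrOpen U hUo, fun q => rfl, ⟨h0, hU0⟩, fun q hq => (hU q hq.2).1,
    fun q hq => (hU q hq.2).2.1.analyticAt, fun y hy => ?_⟩
  have hy' : y ∈ P.target ∧ P.symm y ∈ U := by
    simpa using hy
  have h1 := (hU _ hy'.2).2.2
  rw [← hP, P.right_inv hy'.1] at h1
  exact h1.analyticAt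

end TimeOne

/-! ### The normal form -/

section NormalForm

open scoped ContDiff

variable {s : ℝ}

theorem contDiff_poly {n : ℕ} (hs : 1 < s) {A : ℝ} (hA : 0 ≤ A) {c : (Fin n → ZStar) → ℂ}
    (hc : RootBound A c) : ContDiff ℝ ω (poly c : Ell2 s → ℂ) :=
  contDiff_diag (form hs hA hc)

theorem contDiff_H (hs : 1 < s) : ContDiff ℝ ω (H : Ell2 s → ℂ) := by
  have h : (H : Ell2 s → ℂ) = fun q => poly lamCoef q + poly quarticCoef q := by
    funext q
    rw [H, lam_eq_poly, G_eq_poly]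
  rw [h]
  exact (contDiff_poly hs zero_le_one lamCoef_rootBound).add
    (contDiff_poly hs zero_le_one quarticCoef_quotBound.rootBound)

theorem contDiff_Lam_add_B (hs : 1 < s) :
    ContDiff ℝ ω (fun q : Ell2 s => (Lam q : ℂ) + B q) := by
  simp only [lam_eq_poly, B_eq_poly hs]
  exact (contDiff_poly hs zero_le_one lamCoef_rootBound).add
    ((contDiff_poly hs zero_le_one quarticCoef_quotBound.rootBound).add
      (contDiff_poly hs zero_le_one nonresCoef_quotBound.rootBound))

theorem ofReal_re_H (q : Ell2 s) : ((H q).re : ℂ) = H q := by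
  refine Complex.conj_eq_iff_re.1 ?_
  rw [H, map_add, conj_G, Complex.conj_ofReal]

/-- The remainder of the Hamiltonian in the coordinates `f`. -/
def remainder (f : Ell2 s → Ell2 s) (q : Ell2 s) : ℝ := (H (f q) - (Lam q + B q)).re

/-- This holds for every map f since H, Λ and B are real; all content is in identifying the
remainder with the series. -/
theorem H_eq_add_remainder (f : Ell2 s → Ell2 s) (q : Ell2 s) :
    H (f q) = (Lam q : ℂ) + (B q : ℂ) + (remainder f q : ℂ) := by
  rw [remainder, Complex.sub_re, Complex.ofReal_sub, ofReal_re_H, ← Complex.ofReal_add,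
    Complex.ofReal_re]
  ring

theorem analyticAt_remainder (hs : 1 < s) {f : Ell2 s → Ell2 s} {q : Ell2 s}
    (hf : AnalyticAt ℝ f q) : AnalyticAt ℝ (remainder f) q := by
  have h1 : AnalyticAt ℝ (fun q => H (f q) - ((Lam q : ℂ) + B q)) q :=
    ((contDiff_H hs).contDiffAt.analyticAt.comp hf).sub
      (contDiff_Lam_add_B hs).contDiffAt.analyticAt
  exact (Complex.reCLM.analyticAt _).comp h1

/-- The condition on the initial value under which the solution is used. -/
structure IsGoodStart (hs : 1 < s) (Φ : Ell2 s → Curve (Ell2 s)) (q : Ell2 s) : Prop where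
  differentiable : DifferentiableAt ℝ Φ q
  eq : ∀ᶠ p in 𝓝 q, Φ p = constCurve p + primitive (liftCurve (field hs) fun _ => Φ p)
  norm_lt : ‖Φ q‖ < goodRadius s

theorem IsFlow.eventually_isGoodStart (hs : 1 < s) {Φ : Ell2 s → Curve (Ell2 s)}
    (h : IsFlow (field hs) Φ) : ∀ᶠ q in 𝓝 0, IsGoodStart hs Φ q := by
  have h1 : Filter.Tendsto (fun q => ‖Φ q‖) (𝓝 0) (𝓝 ‖Φ 0‖) :=
    h.analytic.self_of_nhds.continuousAt.norm
  rw [h.map_zero, norm_zero] at h1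
  filter_upwards [h.analytic, eventually_eventually_nhds.2 h.eq,
    h1.eventually_lt_const (goodRadius_pos s)] with q ha he hn
  exact ⟨ha.differentiableAt (by simp), he, hn⟩

namespace IsGoodStart

variable {hs : 1 < s} {Φ : Ell2 s → Curve (Ell2 s)} {q : Ell2 s}

theorem norm_lt' (h : IsGoodStart hs Φ q) : ‖q‖ < goodRadius s := by
  have h1 := (Φ q).norm_at_le 0
  rw [at_zero_of_eq h.eq.self_of_nhds] at h1
  exact h1.trans_lt h.norm_lt

theorem remainder_eq (h : IsGoodStart hs Φ q) :
    (remainder (fun p => endpoint (Φ p)) q : ℂ) = remSeries q := by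
  have h1 := hasSum_remTerm_flow hs (γ := (Φ q).at)
    (fun t ht => hasDerivWithinAt_of_eq h.eq.self_of_nhds ht)
    fun t => ((Φ q).norm_at_le t).trans h.norm_lt.le
  rw [at_zero_of_eq h.eq.self_of_nhds, ← endpoint_apply] at h1
  rw [remSeries, h1.tsum_eq, H_eq_add_remainder (fun p => endpoint (Φ p)) q]
  ring

theorem symplForm_fderiv (h : IsGoodStart hs Φ q) (a b : Ell2 s) :
    symplForm (fderiv ℝ (fun p => endpoint (Φ p)) q a) (fderiv ℝ (fun p => endpoint (Φ p)) q b)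
      = symplForm a b := by
  rw [(hasFDerivAt_endpoint_comp h.differentiable).fderiv, ContinuousLinearMap.comp_apply,
    ContinuousLinearMap.comp_apply, endpoint_apply, endpoint_apply]
  exact symplectic_flow (symplBilin (by linarith : 0 ≤ s)) (symplBilin_linearized_field hs)
    h.differentiable h.eq a b

end IsGoodStart

end NormalForm

end DNLS

end

/-! ### The normal form theorem -/

theorem theorem1 :
    ∃ C : ℝ, 0 < C ∧ ∀ s : ℝ, 1 < s →
      ∃ (Ψ : OpenPartialHomeomorph (DNLS.Ell2 s) (DNLS.Ell2 s)) (R : DNLS.Ell2 s → ℝ),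
        DNLS.IsAnalyticSymplectic Ψ ∧
        -- the transformed Hamiltonian
        (∀ q ∈ Ψ.source,
          DNLS.H (Ψ q) = (DNLS.Lam q : ℂ) + (DNLS.B q : ℂ) + (R q : ℂ)) ∧
        -- the remainder is analytic and of order at least six
        AnalyticOnNhd ℝ R Ψ.source ∧
        R =O[𝓝 0] (fun q => ‖q‖ ^ 6) ∧
        -- its vector field maps into `ℓ²_{s-1}` and is of order five there
        (∃ X : DNLS.Ell2 s → DNLS.Ell2 (s - 1),
          (∀ q ∈ Ψ.source, ∀ j : DNLS.ZStar, X q j = DNLS.hamVec R q j) ∧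
          X =O[𝓝 0] (fun q => ‖q‖ ^ 5)) ∧
        -- its expansion in monomials of zero momentum, with the bound of the coefficients
        ∃ c : (r : ℕ) → (Fin (2 * r) → DNLS.ZStar) → ℂ,
          (∀ q ∈ Ψ.source,
            HasSum
              (fun x : Σ r : {r : ℕ // 3 ≤ r}, DNLS.zeroMomentum r.1 =>
                c x.1.1 x.2.1 * DNLS.monomial x.2.1 q)
              (R q : ℂ)) ∧
          ∀ r : ℕ, 3 ≤ r → ∀ j ∈ DNLS.zeroMomentum r,
            ‖c r j‖ < C ^ r * DNLS.decrQuot j ^ (1 / 2 : ℝ) := by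
  refine ⟨4, by norm_num, fun s hs => ?_⟩
  obtain ⟨Φ, hΦ⟩ := DNLS.exists_isFlow (DNLS.field hs)
  obtain ⟨Ψ, hΨ, h0, hgood, han, han'⟩ :=
    hΦ.exists_openPartialHomeomorph (DNLS.IsFlow.eventually_isGoodStart hs hΦ)
  have hfun : (Ψ : DNLS.Ell2 s → DNLS.Ell2 s) = fun q => DNLS.endpoint (Φ q) := funext hΨ
  have hR : ∀ q ∈ Ψ.source, (DNLS.remainder Ψ q : ℂ) = DNLS.remSeries q := fun q hq => by
    rw [hfun]
    exact (hgood q hq).remainder_eq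
  have hU : ∀ᶠ q in 𝓝 0, q ∈ Ψ.source := Ψ.open_source.mem_nhds h0
  have hX : ∀ q ∈ Ψ.source, ∃ x : DNLS.Ell2 (s - 1),
      (∀ j : DNLS.ZStar, x j = DNLS.hamVec (DNLS.remainder Ψ) q j) ∧
        ‖x‖ ≤ DNLS.remFieldConst s * ‖q‖ ^ 5 := fun q hq => by
    have hn := (hgood q hq).norm_lt'
    refine DNLS.exists_field_of_fderiv hs hn.le ?_
    -- The remainder equals the series on the open source only, which suffices for its derivative.
    refine (DNLS.hasFDerivAt_remSeries hs (mem_ball_zero_iff.2 hn)).congr_of_eventuallyEq ?_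
    filter_upwards [Ψ.open_source.mem_nhds hq] with p hp using hR p hp
  -- Outside the source X takes arbitrary values, which the estimate near 0 does not see.
  choose! X hXj hXn using hX
  refine ⟨Ψ, DNLS.remainder Ψ, ⟨h0, ?_, han, han', fun q hq h k => ?_⟩,
    fun q _ => DNLS.H_eq_add_remainder Ψ q, fun q hq => DNLS.analyticAt_remainder hs (han q hq),
    ?_, ⟨X, hXj, ?_⟩, DNLS.remCoef, fun q hq => ?_, fun r hr j _ => DNLS.norm_remCoef_lt hr j⟩
  · rw [hΨ, hΦ.map_zero, map_zero]
  · rw [hfun]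
    exact (hgood q hq).symplForm_fderiv h k
  · refine IsBigO.of_bound (DNLS.Ell2.embConst s ^ 6 *
      ∑' m : ℕ, ((2 * (m + 3) : ℕ) : ℝ) ^ 1 * (1 / 4) ^ m) ?_
    filter_upwards [hU] with q hq
    rw [← Complex.norm_real, hR q hq, norm_pow, norm_norm]
    exact DNLS.norm_remSeries_le hs (hgood q hq).norm_lt'.le
  · refine IsBigO.of_bound (DNLS.remFieldConst s) ?_
    filter_upwards [hU] with q hq
    rw [norm_pow, norm_norm]
    exact hXn q hq
  · rw [hR q hq]
    exact DNLS.hasSum_remCoef hs (hgood q hq).norm_lt'.le
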